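/- Let $1<q<2$ and $\frac1p+\frac1q=1$; scalars are real or complex. **Spaces.** For a positive sequence $u=(u_j)$ let $\mathfrak X_{p,u}$ be the Banach space of all scalar sequences $a$ with $\|a\|=\max\{(\sum_j|a_j|^p)^{1/p},(\sum_j|a_ju_j|^2)^{1/2}\}<\infty$, let $\mathfrak X_{q,u}:=\mathfrak X_{p,u}^*$, and let $h^u_j\in\mathfrak X_{q,u}$ be the $j$-th coordinate functional. If $v,w$ are positive sequences with $w_j/v_j\le 1$ for all $j$ and $w_j/v_j\to0$, let $\Delta:\mathfrak X_{p,w}\to\mathfrak X_{p,v}$ be $\Delta a=((w_j/v_j)a_j)_j$, and let $\Delta^*:\mathfrak X_{q,v}\to\mathfrak X_{q,w}$ be its adjoint. **Constants.** For a bounded operator $T:E\to Y$ between normed spaces, $\gamma_2(T)=\inf\{\|A\|\|B\| : T=AB,\ B:E\to H,\ A:H\to Y,\ H \text{ a Hilbert space}\}$. For a finite dimensional normed space $E$, $d(E)$ is the Banach–Mazur distance of $E$ to the Euclidean space of the same dimension. **Choice of weights.** Fix $\delta_i\in(0,1]$ decreasing to $0$, a nondecreasing sequence $r_i$ with $q<r_i<2$,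 $r_i\to2$ and $\delta_i^{q(2-r_i)/(2-q)}>\frac12$ for all $i$, and nonnegative integers $n_i$ with $n_i^{1/r_i-1/2}\to\infty$. Call a pair $(v,w)$ of positive sequences with $w_j/v_j\le1$ and $w_j/v_j\to0$ *admissible* if there are two sequences $(Y_j)$ and $(Z_j)$ of random variables on a probability space, each sequence consisting of independent symmetric three-valued variables (with values $c_j,0,-c_j$) normalized in $L_q$, such that $v_j=1/\|Y_j\|_2$ and $w_j=1/\|Z_j\|_2$, and there are pairwise disjoint finite sets $\sigma_{i,l}$ ($1\le l\le n_i$) of indices, scalars $a_j$ and a constant $C>0$ such that $w_j=\delta_iv_j$ for $j\in\sigma_{i,l}$ and, for every $i$ and all scalars $c_1,\dots,c_{n_i}$, $$C^{-1}\Big(\sum_l|c_l|^{r_i}\Big)^{1/r_i}\le\Big\|\sum_lc_l\sum_{j\in\sigma_{i,l}}a_jY_j\Big\|_{L_q}\le C\Big(\sum_l|c_l|^{r_i}\Big)^{1/r_i},$$ and the same holds with $\delta_ia_jZ_j$ in place of $a_jY_j$. **Claim.** There is an admissible pair $(v,w)$ for which there exists an isomorphism of $\mathfrak X_{q,w}$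 onto $\mathfrak X_{q,v}$ of norm one. Moreover, for every admissible pair $(v,w)$ and every isomorphism $S$ of norm one from $\mathfrak X_{q,w}$ onto $\mathfrak X_{q,v}$, the space $X=\mathfrak X_{q,v}$ and the operator $T=S\Delta^*:X\to X$ satisfy the following: $(h^v_j)$ is a $1$-unconditional basis of $X$; $\|T\|\le1$; and (a) there is $\eta>0$ such that for every $M$ there is a finite dimensional subspace $E$ of $X$ with $d(E)>M$ and $\|Tx\|>\eta\|x\|$ for all nonzero $x\in E$; (b) there is a constant $\Gamma$ such that for every $m$ there is an $n$ such that every $m$-dimensional subspace $E$ of the closed linear span of $\{h^v_j:j\ge n\}$ satisfies $\gamma_2(T|_E)\le\Gamma$. -/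

import Mathlib

open Filter Topology MeasureTheory ProbabilityTheory
open scoped ENNReal NNReal

universe u

noncomputable section

/-! ### Factorization through a Hilbert space, Euclidean distance, unconditional bases -/

/-- The factorization constant `γ₂(T)` of an operator through a Hilbert space: the infimum of
`‖A‖ ‖B‖` over all factorizations `T = A B` with `B : E → H`, `A : H → Y` bounded and `H` a Hilbert
space (`∞` if there is no such factorization). -/
def gammaTwo {𝕜 : Type*} [RCLike 𝕜] {E : Type u} [NormedAddCommGroup E] [NormedSpace 𝕜 E]
    {Y : Type*} [NormedAddCommGroup Y] [NormedSpace 𝕜 Y] (T : E →L[𝕜] Y) : ℝ≥0∞ :=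
  sInf {c : ℝ≥0∞ | ∃ (H : Type u) (_ : NormedAddCommGroup H) (_ : InnerProductSpace 𝕜 H)
    (_ : CompleteSpace H) (A : H →L[𝕜] Y) (B : E →L[𝕜] H), T = A.comp B ∧ c = ‖A‖ₑ * ‖B‖ₑ}

/-- The Banach–Mazur distance `d(E)` of a finite dimensional normed space `E` to the Euclidean space
of the same dimension. -/
def euclideanDist (𝕜 : Type*) [RCLike 𝕜] (E : Type*) [NormedAddCommGroup E] [NormedSpace 𝕜 E] :
    ℝ≥0∞ :=
  sInf {c : ℝ≥0∞ | ∃ φ : E ≃L[𝕜] EuclideanSpace 𝕜 (Fin (Module.finrank 𝕜 E)),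
    c = ‖(φ : E →L[𝕜] EuclideanSpace 𝕜 (Fin (Module.finrank 𝕜 E)))‖ₑ *
      ‖(φ.symm : EuclideanSpace 𝕜 (Fin (Module.finrank 𝕜 E)) →L[𝕜] E)‖ₑ}

/-- `e` is a `1`-unconditional basis of `X`: it is an unconditional Schauder basis, and changing the
signs (moduli one multiples) of the coefficients does not change the norm. -/
def IsOneUnconditionalBasis (𝕜 : Type*) [RCLike 𝕜] {X : Type*} [NormedAddCommGroup X]
    [NormedSpace 𝕜 X] (e : ℕ → X) : Prop :=
  (∃ b : UnconditionalSchauderBasis ℕ 𝕜 X, b.basis = e) ∧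
    ∀ (s : Finset ℕ) (a θ : ℕ → 𝕜), (∀ i, ‖θ i‖ = 1) →
      ‖∑ i ∈ s, (θ i * a i) • e i‖ = ‖∑ i ∈ s, a i • e i‖

/-- Condition (a): for some `η > 0` there are finite dimensional subspaces `E`, arbitrarily far from
Euclidean spaces, with `‖T x‖ > η ‖x‖` for all nonzero `x ∈ E`. -/
def PreservesFarFromEuclidean {𝕜 : Type*} [RCLike 𝕜] {X Y : Type*} [NormedAddCommGroup X]
    [NormedSpace 𝕜 X] [NormedAddCommGroup Y] [NormedSpace 𝕜 Y] (T : X →L[𝕜] Y) : Prop :=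
  ∃ η : ℝ, 0 < η ∧ ∀ M : ℝ≥0, ∃ E : Submodule 𝕜 X, FiniteDimensional 𝕜 E ∧
    (M : ℝ≥0∞) < euclideanDist 𝕜 E ∧ ∀ x ∈ E, x ≠ 0 → η * ‖x‖ < ‖T x‖

/-- Condition (b): for some constant `Γ` and every `m` there is an `n` such that
`γ₂(T|E) ≤ Γ` for every `m`-dimensional subspace `E` of the closed linear span of `(e i)`, `i ≥ n`. -/
def HilbertianOnTails {𝕜 : Type*} [RCLike 𝕜] {X Y : Type*} [NormedAddCommGroup X]
    [NormedSpace 𝕜 X] [NormedAddCommGroup Y] [NormedSpace 𝕜 Y] (e : ℕ → X) (T : X →L[𝕜] Y) :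
    Prop :=
  ∃ Γ : ℝ≥0, ∀ m : ℕ, ∃ n : ℕ, ∀ E : Submodule 𝕜 X, FiniteDimensional 𝕜 E →
    Module.finrank 𝕜 E = m → E ≤ (Submodule.span 𝕜 (e '' Set.Ici n)).topologicalClosure →
      gammaTwo (T.comp E.subtypeL) ≤ (Γ : ℝ≥0∞)

/-! ### The spaces `𝔛_{p,u}` and their duals -/

/-- The scalar sequence space `ℓ_p`. -/
abbrev SeqLp (𝕜 : Type*) [RCLike 𝕜] (p : ℝ≥0∞) : Type _ := lp (fun _ : ℕ => 𝕜) p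

/-- The subspace of `ℓ_p ⊕_∞ ℓ_2` (the product norm in Mathlib is the maximum) of all pairs
`(a, a u)`. -/
def rosenthalSubspace (𝕜 : Type*) [RCLike 𝕜] (p : ℝ≥0∞) [Fact (1 ≤ p)] (u : ℕ → ℝ) :
    Submodule 𝕜 (SeqLp 𝕜 p × SeqLp 𝕜 2) where
  carrier := {x | ∀ j, x.2 j = (u j : 𝕜) * x.1 j}
  add_mem' {x y} hx hy j := by
    have h1 := hx j
    have h2 := hy j
    simp only [Prod.snd_add, Prod.fst_add, lp.coeFn_add, Pi.add_apply, h1, h2]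
    ring
  zero_mem' j := by simp
  smul_mem' c x hx j := by
    have h1 := hx j
    simp only [Prod.smul_snd, Prod.smul_fst, lp.coeFn_smul, Pi.smul_apply, smul_eq_mul, h1]
    ring

/-- The space `𝔛_{p,u}`: the sequences `a` for which the norm
`max {(∑ |a j|^p)^(1/p), (∑ |a j u j|²)^(1/2)}` is finite, represented by the pairs `(a, a u)` in
`ℓ_p ⊕_∞ ℓ_2`. -/
def RosenthalX (𝕜 : Type*) [RCLike 𝕜] (p : ℝ≥0∞) [Fact (1 ≤ p)] (u : ℕ → ℝ) : Type _ :=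
  rosenthalSubspace 𝕜 p u

instance RosenthalX.instNormedAddCommGroup (𝕜 : Type*) [RCLike 𝕜] (p : ℝ≥0∞) [Fact (1 ≤ p)]
    (u : ℕ → ℝ) : NormedAddCommGroup (RosenthalX 𝕜 p u) :=
  inferInstanceAs (NormedAddCommGroup (rosenthalSubspace 𝕜 p u))

instance RosenthalX.instNormedSpace (𝕜 : Type*) [RCLike 𝕜] (p : ℝ≥0∞) [Fact (1 ≤ p)]
    (u : ℕ → ℝ) : NormedSpace 𝕜 (RosenthalX 𝕜 p u) :=
  inferInstanceAs (NormedSpace 𝕜 (rosenthalSubspace 𝕜 p u))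

/-- The isometric embedding `a ↦ (a, a u)` of `𝔛_{p,u}` into `ℓ_p ⊕_∞ ℓ_2`. -/
def RosenthalX.embed (𝕜 : Type*) [RCLike 𝕜] (p : ℝ≥0∞) [Fact (1 ≤ p)] (u : ℕ → ℝ) :
    RosenthalX 𝕜 p u →ₗᵢ[𝕜] SeqLp 𝕜 p × SeqLp 𝕜 2 where
  toFun x := x.1
  map_add' _ _ := rfl
  map_smul' _ _ := rfl
  norm_map' _ := rfl

/-- The space `𝔛_{q,u} := 𝔛_{p,u}^*`, where `1/p + 1/q = 1`; it is indexed by the exponent `p` of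
its predual. -/
abbrev RosenthalXDual (𝕜 : Type*) [RCLike 𝕜] (p : ℝ≥0∞) [Fact (1 ≤ p)] (u : ℕ → ℝ) : Type _ :=
  StrongDual 𝕜 (RosenthalX 𝕜 p u)

/-- The basis `h^u` of `𝔛_{q,u}` dual to the unit vector basis of `𝔛_{p,u}`: the `j`-th vector is
the `j`-th coordinate functional `a ↦ a j`. -/
def dualUnitVector (𝕜 : Type*) [RCLike 𝕜] (p : ℝ≥0∞) [Fact (1 ≤ p)] (u : ℕ → ℝ) (j : ℕ) :
    RosenthalXDual 𝕜 p u :=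
  ((lp.evalCLM 𝕜 (fun _ : ℕ => 𝕜) p j).comp
    (ContinuousLinearMap.fst 𝕜 (SeqLp 𝕜 p) (SeqLp 𝕜 2))).comp
      (RosenthalX.embed 𝕜 p u).toContinuousLinearMap

/-! ### The diagonal operator `Δ` -/

/-- A pair of positive weights `v`, `w` with `w j / v j ≤ 1` and `w j / v j → 0`. -/
structure WeightPair where
  /-- The larger weight. -/
  v : ℕ → ℝ
  /-- The smaller weight. -/
  w : ℕ → ℝ
  v_pos : ∀ j, 0 < v j
  w_pos : ∀ j, 0 < w j
  ratio_le_one : ∀ j, w j / v j ≤ 1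
  ratio_tendsto : Tendsto (fun j => w j / v j) atTop (𝓝 0)

/-- The diagonal operator `a ↦ (d j * a j)` on `ℓ_p`, for real multipliers `|d j| ≤ 1`. -/
def lpDiag (𝕜 : Type*) [RCLike 𝕜] (p : ℝ≥0∞) [Fact (1 ≤ p)] (d : ℕ → ℝ) (hd : ∀ j, |d j| ≤ 1) :
    SeqLp 𝕜 p →L[𝕜] SeqLp 𝕜 p :=
  have key : ∀ (x : SeqLp 𝕜 p) (j : ℕ), ‖(d j : 𝕜) * x j‖ ≤ ‖x j‖ := fun x j => by
    rw [norm_mul, RCLike.norm_ofReal]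
    exact mul_le_of_le_one_left (norm_nonneg _) (hd j)
  LinearMap.mkContinuous
    { toFun := fun x => ⟨fun j => (d j : 𝕜) * x j, (lp.memℓp x).mono' (key x)⟩
      map_add' := fun x y => by
        ext j
        exact mul_add _ _ _
      map_smul' := fun c x => by
        ext j
        exact mul_left_comm _ _ _ }
    1 (fun x => by
      rw [one_mul]
      exact lp.norm_mono (zero_lt_one.trans_le (Fact.out : 1 ≤ p)).ne' (key x))

theorem WeightPair.abs_ratio_le_one (W : WeightPair) (j : ℕ) : |W.w j / W.v j| ≤ 1 := by
  rw [abs_of_pos (div_pos (W.w_pos j) (W.v_pos j))]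
  exact W.ratio_le_one j

/-- The operator `K` on `ℓ_p ⊕_∞ ℓ_2` which is diagonal with multipliers `w j / v j` on `ℓ_p` and
the identity on `ℓ_2`. -/
def WeightPair.K (𝕜 : Type*) [RCLike 𝕜] (p : ℝ≥0∞) [Fact (1 ≤ p)] (W : WeightPair) :
    (SeqLp 𝕜 p × SeqLp 𝕜 2) →L[𝕜] (SeqLp 𝕜 p × SeqLp 𝕜 2) :=
  (lpDiag 𝕜 p (fun j => W.w j / W.v j) W.abs_ratio_le_one).prodMap
    (ContinuousLinearMap.id 𝕜 (SeqLp 𝕜 2))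

/-- The diagonal operator `Δ : 𝔛_{p,w} → 𝔛_{p,v}`, `Δ g_j^w = (w j / v j) g_j^v`, as the restriction
of `K`: it sends `a` to the sequence with entries `(w j / v j) a j`. -/
def WeightPair.Delta (𝕜 : Type*) [RCLike 𝕜] (p : ℝ≥0∞) [Fact (1 ≤ p)] (W : WeightPair) :
    RosenthalX 𝕜 p W.w →L[𝕜] RosenthalX 𝕜 p W.v :=
  have key : ∀ x : RosenthalX 𝕜 p W.w,
      W.K 𝕜 p (RosenthalX.embed 𝕜 p W.w x) ∈ rosenthalSubspace 𝕜 p W.v := by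
    rintro ⟨x, hx⟩ j
    have h1 : x.2 j = (W.w j : 𝕜) * x.1 j := hx j
    have h2 : (W.v j : 𝕜) ≠ 0 := by exact_mod_cast (W.v_pos j).ne'
    change x.2 j = (W.v j : 𝕜) * (((W.w j / W.v j : ℝ) : 𝕜) * x.1 j)
    rw [h1]
    push_cast
    field_simp
  LinearMap.mkContinuous
    { toFun := fun x => (⟨W.K 𝕜 p (RosenthalX.embed 𝕜 p W.w x), key x⟩ :
        rosenthalSubspace 𝕜 p W.v)
      map_add' := fun x y => Subtype.ext (by
        change W.K 𝕜 p (RosenthalX.embed 𝕜 p W.w (x + y)) =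
          W.K 𝕜 p (RosenthalX.embed 𝕜 p W.w x) + W.K 𝕜 p (RosenthalX.embed 𝕜 p W.w y)
        rw [map_add, map_add])
      map_smul' := fun c x => Subtype.ext (by
        change W.K 𝕜 p (RosenthalX.embed 𝕜 p W.w (c • x)) =
          c • W.K 𝕜 p (RosenthalX.embed 𝕜 p W.w x)
        rw [map_smul, map_smul]) }
    ‖W.K 𝕜 p‖ (fun x => by
      change ‖W.K 𝕜 p (RosenthalX.embed 𝕜 p W.w x)‖ ≤ ‖W.K 𝕜 p‖ * ‖x‖
      rw [← (RosenthalX.embed 𝕜 p W.w).norm_map x]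
      exact (W.K 𝕜 p).le_opNorm _)

/-- The (Banach space) adjoint `Δ^* : 𝔛_{q,v} → 𝔛_{q,w}`, `f ↦ f ∘ Δ`. -/
def WeightPair.DeltaAdj (𝕜 : Type*) [RCLike 𝕜] (p : ℝ≥0∞) [Fact (1 ≤ p)] (W : WeightPair) :
    RosenthalXDual 𝕜 p W.v →L[𝕜] RosenthalXDual 𝕜 p W.w :=
  ContinuousLinearMap.precomp 𝕜 (W.Delta 𝕜 p)

/-! ### The choice of the weights -/

/-- `Y` is a sequence of independent, symmetric, three valued random variables (`Y j` takes the
values `c`, `0`, `-c`, the values `c` and `-c` with equal probability), normalized in `L_q`. -/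
structure IsThreeValuedSystem {Ω : Type*} [MeasurableSpace Ω] (P : Measure Ω) (q : ℝ)
    (Y : ℕ → Ω → ℝ) : Prop where
  measurable : ∀ j, Measurable (Y j)
  indep : iIndepFun Y P
  symm_three_valued : ∀ j, ∃ c : ℝ, 0 < c ∧ (∀ᵐ ω ∂P, Y j ω = c ∨ Y j ω = 0 ∨ Y j ω = -c) ∧
    P {ω | Y j ω = c} = P {ω | Y j ω = -c}
  normalized : ∀ j, eLpNorm (Y j) (ENNReal.ofReal q) P = 1

/-- The functions `y 1, …, y N` are, in `L_q(P)`, `C`-equivalent to the unit vector basis of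
`ℓ_r^N`. -/
def IsEquivToEllR {𝕜 : Type*} [RCLike 𝕜] {Ω : Type*} [MeasurableSpace Ω] (P : Measure Ω)
    (q r C : ℝ) {N : ℕ} (y : Fin N → Ω → 𝕜) : Prop :=
  ∀ c : Fin N → 𝕜,
    C⁻¹ * (∑ l, ‖c l‖ ^ r) ^ (1 / r) ≤
        (eLpNorm (fun ω => ∑ l, c l * y l ω) (ENNReal.ofReal q) P).toReal ∧
      (eLpNorm (fun ω => ∑ l, c l * y l ω) (ENNReal.ofReal q) P).toReal ≤
        C * (∑ l, ‖c l‖ ^ r) ^ (1 / r)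

/-- The weights `v`, `w` arise from the parameters `δ i`, `r i`, `n i`: they are
`v j = 1 / ‖Y j‖₂`, `w j = 1 / ‖Z j‖₂` for two sequences of independent symmetric three valued random
variables normalized in `L_q`, there are pairwise disjoint finite sets `σ (i, l)`, `l < n i`, with
`w j = δ i * v j` on `σ (i, l)`, and there are coefficients `a j` and a constant `C` such that, for
every `i`, the block sums `∑_{j ∈ σ (i, l)} a j Y j`, `l < n i`, and likewise the block sums
`∑_{j ∈ σ (i, l)} δ i a j Z j`, are `C`-equivalent in `L_q` to the unit vector basis of
`ℓ_{r i}^{n i}`. -/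
def IsBlockWeightChoice (𝕜 : Type*) [RCLike 𝕜] (q : ℝ) (δ r : ℕ → ℝ) (n : ℕ → ℕ)
    (W : WeightPair) : Prop :=
  ∃ (Ω : Type) (_ : MeasurableSpace Ω) (P : Measure Ω) (_ : IsProbabilityMeasure P)
    (Y Z : ℕ → Ω → ℝ) (σ : (Σ i, Fin (n i)) → Finset ℕ) (a : ℕ → 𝕜) (C : ℝ),
    IsThreeValuedSystem P q Y ∧ IsThreeValuedSystem P q Z ∧
    (∀ j, W.v j = (eLpNorm (Y j) 2 P).toReal⁻¹) ∧
    (∀ j, W.w j = (eLpNorm (Z j) 2 P).toReal⁻¹) ∧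
    (Pairwise fun b b' => Disjoint (σ b) (σ b')) ∧
    (∀ b, ∀ j ∈ σ b, W.w j = δ b.1 * W.v j) ∧
    0 < C ∧
    ∀ i,
      IsEquivToEllR P q (r i) C
        (fun (l : Fin (n i)) ω => ∑ j ∈ σ ⟨i, l⟩, a j * ((Y j ω : ℝ) : 𝕜)) ∧
      IsEquivToEllR P q (r i) C
        (fun (l : Fin (n i)) ω => ∑ j ∈ σ ⟨i, l⟩, (δ i : 𝕜) * a j * ((Z j ω : ℝ) : 𝕜))

end

/-!
The space `𝔛_{q,v}` is studied through two descriptions of its norm. As the dual of a subspace of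
`ℓ_p ⊕_∞ ℓ_2` it is a quotient of `ℓ_q ⊕ ℓ_2` (`RosenthalX.exists_dualSum_eq`, by Hahn–Banach), so
that its coordinate functionals form a `1`-unconditional basis. On the other hand, by Rosenthal's
inequality (`integral_abs_sum_rpow_le`), it is isomorphic to the span in `L_q` of any three valued
system with `v_j = 1 / ‖Y_j‖₂`; the two estimates are `HasLevels.norm_sum_smul_dualUnitVector_le`
and `HasLevels.toReal_eLpNorm_sum_le_norm`.

Condition (a) uses the probabilistic description. The adjoint `Δ^*` multiplies the basis vectors of
the `i`-th group of blocks by `δ_i`, so it sends the blocks of `Y` to those of `δ_i Z`. Both families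
are equivalent to the basis of `ℓ_{r_i}^{n_i}`, with a constant not depending on `i`, hence `Δ^*` is
bounded below on their span, uniformly in `i`. By the parallelogram law some signed sum of `n` vectors
in a Hilbert space has norm at most of order `n ^ (1 / 2)`, so the distance of the span to the
Euclidean space is at least of order `n_i ^ (1 / r_i - 1 / 2)`, which is unbounded.

Condition (b) uses the quotient description. A functional supported far out in the basis splits as a
functional on `ℓ_p` plus one on `ℓ_2`, and `Δ^*` multiplies the first part by the small numbers
`w_j / v_j`. The splitting is not linear, but an `m`-dimensional space is the absolutely convex hull
of a number `N(m)` of vectors, up to constants (`exists_absConvex_generators`). Splitting these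
generators gives a factorization of `T|_E` through the Hilbert sum of `ℓ_2^N` and `ℓ_2`, in which an
orthogonal projection removes the ambiguity in the choice of the coefficients; if the ratios on the
tail are at most of order `1 / N(m)`, the constant is absolute (`gammaTwo_le_of_nonlinear_lift`).

For the existence of a pair with isomorphic spaces, Rosenthal's theorem
(`IsRosenthalWeight.nonempty_equiv`) says that all spaces `𝔛_{p,u}` are isomorphic for which `u`
tends to `0` along some set of indices over which the series of `u ^ (2p / (p - 2))` diverges. The
reason is that grouping the coordinates into blocks embeds every `𝔛_{p,v}` as a complemented subspace
of `𝔛_{p,u}`, and a countable sum of copies of `𝔛_{p,v}` is again a space of this kind, so that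
Pełczyński's decomposition method applies. It remains to produce weights. The norm in `L_q` of a
combination of a three valued system is governed by the modular built from `min (t ^ q) (t ^ 2)`, and
every power `t ^ r` with `q < r < 2` is equivalent, uniformly in `r`, to a positive combination of the
dyadic dilates of this function; finitely many of them suffice on a compact range
(`exists_orlicz_family`). Realizing the dilates by atoms gives blocks equivalent to the basis of
`ℓ_r^n`. Passing from `v` to `δ v` dilates the modular and multiplies it by a constant, and the
combined effect on `t ^ r` is the factor `δ ^ (q (2 - r) / (2 - q))`, which lies in `(1 / 2, 1]` by
assumption. Additional coordinates ensure Rosenthal's condition for both weights.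
-/

noncomputable section

/-! ### Operators into and out of the spaces `𝔛_{p,u}` -/

section RosenthalX

variable {𝕜 : Type*} [RCLike 𝕜] {p : ℝ≥0∞} [Fact (1 ≤ p)] {u : ℕ → ℝ}

variable (𝕜 p u) in
/-- The contraction `a ↦ a` of `𝔛_{p,u}` into `ℓ_p`. -/
def RosenthalX.fstL : RosenthalX 𝕜 p u →L[𝕜] SeqLp 𝕜 p :=
  (ContinuousLinearMap.fst 𝕜 (SeqLp 𝕜 p) (SeqLp 𝕜 2)).comp
    (RosenthalX.embed 𝕜 p u).toContinuousLinearMap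

variable (𝕜 p u) in
/-- The contraction `a ↦ a u` of `𝔛_{p,u}` into `ℓ_2`. -/
def RosenthalX.sndL : RosenthalX 𝕜 p u →L[𝕜] SeqLp 𝕜 2 :=
  (ContinuousLinearMap.snd 𝕜 (SeqLp 𝕜 p) (SeqLp 𝕜 2)).comp
    (RosenthalX.embed 𝕜 p u).toContinuousLinearMap

theorem RosenthalX.norm_def (x : RosenthalX 𝕜 p u) :
    ‖x‖ = max ‖fstL 𝕜 p u x‖ ‖sndL 𝕜 p u x‖ := rfl

theorem RosenthalX.sndL_apply (x : RosenthalX 𝕜 p u) (j : ℕ) :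
    sndL 𝕜 p u x j = (u j : 𝕜) * fstL 𝕜 p u x j := x.2 j

theorem RosenthalX.norm_fstL_apply_le (x : RosenthalX 𝕜 p u) : ‖fstL 𝕜 p u x‖ ≤ ‖x‖ := by
  rw [norm_def]; exact le_max_left _ _

theorem RosenthalX.norm_sndL_apply_le (x : RosenthalX 𝕜 p u) : ‖sndL 𝕜 p u x‖ ≤ ‖x‖ := by
  rw [norm_def]; exact le_max_right _ _

theorem RosenthalX.ext_fstL {x y : RosenthalX 𝕜 p u}
    (h : ∀ j, fstL 𝕜 p u x j = fstL 𝕜 p u y j) : x = y := by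
  refine Subtype.ext (Prod.ext (lp.ext (funext h)) (lp.ext (funext fun j => ?_)))
  have h1 := sndL_apply x j
  have h2 := sndL_apply y j
  change sndL 𝕜 p u x j = sndL 𝕜 p u y j
  rw [h1, h2, h j]

variable {E : Type*} [NormedAddCommGroup E] [NormedSpace 𝕜 E]

/-- The operator into `𝔛_{p,u}` with given components in `ℓ_p` and `ℓ_2`. -/
def RosenthalX.lift (A : E →L[𝕜] SeqLp 𝕜 p) (B : E →L[𝕜] SeqLp 𝕜 2)
    (h : ∀ x j, B x j = (u j : 𝕜) * A x j) : E →L[𝕜] RosenthalX 𝕜 p u :=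
  (A.prod B).codRestrict (rosenthalSubspace 𝕜 p u) (fun x j => h x j)

theorem dualUnitVector_apply (j : ℕ) (x : RosenthalX 𝕜 p u) :
    dualUnitVector 𝕜 p u j x = RosenthalX.fstL 𝕜 p u x j := rfl

theorem WeightPair.fstL_Delta (W : WeightPair) (x : RosenthalX 𝕜 p W.w) (j : ℕ) :
    RosenthalX.fstL 𝕜 p W.v (W.Delta 𝕜 p x) j =
      ((W.w j / W.v j : ℝ) : 𝕜) * RosenthalX.fstL 𝕜 p W.w x j := rfl

theorem WeightPair.sndL_Delta (W : WeightPair) (x : RosenthalX 𝕜 p W.w) :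
    RosenthalX.sndL 𝕜 p W.v (W.Delta 𝕜 p x) = RosenthalX.sndL 𝕜 p W.w x := rfl

/-- Multiplication by a sequence of scalars of modulus at most `1`, on `ℓ_p`. -/
def lpMul (p : ℝ≥0∞) [Fact (1 ≤ p)] (d : ℕ → 𝕜) (hd : ∀ j, ‖d j‖ ≤ 1) :
    SeqLp 𝕜 p →L[𝕜] SeqLp 𝕜 p :=
  lp.mapCLM p (fun j => ContinuousLinearMap.mul 𝕜 𝕜 (d j)) zero_le_one
    (fun j => by simpa using hd j)

@[simp] theorem lpMul_apply (d : ℕ → 𝕜) (hd : ∀ j, ‖d j‖ ≤ 1) (x : SeqLp 𝕜 p) (j : ℕ) :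
    lpMul p d hd x j = d j * x j := rfl

theorem norm_lpMul_apply_le_of_le (d : ℕ → 𝕜) (hd : ∀ j, ‖d j‖ ≤ 1) {ε : ℝ} (hε : 0 ≤ ε)
    (h : ∀ j, ‖d j‖ ≤ ε) (x : SeqLp 𝕜 p) : ‖lpMul p d hd x‖ ≤ ε * ‖x‖ := by
  have h1 := lp.norm_mapCLM_le (E := fun _ : ℕ => 𝕜) (F := fun _ : ℕ => 𝕜) p
    (fun j => ContinuousLinearMap.mul 𝕜 𝕜 (d j)) hε (fun j => by simpa using h j)
  exact (ContinuousLinearMap.le_opNorm _ x).trans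
    (mul_le_mul_of_nonneg_right h1 (norm_nonneg _))

theorem norm_lpMul_apply_le (d : ℕ → 𝕜) (hd : ∀ j, ‖d j‖ ≤ 1) (x : SeqLp 𝕜 p) :
    ‖lpMul p d hd x‖ ≤ ‖x‖ := by
  simpa using norm_lpMul_apply_le_of_le d hd zero_le_one hd x

variable (p u) in
/-- Multiplication by a sequence of scalars of modulus at most `1`, on `𝔛_{p,u}`. -/
def RosenthalX.mulOp (d : ℕ → 𝕜) (hd : ∀ j, ‖d j‖ ≤ 1) :
    RosenthalX 𝕜 p u →L[𝕜] RosenthalX 𝕜 p u :=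
  lift ((lpMul p d hd).comp (fstL 𝕜 p u)) ((lpMul 2 d hd).comp (sndL 𝕜 p u)) fun x j => by
    simp only [ContinuousLinearMap.comp_apply, lpMul_apply, sndL_apply]
    ring

theorem RosenthalX.fstL_mulOp (d : ℕ → 𝕜) (hd : ∀ j, ‖d j‖ ≤ 1) (x : RosenthalX 𝕜 p u) :
    fstL 𝕜 p u (mulOp p u d hd x) = lpMul p d hd (fstL 𝕜 p u x) := rfl

theorem RosenthalX.sndL_mulOp (d : ℕ → 𝕜) (hd : ∀ j, ‖d j‖ ≤ 1) (x : RosenthalX 𝕜 p u) :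
    sndL 𝕜 p u (mulOp p u d hd x) = lpMul 2 d hd (sndL 𝕜 p u x) := rfl

theorem RosenthalX.norm_mulOp_apply_le (d : ℕ → 𝕜) (hd : ∀ j, ‖d j‖ ≤ 1)
    (x : RosenthalX 𝕜 p u) : ‖mulOp p u d hd x‖ ≤ ‖x‖ := by
  rw [norm_def, fstL_mulOp, sndL_mulOp, norm_def]
  exact max_le_max (norm_lpMul_apply_le _ _ _) (norm_lpMul_apply_le _ _ _)

theorem WeightPair.norm_Delta_apply_le (W : WeightPair) (x : RosenthalX 𝕜 p W.w) :
    ‖W.Delta 𝕜 p x‖ ≤ ‖x‖ := by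
  rw [RosenthalX.norm_def, RosenthalX.norm_def, W.sndL_Delta]
  refine max_le_max ?_ le_rfl
  refine lp.norm_mono (zero_lt_one.trans_le (Fact.out : 1 ≤ p)).ne' fun j => ?_
  rw [W.fstL_Delta, norm_mul, RCLike.norm_ofReal]
  exact mul_le_of_le_one_left (norm_nonneg _) (W.abs_ratio_le_one j)

theorem WeightPair.norm_DeltaAdj_apply_le (W : WeightPair) (f : RosenthalXDual 𝕜 p W.v) :
    ‖W.DeltaAdj 𝕜 p f‖ ≤ ‖f‖ :=
  ContinuousLinearMap.opNorm_le_bound _ (norm_nonneg _) fun x =>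
    (f.le_opNorm _).trans (mul_le_mul_of_nonneg_left (W.norm_Delta_apply_le x) (norm_nonneg _))

theorem WeightPair.DeltaAdj_dualUnitVector (W : WeightPair) (j : ℕ) :
    W.DeltaAdj 𝕜 p (dualUnitVector 𝕜 p W.v j) =
      ((W.w j / W.v j : ℝ) : 𝕜) • dualUnitVector 𝕜 p W.w j := by
  ext x
  exact W.fstL_Delta x j

end RosenthalX

/-! ### The dual of `ℓ_p` -/

section DualLp

variable {𝕜 : Type*} [RCLike 𝕜] {p q : ℝ≥0∞} [Fact (1 ≤ p)]

theorem exists_norm_one_mul_eq_norm (y : 𝕜) : ∃ θ : 𝕜, ‖θ‖ = 1 ∧ θ * y = (‖y‖ : 𝕜) := by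
  by_cases hy : y = 0
  · exact ⟨1, by simp, by simp [hy]⟩
  · have h : (‖y‖ : 𝕜) ≠ 0 := by simpa using hy
    refine ⟨(‖y‖ : 𝕜) / y, ?_, by field_simp⟩
    rw [norm_div, RCLike.norm_ofReal, abs_norm, div_self (by simpa using hy)]

/-- The coefficients of a functional on `ℓ_p` form a sequence in the ball of radius `‖F‖` of
`ℓ_q`. -/
theorem sum_norm_rpow_coeff_le (hpq : p.toReal.HolderConjugate q.toReal)
    (F : StrongDual 𝕜 (SeqLp 𝕜 p)) (s : Finset ℕ) :
    ∑ j ∈ s, ‖F (lp.single p j 1)‖ ^ q.toReal ≤ ‖F‖ ^ q.toReal := by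
  choose θ hθ hθy using fun j => exists_norm_one_mul_eq_norm (F (lp.single p j (1 : 𝕜)))
  set y : ℕ → ℝ := fun j => ‖F (lp.single p j (1 : 𝕜))‖ with hy
  have hy0 : ∀ j, 0 ≤ y j := fun j => norm_nonneg _
  set S := ∑ j ∈ s, y j ^ q.toReal with hS
  have hS0 : 0 ≤ S := Finset.sum_nonneg fun j _ => Real.rpow_nonneg (hy0 j) _
  -- the extremal vector of Hölder's inequality
  set x : ℕ → 𝕜 := fun j => θ j * ((y j ^ (q.toReal - 1) : ℝ) : 𝕜) with hx
  have hxn : ∀ j, ‖x j‖ ^ p.toReal = y j ^ q.toReal := fun j => by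
    rw [hx]
    simp only [norm_mul, hθ, one_mul, RCLike.norm_ofReal]
    rw [abs_of_nonneg (Real.rpow_nonneg (hy0 j) _), ← Real.rpow_mul (hy0 j),
      hpq.symm.sub_one_mul_conj]
  have hFx : F (∑ j ∈ s, lp.single p j (x j)) = (S : 𝕜) := by
    rw [map_sum, hS]
    push_cast
    refine Finset.sum_congr rfl fun j _ => ?_
    have h1 : lp.single p j (x j) = x j • (lp.single p j (1 : 𝕜) : SeqLp 𝕜 p) := by
      rw [← lp.single_smul]; simp
    rw [h1, map_smul, smul_eq_mul, hx]
    simp only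
    rw [mul_right_comm, hθy j]
    have h2 : y j * y j ^ (q.toReal - 1) = y j ^ q.toReal := by
      rcases (hy0 j).eq_or_lt with h | h
      · rw [← h, Real.zero_rpow hpq.symm.ne_zero, zero_mul]
      · rw [← Real.rpow_one_add' (hy0 j) (by linarith [hpq.symm.pos])]; congr 1; ring
    rw [← RCLike.ofReal_mul, h2]
  have hnx : ‖∑ j ∈ s, lp.single p j (x j)‖ ^ p.toReal = S := by
    rw [lp.norm_sum_single hpq.pos]
    exact Finset.sum_congr rfl fun j _ => hxn j
  have hle : S ≤ ‖F‖ * S ^ (1 / p.toReal) := by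
    have h := F.le_opNorm (∑ j ∈ s, lp.single p j (x j))
    rw [hFx, RCLike.norm_ofReal, abs_of_nonneg hS0] at h
    rwa [← hnx, one_div, Real.rpow_rpow_inv (norm_nonneg _) hpq.ne_zero, hnx]
  rcases hS0.eq_or_lt with h | h
  · rw [← h]; positivity
  · have h3 : S ^ (1 / q.toReal) ≤ ‖F‖ := by
      have : S ^ (1 / q.toReal) * S ^ (1 / p.toReal) = S := by
        rw [← Real.rpow_add h, one_div, one_div, add_comm, hpq.inv_add_inv_eq_one, Real.rpow_one]
      refine le_of_mul_le_mul_right ?_ (Real.rpow_pos_of_pos h (1 / p.toReal))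
      rwa [this]
    calc S = (S ^ (1 / q.toReal)) ^ q.toReal := by
          rw [one_div, Real.rpow_inv_rpow hS0 hpq.symm.ne_zero]
      _ ≤ _ := Real.rpow_le_rpow (Real.rpow_nonneg hS0 _) h3 hpq.symm.nonneg

variable [Fact (1 ≤ q)]

/-- The bilinear pairing of `ℓ_q` and `ℓ_p`. -/
def lpPairing (𝕜 : Type*) [RCLike 𝕜] (q p : ℝ≥0∞) [Fact (1 ≤ p)] [Fact (1 ≤ q)]
    [q.HolderConjugate p] : SeqLp 𝕜 q →L[𝕜] StrongDual 𝕜 (SeqLp 𝕜 p) :=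
  lp.dualPairing q p (fun _ => ContinuousLinearMap.mul 𝕜 𝕜) (K := 1) (fun _ => by simp)

theorem lpPairing_apply [q.HolderConjugate p] (y : SeqLp 𝕜 q) (x : SeqLp 𝕜 p) :
    lpPairing 𝕜 q p y x = ∑' i, y i * x i := rfl

theorem lpPairing_single_right [q.HolderConjugate p] (y : SeqLp 𝕜 q) (j : ℕ) (a : 𝕜) :
    lpPairing 𝕜 q p y (lp.single p j a) = y j * a := by
  rw [lpPairing_apply, tsum_eq_single j]
  · rw [lp.single_apply_self]
  · intro i hi
    rw [lp.single_apply_ne _ _ _ hi, mul_zero]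

theorem lpPairing_single_left [q.HolderConjugate p] (x : SeqLp 𝕜 p) (j : ℕ) (a : 𝕜) :
    lpPairing 𝕜 q p (lp.single q j a) x = a * x j := by
  rw [lpPairing_apply, tsum_eq_single j]
  · rw [lp.single_apply_self]
  · intro i hi
    rw [lp.single_apply_ne _ _ _ hi, zero_mul]

theorem norm_lpPairing_apply_le [q.HolderConjugate p] (y : SeqLp 𝕜 q) :
    ‖lpPairing 𝕜 q p y‖ ≤ ‖y‖ := by
  refine ((lpPairing 𝕜 q p).le_opNorm y).trans ?_
  refine mul_le_of_le_one_left (norm_nonneg _) ?_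
  exact lp.norm_dualPairing (p := q) (q := p) _ _

/-- The pairing identifies `ℓ_q` with the dual of `ℓ_p`. -/
theorem exists_lpPairing_eq [q.HolderConjugate p] (hpq : p.toReal.HolderConjugate q.toReal)
    (F : StrongDual 𝕜 (SeqLp 𝕜 p)) :
    ∃ y : SeqLp 𝕜 q, ‖y‖ ≤ ‖F‖ ∧ (∀ j, y j = F (lp.single p j 1)) ∧ lpPairing 𝕜 q p y = F := by
  have hp : p ≠ ∞ := by rintro rfl; simpa using hpq.pos
  refine ⟨⟨fun j => F (lp.single p j 1), memℓp_gen' (sum_norm_rpow_coeff_le hpq F)⟩, ?_,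
    fun j => rfl, ?_⟩
  · exact lp.norm_le_of_forall_sum_le hpq.symm.pos (norm_nonneg _) (sum_norm_rpow_coeff_le hpq F)
  · refine lp.ext_continuousLinearMap hp fun j => ContinuousLinearMap.ext_ring ?_
    simp only [ContinuousLinearMap.comp_apply, lp.singleContinuousLinearMap_apply]
    rw [lpPairing_single_right, mul_one]

/-- The coordinate functionals form a basis of the dual of `ℓ_p`. -/
theorem hasSum_coeff_smul_evalCLM [q.HolderConjugate p]
    (hpq : p.toReal.HolderConjugate q.toReal) (F : StrongDual 𝕜 (SeqLp 𝕜 p)) :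
    HasSum (fun j => F (lp.single p j 1) • lp.evalCLM 𝕜 (fun _ : ℕ => 𝕜) p j) F := by
  have hq : q ≠ ∞ := by rintro rfl; simpa using hpq.symm.pos
  obtain ⟨y, -, hy, hF⟩ := exists_lpPairing_eq (q := q) hpq F
  have h := (lp.hasSum_single hq y).mapL (lpPairing 𝕜 q p)
  rw [hF] at h
  refine h.congr_fun fun j => ?_
  ext x
  rw [lpPairing_single_left, hy]
  rfl

end DualLp

/-! ### Functionals on `𝔛_{p,u}` and the unconditional basis of the dual -/

section Dual

variable {𝕜 : Type*} [RCLike 𝕜] {p : ℝ≥0∞} [Fact (1 ≤ p)] {u : ℕ → ℝ}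

variable (𝕜 p u) in
/-- The quotient map `(ℓ_p)^* × (ℓ_2)^* → 𝔛_{q,u}`, the adjoint of `RosenthalX.embed`. -/
def RosenthalX.dualSum :
    StrongDual 𝕜 (SeqLp 𝕜 p) × StrongDual 𝕜 (SeqLp 𝕜 2) →L[𝕜] RosenthalXDual 𝕜 p u :=
  (ContinuousLinearMap.precomp 𝕜 (fstL 𝕜 p u)).coprod
    (ContinuousLinearMap.precomp 𝕜 (sndL 𝕜 p u))

theorem RosenthalX.dualSum_apply (F : StrongDual 𝕜 (SeqLp 𝕜 p) × StrongDual 𝕜 (SeqLp 𝕜 2))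
    (x : RosenthalX 𝕜 p u) :
    dualSum 𝕜 p u F x = F.1 (fstL 𝕜 p u x) + F.2 (sndL 𝕜 p u x) := rfl

/-- By the Hahn–Banach theorem the quotient map has nonlinear liftings, with both components of
norm at most that of the functional. -/
theorem RosenthalX.exists_dualSum_eq (f : RosenthalXDual 𝕜 p u) :
    ∃ F, ‖F.1‖ ≤ ‖f‖ ∧ ‖F.2‖ ≤ ‖f‖ ∧ dualSum 𝕜 p u F = f := by
  obtain ⟨g, hg, hgn⟩ := exists_extension_norm_eq (rosenthalSubspace 𝕜 p u) (f : _ →L[𝕜] 𝕜)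
  refine ⟨(g.comp (ContinuousLinearMap.inl 𝕜 _ _), g.comp (ContinuousLinearMap.inr 𝕜 _ _)),
    ?_, ?_, ?_⟩
  · refine ContinuousLinearMap.opNorm_le_bound _ (norm_nonneg _) fun x => ?_
    have := g.le_opNorm (x, 0)
    rw [hgn] at this
    simpa using! this
  · refine ContinuousLinearMap.opNorm_le_bound _ (norm_nonneg _) fun x => ?_
    have := g.le_opNorm (0, x)
    rw [hgn] at this
    simpa using! this
  · ext x
    rw [dualSum_apply]
    simp only [ContinuousLinearMap.comp_apply, ContinuousLinearMap.inl_apply,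
      ContinuousLinearMap.inr_apply]
    rw [← map_add, Prod.mk_add_mk, add_zero, zero_add]
    exact hg x

variable (𝕜 p u) in
/-- The `j`-th unit vector of `𝔛_{p,u}`. -/
def RosenthalX.unitVector (j : ℕ) : RosenthalX 𝕜 p u :=
  lift (lp.singleContinuousLinearMap 𝕜 (fun _ : ℕ => 𝕜) p j)
    ((u j : 𝕜) • lp.singleContinuousLinearMap 𝕜 (fun _ : ℕ => 𝕜) 2 j)
    (fun x i => by
      rw [smul_apply, lp.coeFn_smul, Pi.smul_apply, smul_eq_mul,
        lp.singleContinuousLinearMap_apply, lp.singleContinuousLinearMap_apply]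
      by_cases h : i = j
      · subst h
        rw [lp.single_apply_self, lp.single_apply_self]
      · rw [lp.single_apply_ne _ _ _ h, lp.single_apply_ne _ _ _ h, mul_zero, mul_zero]) 1

theorem RosenthalX.fstL_unitVector (j : ℕ) :
    fstL 𝕜 p u (unitVector 𝕜 p u j) = lp.single p j 1 := rfl

theorem RosenthalX.sndL_unitVector (j : ℕ) :
    sndL 𝕜 p u (unitVector 𝕜 p u j) = (u j : 𝕜) • lp.single 2 j 1 := rfl

theorem dualUnitVector_unitVector (i j : ℕ) :
    dualUnitVector 𝕜 p u i (RosenthalX.unitVector 𝕜 p u j) = (Pi.single j (1 : 𝕜) : ℕ → 𝕜) i := by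
  rw [dualUnitVector_apply, RosenthalX.fstL_unitVector, lp.coeFn_single]

/-- Every functional is the image of a pair of functionals on `ℓ_p` and `ℓ_2`, whose expansions
converge separately. -/
theorem hasSum_dualUnitVector {q : ℝ≥0∞} [Fact (1 ≤ q)] [q.HolderConjugate p]
    (hpq : p.toReal.HolderConjugate q.toReal) (f : RosenthalXDual 𝕜 p u) :
    HasSum (fun j => f (RosenthalX.unitVector 𝕜 p u j) • dualUnitVector 𝕜 p u j) f := by
  obtain ⟨F, -, -, rfl⟩ := RosenthalX.exists_dualSum_eq f
  have h2 : (2 : ℝ≥0∞).toReal.HolderConjugate (2 : ℝ≥0∞).toReal := by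
    simpa using Real.HolderConjugate.two_two
  have h := ((hasSum_coeff_smul_evalCLM hpq F.1).prodMk
    (hasSum_coeff_smul_evalCLM h2 F.2)).mapL (RosenthalX.dualSum 𝕜 p u)
  refine h.congr_fun fun j => ?_
  ext x
  simp only [RosenthalX.dualSum_apply, smul_apply, dualUnitVector_apply,
    RosenthalX.fstL_unitVector, RosenthalX.sndL_unitVector, map_smul, smul_eq_mul]
  change _ = F.1 _ * RosenthalX.fstL 𝕜 p u x j + F.2 _ * RosenthalX.sndL 𝕜 p u x j
  rw [RosenthalX.sndL_apply]
  ring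

/-- Unimodular multipliers on the dual basis are adjoints of contractions of `𝔛_{p,u}`. -/
theorem norm_sum_smul_dualUnitVector_le_of_unimodular (s : Finset ℕ) (a θ : ℕ → 𝕜)
    (hθ : ∀ i, ‖θ i‖ = 1) :
    ‖∑ i ∈ s, (θ i * a i) • dualUnitVector 𝕜 p u i‖ ≤ ‖∑ i ∈ s, a i • dualUnitVector 𝕜 p u i‖ := by
  refine ContinuousLinearMap.opNorm_le_bound _ (norm_nonneg _) fun x => ?_
  have h : (∑ i ∈ s, (θ i * a i) • dualUnitVector 𝕜 p u i) x =
      (∑ i ∈ s, a i • dualUnitVector 𝕜 p u i)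
        (RosenthalX.mulOp p u θ (fun i => (hθ i).le) x) := by
    simp only [sum_apply, smul_apply, smul_eq_mul,
      dualUnitVector_apply, RosenthalX.fstL_mulOp, lpMul_apply]
    exact Finset.sum_congr rfl fun i _ => by ring
  rw [h]
  exact (ContinuousLinearMap.le_opNorm _ _).trans
    (mul_le_mul_of_nonneg_left (RosenthalX.norm_mulOp_apply_le _ _ x) (norm_nonneg _))

theorem isOneUnconditionalBasis_dualUnitVector {q : ℝ≥0∞} [Fact (1 ≤ q)] [q.HolderConjugate p]
    (hpq : p.toReal.HolderConjugate q.toReal) :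
    IsOneUnconditionalBasis 𝕜 (dualUnitVector 𝕜 p u) := by
  refine ⟨⟨⟨dualUnitVector 𝕜 p u,
    fun j => ContinuousLinearMap.apply 𝕜 𝕜 (RosenthalX.unitVector 𝕜 p u j), fun i j => ?_,
    fun f => hasSum_dualUnitVector hpq f⟩, rfl⟩, fun s a θ hθ => le_antisymm ?_ ?_⟩
  · rw [ContinuousLinearMap.apply_apply, dualUnitVector_unitVector]
    convert Pi.single_comm i (1 : 𝕜) j
  · exact norm_sum_smul_dualUnitVector_le_of_unimodular s a θ hθ
  · have h := norm_sum_smul_dualUnitVector_le_of_unimodular (p := p) (u := u) s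
      (fun i => θ i * a i) (fun i => (θ i)⁻¹) (fun i => by rw [norm_inv, hθ, inv_one])
    refine le_trans (le_of_eq ?_) h
    congr 1
    refine Finset.sum_congr rfl fun i _ => ?_
    have : θ i ≠ 0 := fun h0 => by simpa [h0] using hθ i
    rw [inv_mul_cancel_left₀ this]

end Dual

/-! ### Uniform nets in finite dimensional spaces -/

/-- A finite dimensional normed space is the absolutely convex hull of boundedly many vectors, up
to a factor `2`; the number of vectors is bounded in terms of the dimension only. -/
theorem exists_absConvex_generators (𝕜 : Type*) [RCLike 𝕜] (E : Type*) [NormedAddCommGroup E]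
    [NormedSpace 𝕜 E] [FiniteDimensional 𝕜 E] :
    ∃ (N : ℕ) (s : Fin N → E), N ≤ 25 ^ Module.finrank 𝕜 E ∧ (∀ k, ‖s k‖ ≤ 2) ∧
      ∀ x, ∃ c : Fin N → 𝕜, ∑ k, ‖c k‖ ≤ ‖x‖ ∧ ∑ k, c k • s k = x := by
  classical
  let _ : NormedSpace ℝ E := NormedSpace.restrictScalars ℝ 𝕜 E
  have _ : IsScalarTower ℝ 𝕜 E := RestrictScalars.isScalarTower ℝ 𝕜 E
  have _ : FiniteDimensional ℝ E := FiniteDimensional.trans ℝ 𝕜 E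
  have hdim : 5 ^ Module.finrank ℝ E ≤ 25 ^ Module.finrank 𝕜 E := by
    rw [← Module.finrank_mul_finrank ℝ 𝕜 E, show 25 = 5 ^ 2 by norm_num, ← pow_mul]
    refine Nat.pow_le_pow_right (by norm_num) (Nat.mul_le_mul_right _ ?_)
    exact RCLike.finrank_le_two 𝕜
  -- a maximal `1`-separated subset of the ball of radius `2`
  let P : Finset E → Prop := fun s =>
    (∀ c ∈ s, ‖c‖ ≤ 2) ∧ ∀ c ∈ s, ∀ d ∈ s, c ≠ d → 1 ≤ ‖c - d‖
  obtain ⟨s, hs, hmax⟩ : ∃ s, P s ∧ ∀ t, P t → t.card ≤ s.card := by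
    let S : Set ℕ := {n | ∃ s, P s ∧ s.card = n}
    have hb : BddAbove S := ⟨5 ^ Module.finrank ℝ E, by
      rintro _ ⟨s, hs, rfl⟩
      exact Besicovitch.card_le_of_separated s hs.1 hs.2⟩
    obtain ⟨s, hs, hcard⟩ := Nat.sSup_mem (s := S) ⟨0, ∅, ⟨by simp, by simp⟩, rfl⟩ hb
    exact ⟨s, hs, fun t ht => hcard ▸ le_csSup hb ⟨t, ht, rfl⟩⟩
  have hnet : ∀ x : E, ‖x‖ ≤ 2 → ∃ k ∈ s, ‖x - k‖ ≤ 1 := by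
    intro x hx
    by_contra! h
    have hxs : x ∉ s := fun hxs => by simpa using (h x hxs).trans' zero_lt_one
    have hP : P (insert x s) := by
      refine ⟨fun c hc => ?_, fun c hc d hd hcd => ?_⟩
      · rcases Finset.mem_insert.1 hc with rfl | hc
        exacts [hx, hs.1 c hc]
      · rcases Finset.mem_insert.1 hc with hc' | hc' <;>
          rcases Finset.mem_insert.1 hd with hd' | hd'
        · exact absurd (hc'.trans hd'.symm) hcd
        · rw [hc']; exact (h d hd').le
        · rw [hd', norm_sub_rev]; exact (h c hc').le
        · exact hs.2 c hc' d hd' hcd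
    have := hmax _ hP
    rw [Finset.card_insert_of_notMem hxs] at this
    omega
  let e : Fin s.card ≃ s := s.equivFin.symm
  let v : Fin s.card → E := fun k => (e k : E)
  have happrox : ∀ (i : ℕ) (x : E), ‖x‖ ≤ 2 → ∃ c : Fin s.card → 𝕜, ∑ k, ‖c k‖ ≤ 2 ∧
      ‖x - ∑ k, c k • v k‖ ≤ 2 * (1 / 2) ^ i := by
    intro i
    induction i with
    | zero => exact fun x hx => ⟨0, by simp, by simpa using hx⟩
    | succ i ih =>
      intro x hx
      obtain ⟨k, hk, hxk⟩ := hnet x hx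
      obtain ⟨c, hc, hxc⟩ := ih ((2 : 𝕜) • (x - k)) (by
        rw [norm_smul, RCLike.norm_ofNat]; linarith)
      have hvk : v (e.symm ⟨k, hk⟩) = k := by simp [v]
      refine ⟨(Pi.single (e.symm ⟨k, hk⟩) (1 : 𝕜) : Fin s.card → 𝕜) + (2 : 𝕜)⁻¹ • c, ?_, ?_⟩
      · calc ∑ j, ‖((Pi.single (e.symm ⟨k, hk⟩) (1 : 𝕜) : Fin s.card → 𝕜) + (2 : 𝕜)⁻¹ • c) j‖
            ≤ ∑ j, (‖(Pi.single (e.symm ⟨k, hk⟩) (1 : 𝕜) : Fin s.card → 𝕜) j‖ +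
                2⁻¹ * ‖c j‖) := by
              refine Finset.sum_le_sum fun j _ => (norm_add_le _ _).trans ?_
              rw [Pi.smul_apply, norm_smul, norm_inv, RCLike.norm_ofNat]
          _ = 1 + 2⁻¹ * ∑ j, ‖c j‖ := by
              rw [Finset.sum_add_distrib, ← Finset.mul_sum]
              congr 1
              rw [Finset.sum_eq_single (e.symm ⟨k, hk⟩)]
              · simp
              · intro j _ hj
                rw [Pi.single_eq_of_ne hj, norm_zero]
              · simp
          _ ≤ 2 := by linarith
      · have : x - ∑ j, ((Pi.single (e.symm ⟨k, hk⟩) (1 : 𝕜) : Fin s.card → 𝕜) + (2 : 𝕜)⁻¹ • c) j • v j =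
            (2 : 𝕜)⁻¹ • ((2 : 𝕜) • (x - k) - ∑ j, c j • v j) := by
          simp only [Pi.add_apply, Pi.smul_apply, add_smul, Finset.sum_add_distrib, smul_sub,
            Finset.smul_sum, smul_smul, smul_eq_mul]
          rw [Finset.sum_eq_single (e.symm ⟨k, hk⟩), Pi.single_eq_same, hvk, one_smul,
            inv_mul_cancel₀ (two_ne_zero), one_smul, one_smul]
          · abel
          · intro j _ hj
            rw [Pi.single_eq_of_ne hj, zero_smul]
          · simp
        rw [this, norm_smul, norm_inv, RCLike.norm_ofNat, pow_succ]
        linarith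
  -- by compactness the approximation is exact
  let K : Set (Fin s.card → 𝕜) := {c | ∑ k, ‖c k‖ ≤ 2}
  have hKc : IsCompact K := by
    refine Metric.isCompact_of_isClosed_isBounded ?_ ?_
    · exact isClosed_le (by fun_prop) continuous_const
    · refine isBounded_iff_forall_norm_le.2 ⟨2, fun c hc => ?_⟩
      refine (pi_norm_le_iff_of_nonneg (by norm_num)).2 fun k => le_trans ?_ hc
      exact Finset.single_le_sum (f := fun k => ‖c k‖) (fun _ _ => norm_nonneg _)
        (Finset.mem_univ k)
  let L : (Fin s.card → 𝕜) → E := fun c => ∑ k, c k • v k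
  have hL : Continuous L := by fun_prop
  have hexact : ∀ x : E, ‖x‖ ≤ 2 → x ∈ L '' K := by
    intro x hx
    rw [← (hKc.image hL).isClosed.closure_eq, Metric.mem_closure_iff]
    intro ε hε
    obtain ⟨i, hi⟩ := exists_pow_lt_of_lt_one (half_pos hε) (show (1 / 2 : ℝ) < 1 by norm_num)
    obtain ⟨c, hc, hxc⟩ := happrox i x hx
    refine ⟨L c, ⟨c, hc, rfl⟩, ?_⟩
    rw [dist_eq_norm]
    exact hxc.trans_lt (by linarith)
  refine ⟨s.card, v, (Besicovitch.card_le_of_separated s hs.1 hs.2).trans hdim,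
    fun k => hs.1 _ (e k).2, fun x => ?_⟩
  rcases eq_or_ne x 0 with rfl | hx
  · exact ⟨0, by simp, by simp⟩
  have hx0 : 0 < ‖x‖ := norm_pos_iff.2 hx
  obtain ⟨c, hc, hcx⟩ := hexact (((2 / ‖x‖ : ℝ) : 𝕜) • x) (by
    rw [norm_smul, RCLike.norm_ofReal, abs_of_pos (by positivity)]
    exact (div_mul_cancel₀ _ hx0.ne').le)
  refine ⟨fun k => ((‖x‖ / 2 : ℝ) : 𝕜) * c k, ?_, ?_⟩
  · simp only [norm_mul, RCLike.norm_ofReal]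
    rw [← Finset.mul_sum, abs_of_pos (by positivity)]
    have : ∑ k, ‖c k‖ ≤ 2 := hc
    nlinarith
  · simp only [mul_smul]
    rw [← Finset.smul_sum]
    change _ • L c = x
    rw [hcx, smul_smul, ← RCLike.ofReal_mul]
    rw [show ‖x‖ / 2 * (2 / ‖x‖) = 1 by field_simp]
    simp

/-! ### Factorization through a Hilbert space -/

theorem gammaTwo_le_of_factorization {𝕜 : Type*} [RCLike 𝕜] {E : Type u} [NormedAddCommGroup E]
    [NormedSpace 𝕜 E] {Y : Type*} [NormedAddCommGroup Y] [NormedSpace 𝕜 Y] {T : E →L[𝕜] Y}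
    {H : Type u} [NormedAddCommGroup H] [InnerProductSpace 𝕜 H] [CompleteSpace H]
    (A : H →L[𝕜] Y) (B : E →L[𝕜] H) (h : T = A.comp B) {a b : ℝ} (hA : ‖A‖ ≤ a) (hB : ‖B‖ ≤ b) :
    gammaTwo T ≤ ENNReal.ofReal (a * b) := by
  have hmem : gammaTwo T ≤ ‖A‖ₑ * ‖B‖ₑ := by
    unfold gammaTwo
    exact sInf_le ⟨H, inferInstance, inferInstance, inferInstance, A, B, h, rfl⟩
  refine hmem.trans ?_
  rw [ENNReal.ofReal_mul ((norm_nonneg _).trans hA), ← ofReal_norm, ← ofReal_norm]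
  exact mul_le_mul' (ENNReal.ofReal_le_ofReal hA) (ENNReal.ofReal_le_ofReal hB)

/-- Suppose that every `x ∈ E` lifts to a pair `(y, z)` with `z` in a Hilbert space such that
`T x = R₁ y + R₂ z`, the lifting being bounded but in general neither linear nor continuous. If
`R₁` is small enough in terms of `dim E`, then `T` factors through a Hilbert space with an absolute
constant. -/
theorem gammaTwo_le_of_nonlinear_lift {𝕜 : Type u} [RCLike 𝕜] {E : Type u} [NormedAddCommGroup E]
    [NormedSpace 𝕜 E] [FiniteDimensional 𝕜 E] {Y U : Type*} [NormedAddCommGroup Y]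
    [NormedSpace 𝕜 Y] [NormedAddCommGroup U] [NormedSpace 𝕜 U] {H : Type u}
    [NormedAddCommGroup H] [InnerProductSpace 𝕜 H] [CompleteSpace H] (T : E →L[𝕜] Y)
    (R₁ : U →L[𝕜] Y) (R₂ : H →L[𝕜] Y)
    (hlift : ∀ x, ∃ y z, ‖y‖ ≤ ‖x‖ ∧ ‖z‖ ≤ ‖x‖ ∧ T x = R₁ y + R₂ z)
    (h₁ : ‖R₁‖ * (2 * 25 ^ Module.finrank 𝕜 E) ≤ 1) (h₂ : ‖R₂‖ ≤ 1) :
    gammaTwo T ≤ 6 := by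
  obtain ⟨N, s, hN, hs, hgen⟩ := exists_absConvex_generators 𝕜 E
  choose y z hy hz hTyz using fun k => hlift (s k)
  let G := EuclideanSpace 𝕜 (Fin N)
  let Ly : G →ₗ[𝕜] U := ∑ k, (LinearMap.toSpanSingleton 𝕜 U (y k)).comp
    ((EuclideanSpace.proj k : G →L[𝕜] 𝕜) : G →ₗ[𝕜] 𝕜)
  let Lz : G →ₗ[𝕜] H := ∑ k, (LinearMap.toSpanSingleton 𝕜 H (z k)).comp
    ((EuclideanSpace.proj k : G →L[𝕜] 𝕜) : G →ₗ[𝕜] 𝕜)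
  let Ls : G →ₗ[𝕜] E := ∑ k, (LinearMap.toSpanSingleton 𝕜 E (s k)).comp
    ((EuclideanSpace.proj k : G →L[𝕜] 𝕜) : G →ₗ[𝕜] 𝕜)
  have hLy : ∀ c, Ly c = ∑ k, c k • y k := fun c => by simp [Ly]; rfl
  have hLz : ∀ c, Lz c = ∑ k, c k • z k := fun c => by simp [Lz]; rfl
  have hLs : ∀ c, Ls c = ∑ k, c k • s k := fun c => by simp [Ls]; rfl
  have hTL : ∀ c, T (Ls c) = R₁ (Ly c) + R₂ (Lz c) := fun c => by
    rw [hLy, hLz, hLs, map_sum, map_sum, map_sum, ← Finset.sum_add_distrib]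
    refine Finset.sum_congr rfl fun k _ => ?_
    rw [map_smul, map_smul, map_smul, hTyz, smul_add]
  have hsurj : Function.Surjective Ls := fun x => by
    obtain ⟨c, -, hc⟩ := hgen x
    exact ⟨WithLp.toLp 2 c, by rw [hLs]; exact hc⟩
  obtain ⟨σ, hσ⟩ := Ls.exists_rightInverse_of_surjective (LinearMap.range_eq_top.2 hsurj)
  -- the graph of `Lz` inside the Hilbert sum of the coefficient space and `H`
  let J : G →ₗ[𝕜] WithLp 2 (G × H) :=
    (WithLp.linearEquiv 2 𝕜 (G × H)).symm.toLinearMap.comp (LinearMap.id.prod Lz)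
  have hJ : ∀ c, J c = WithLp.toLp 2 (c, Lz c) := fun c => rfl
  let V : Submodule 𝕜 (WithLp 2 (G × H)) := (LinearMap.ker Ls).map J
  have _ : FiniteDimensional 𝕜 V := inferInstance
  let Q : WithLp 2 (G × H) →L[𝕜] WithLp 2 (G × H) := Vᗮ.starProjection
  let A₀ : WithLp 2 (G × H) →L[𝕜] Y :=
    ((R₁.comp (LinearMap.toContinuousLinearMap Ly)).coprod R₂).comp
      (WithLp.prodContinuousLinearEquiv 2 𝕜 G H).toContinuousLinearMap
  have hA₀ : ∀ g, A₀ g = R₁ (Ly g.fst) + R₂ g.snd := fun g => rfl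
  have hA₀J : ∀ c, A₀ (J c) = T (Ls c) := fun c => by rw [hA₀, hTL]; rfl
  have hA₀Q : ∀ g, A₀ (Q g) = A₀ g := fun g => by
    have h1 : g - Q g ∈ V := by
      have h2 : g - Q g ∈ Vᗮᗮ := Vᗮ.sub_starProjection_mem_orthogonal g
      rwa [Submodule.orthogonal_orthogonal] at h2
    obtain ⟨c, hc, hcg⟩ := h1
    have h3 : A₀ (g - Q g) = 0 := by
      rw [← hcg, hA₀J, LinearMap.mem_ker.1 hc, map_zero]
    rw [map_sub, sub_eq_zero] at h3
    exact h3.symm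
  let B₀ : E →L[𝕜] WithLp 2 (G × H) :=
    Q.comp (LinearMap.toContinuousLinearMap (J.comp σ))
  have hB₀ : ∀ c, B₀ (Ls c) = Q (J c) := fun c => by
    have h1 : σ (Ls c) - c ∈ LinearMap.ker Ls := by
      rw [LinearMap.mem_ker, map_sub, sub_eq_zero]
      exact LinearMap.congr_fun hσ (Ls c)
    have h2 : J (σ (Ls c)) - J c ∈ V := by
      rw [← map_sub]; exact Submodule.mem_map_of_mem h1
    have h3 : Q (J (σ (Ls c)) - J c) = 0 := by
      refine (Submodule.starProjection_apply_eq_zero_iff Vᗮ).2 ?_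
      rwa [Submodule.orthogonal_orthogonal]
    rw [map_sub, sub_eq_zero] at h3
    exact h3
  have hfac : T = A₀.comp B₀ := by
    ext x
    obtain ⟨c, rfl⟩ := hsurj x
    rw [ContinuousLinearMap.comp_apply, hB₀, hA₀Q, hA₀J]
  have hnfst : ∀ g : WithLp 2 (G × H), ‖g.fst‖ ≤ ‖g‖ := fun g => WithLp.norm_fst_le _ g
  have hnsnd : ∀ g : WithLp 2 (G × H), ‖g.snd‖ ≤ ‖g‖ := fun g => WithLp.norm_snd_le _ g
  have hNr : (N : ℝ) ≤ 25 ^ Module.finrank 𝕜 E := by exact_mod_cast hN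
  have hAn : ‖A₀‖ ≤ 2 := by
    refine ContinuousLinearMap.opNorm_le_bound _ (by norm_num) fun g => ?_
    rw [hA₀]
    have h1 : ‖Ly g.fst‖ ≤ 2 * N * ‖g‖ := by
      rw [hLy]
      refine (norm_sum_le _ _).trans ?_
      calc ∑ k, ‖g.fst k • y k‖ ≤ ∑ _k : Fin N, 2 * ‖g‖ := by
            refine Finset.sum_le_sum fun k _ => ?_
            rw [norm_smul, mul_comm]
            exact mul_le_mul ((hy k).trans (hs k)) ((PiLp.norm_apply_le g.fst k).trans (hnfst g))
              (norm_nonneg _) (by norm_num)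
        _ = 2 * N * ‖g‖ := by
            rw [Finset.sum_const, Finset.card_univ, Fintype.card_fin, nsmul_eq_mul]; ring
    have h2 : ‖R₁ (Ly g.fst)‖ ≤ ‖g‖ := by
      calc ‖R₁ (Ly g.fst)‖ ≤ ‖R₁‖ * (2 * N * ‖g‖) :=
            (R₁.le_opNorm _).trans (mul_le_mul_of_nonneg_left h1 (norm_nonneg _))
        _ ≤ ‖R₁‖ * (2 * 25 ^ Module.finrank 𝕜 E * ‖g‖) := by gcongr
        _ = ‖R₁‖ * (2 * 25 ^ Module.finrank 𝕜 E) * ‖g‖ := by ring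
        _ ≤ 1 * ‖g‖ := mul_le_mul_of_nonneg_right h₁ (norm_nonneg _)
        _ = ‖g‖ := one_mul _
    have h3 : ‖R₂ g.snd‖ ≤ ‖g‖ :=
      (R₂.le_of_opNorm_le h₂ _).trans (by rw [one_mul]; exact hnsnd g)
    exact (norm_add_le _ _).trans (by linarith)
  have hBn : ‖B₀‖ ≤ 3 := by
    refine ContinuousLinearMap.opNorm_le_bound _ (by norm_num) fun x => ?_
    obtain ⟨c, hc, hcx⟩ := hgen x
    have hcs : Ls (WithLp.toLp 2 c) = x := by rw [hLs]; exact hcx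
    conv_lhs => rw [← hcs, hB₀]
    refine (Submodule.norm_starProjection_apply_le _ _).trans ?_
    rw [hJ]
    have h1 : ‖(WithLp.toLp 2 c : G)‖ ≤ ‖x‖ := by
      refine le_trans ?_ hc
      have h2 : (WithLp.toLp 2 c : G) = ∑ k, c k • EuclideanSpace.single k (1 : 𝕜) := by
        ext j
        simp [Finset.sum_apply, Pi.single_apply]
      rw [h2]
      refine (norm_sum_le _ _).trans (Finset.sum_le_sum fun k _ => ?_)
      rw [norm_smul, PiLp.norm_single, norm_one, mul_one]
    have h2 : ‖Lz (WithLp.toLp 2 c)‖ ≤ 2 * ‖x‖ := by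
      rw [hLz]
      refine (norm_sum_le _ _).trans ?_
      calc ∑ k, ‖c k • z k‖ ≤ ∑ k, 2 * ‖c k‖ := by
            refine Finset.sum_le_sum fun k _ => ?_
            rw [norm_smul, mul_comm]
            exact mul_le_mul_of_nonneg_right ((hz k).trans (hs k)) (norm_nonneg _)
        _ ≤ 2 * ‖x‖ := by rw [← Finset.mul_sum]; linarith
    have h3 : (WithLp.toLp 2 ((WithLp.toLp 2 c : G), Lz (WithLp.toLp 2 c)) : WithLp 2 (G × H)) =
        WithLp.toLp 2 ((WithLp.toLp 2 c : G), 0) + WithLp.toLp 2 (0, Lz (WithLp.toLp 2 c)) := by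
      rw [← WithLp.toLp_add]; simp
    rw [h3]
    refine (norm_add_le _ _).trans ?_
    rw [WithLp.norm_toLp_fst, WithLp.norm_toLp_snd]
    linarith
  have := gammaTwo_le_of_factorization A₀ B₀ hfac hAn hBn
  refine this.trans (le_of_eq ?_)
  norm_num

/-! ### Tails of the dual basis -/

section Tails

variable {𝕜 : Type*} [RCLike 𝕜] {p : ℝ≥0∞} [Fact (1 ≤ p)]

theorem norm_tailIndicator_le_one (n j : ℕ) : ‖(if n ≤ j then 1 else 0 : 𝕜)‖ ≤ 1 := by
  split_ifs <;> simp

/-- Functionals in the closed span of `h_j`, `j ≥ n`, only depend on the coordinates `j ≥ n`. -/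
theorem apply_tail_of_mem_closure_span {u : ℕ → ℝ} {n : ℕ} {f : RosenthalXDual 𝕜 p u}
    (hf : f ∈ (Submodule.span 𝕜 (dualUnitVector 𝕜 p u '' Set.Ici n)).topologicalClosure)
    (x : RosenthalX 𝕜 p u) :
    f (RosenthalX.mulOp p u (fun j => if n ≤ j then 1 else 0)
      (norm_tailIndicator_le_one n) x) = f x := by
  set x' := RosenthalX.mulOp p u (fun j => if n ≤ j then (1 : 𝕜) else 0)
    (norm_tailIndicator_le_one n) x
  let V : Submodule 𝕜 (RosenthalXDual 𝕜 p u) :=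
    LinearMap.ker (ContinuousLinearMap.apply 𝕜 𝕜 (x' - x) : RosenthalXDual 𝕜 p u →ₗ[𝕜] 𝕜)
  have hV : IsClosed (V : Set (RosenthalXDual 𝕜 p u)) :=
    (ContinuousLinearMap.apply 𝕜 𝕜 (x' - x)).isClosed_ker
  have hle : Submodule.span 𝕜 (dualUnitVector 𝕜 p u '' Set.Ici n) ≤ V := by
    rw [Submodule.span_le]
    rintro _ ⟨j, hj, rfl⟩
    change dualUnitVector 𝕜 p u j (x' - x) = 0
    rw [map_sub, sub_eq_zero, dualUnitVector_apply, dualUnitVector_apply,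
      RosenthalX.fstL_mulOp, lpMul_apply, if_pos (Set.mem_Ici.1 hj), one_mul]
  have h : f (x' - x) = 0 := Submodule.topologicalClosure_minimal _ hle hV hf
  rwa [map_sub, sub_eq_zero] at h

/-- Far out in the basis, `Δ^*` is a small operator on the `ℓ_q` part and factors through `ℓ_2` on
the other part. -/
theorem hilbertianOnTails_comp_DeltaAdj {Y : Type*} [NormedAddCommGroup Y] [NormedSpace 𝕜 Y]
    (W : WeightPair) (S : RosenthalXDual 𝕜 p W.w →L[𝕜] Y) (hS : ‖S‖ ≤ 1) :
    HilbertianOnTails (dualUnitVector 𝕜 p W.v) (S.comp (W.DeltaAdj 𝕜 p)) := by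
  have h22 : (2 : ℝ≥0∞).toReal.HolderConjugate (2 : ℝ≥0∞).toReal := by
    simpa using Real.HolderConjugate.two_two
  refine ⟨6, fun m => ?_⟩
  set ε : ℝ := (2 * 25 ^ m)⁻¹ with hε
  have hε0 : 0 < ε := by positivity
  obtain ⟨n, hn⟩ := eventually_atTop.1 (W.ratio_tendsto.eventually_le_const hε0)
  refine ⟨n, fun E _ hEm hE => ?_⟩
  let d : ℕ → 𝕜 := fun j => (if n ≤ j then 1 else 0) * ((W.w j / W.v j : ℝ) : 𝕜)
  have hdε : ∀ j, ‖d j‖ ≤ ε := fun j => by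
    by_cases h : n ≤ j
    · simp only [d, if_pos h, one_mul, RCLike.norm_ofReal]
      rw [abs_of_pos (div_pos (W.w_pos j) (W.v_pos j))]
      exact hn j h
    · simp only [d, if_neg h, zero_mul, norm_zero, hε0.le]
  have hε1 : ε ≤ 1 := by
    refine inv_le_one_of_one_le₀ ?_
    have : (1 : ℝ) ≤ 25 ^ m := one_le_pow₀ (by norm_num)
    linarith
  have hd1 : ∀ j, ‖d j‖ ≤ 1 := fun j => (hdε j).trans hε1
  let D : RosenthalX 𝕜 p W.w →L[𝕜] SeqLp 𝕜 p := (lpMul p d hd1).comp (RosenthalX.fstL 𝕜 p W.w)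
  let I : RosenthalX 𝕜 p W.w →L[𝕜] SeqLp 𝕜 2 :=
    (lpMul 2 (fun j => if n ≤ j then (1 : 𝕜) else 0) (norm_tailIndicator_le_one n)).comp
      (RosenthalX.sndL 𝕜 p W.w)
  have hD : ∀ x, ‖D x‖ ≤ ε * ‖x‖ := fun x =>
    (norm_lpMul_apply_le_of_le d hd1 hε0.le hdε _).trans
      (mul_le_mul_of_nonneg_left x.norm_fstL_apply_le hε0.le)
  have hI : ∀ x, ‖I x‖ ≤ ‖x‖ := fun x =>
    (norm_lpMul_apply_le _ (norm_tailIndicator_le_one n) _).trans x.norm_sndL_apply_le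
  let R₁ : StrongDual 𝕜 (SeqLp 𝕜 p) →L[𝕜] Y := S.comp (ContinuousLinearMap.precomp 𝕜 D)
  let R₂ : SeqLp 𝕜 2 →L[𝕜] Y :=
    S.comp ((ContinuousLinearMap.precomp 𝕜 I).comp (lpPairing 𝕜 2 2))
  refine gammaTwo_le_of_nonlinear_lift _ R₁ R₂ (fun f => ?_) ?_ ?_
  · obtain ⟨F, hF1, hF2, hF⟩ := RosenthalX.exists_dualSum_eq (f : RosenthalXDual 𝕜 p W.v)
    obtain ⟨z, hz, -, hzF⟩ := exists_lpPairing_eq (q := 2) h22 F.2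
    refine ⟨F.1, z, hF1, hz.trans hF2, ?_⟩
    change S (W.DeltaAdj 𝕜 p f) = S _ + S _
    rw [← map_add]
    congr 1
    ext x
    have h1 := apply_tail_of_mem_closure_span (hE f.2) (W.Delta 𝕜 p x)
    change (f : RosenthalXDual 𝕜 p W.v) (W.Delta 𝕜 p x) = F.1 (D x) + lpPairing 𝕜 2 2 z (I x)
    rw [hzF, ← h1, ← hF, RosenthalX.dualSum_apply]
    congr 2
    ext j
    rw [RosenthalX.fstL_mulOp, lpMul_apply, W.fstL_Delta, ← mul_assoc]
    rfl
  · have : ‖R₁‖ ≤ ε := by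
      refine ContinuousLinearMap.opNorm_le_bound _ hε0.le fun F => ?_
      refine (S.le_of_opNorm_le hS _).trans ?_
      rw [one_mul]
      refine ContinuousLinearMap.opNorm_le_bound _ (by positivity) fun x => ?_
      refine (F.le_opNorm (D x)).trans ?_
      rw [mul_comm ε, mul_assoc]
      exact mul_le_mul_of_nonneg_left (hD x) (norm_nonneg _)
    rw [hEm]
    calc ‖R₁‖ * (2 * 25 ^ m) ≤ ε * (2 * 25 ^ m) := by gcongr
      _ = 1 := inv_mul_cancel₀ (by positivity)
  · refine ContinuousLinearMap.opNorm_le_bound _ zero_le_one fun z => ?_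
    refine (S.le_of_opNorm_le hS _).trans ?_
    rw [one_mul, one_mul]
    refine ContinuousLinearMap.opNorm_le_bound _ (norm_nonneg _) fun x => ?_
    refine (ContinuousLinearMap.le_opNorm (lpPairing 𝕜 2 2 z) (I x)).trans ?_
    exact mul_le_mul (norm_lpPairing_apply_le z) (hI x) (norm_nonneg _) (norm_nonneg _)

end Tails

/-! ### Moments of sums of independent symmetric random variables -/

section TwoPoint

/-- The parallelogram law together with the concavity of `t ↦ t ^ (q / 2)`. -/
theorem norm_add_rpow_add_norm_sub_rpow_le {𝕜 : Type*} [RCLike 𝕜] {q : ℝ} (hq0 : 0 < q)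
    (hq : q ≤ 2) (a b : 𝕜) :
    ‖a + b‖ ^ q + ‖a - b‖ ^ q ≤ 2 * (‖a‖ ^ q + ‖b‖ ^ q) := by
  have key : ∀ x : ℝ, 0 ≤ x → (x ^ 2) ^ (q / 2) = x ^ q := fun x hx => by
    rw [← Real.rpow_natCast, ← Real.rpow_mul hx]; congr 1; push_cast; ring
  have hpar := parallelogram_law_with_norm 𝕜 a b
  have hconc := (Real.concaveOn_rpow (p := q / 2) (by linarith) (by linarith)).2
    (Set.mem_Ici.2 (sq_nonneg ‖a + b‖)) (Set.mem_Ici.2 (sq_nonneg ‖a - b‖))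
    (show (0 : ℝ) ≤ 1 / 2 by norm_num) (show (0 : ℝ) ≤ 1 / 2 by norm_num) (by norm_num)
  simp only [smul_eq_mul] at hconc
  rw [key _ (norm_nonneg _), key _ (norm_nonneg _),
    show 1 / 2 * ‖a + b‖ ^ 2 + 1 / 2 * ‖a - b‖ ^ 2 = ‖a‖ ^ 2 + ‖b‖ ^ 2 by linarith] at hconc
  have hsub := Real.rpow_add_le_add_rpow (p := q / 2) (sq_nonneg ‖a‖) (sq_nonneg ‖b‖)
    (by linarith) (by linarith)
  rw [key _ (norm_nonneg _), key _ (norm_nonneg _)] at hsub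
  linarith

theorem one_add_rpow_add_one_sub_rpow_le {p : ℝ} (hp : 2 ≤ p) {b : ℝ} (hb0 : 0 ≤ b)
    (hb1 : b ≤ 1) : (1 + b) ^ p + (1 - b) ^ p ≤ 2 + 2 * (p ^ 2 * 2 ^ p) * b ^ 2 := by
  -- tangent line bounds for the convex functions `t ↦ t ^ s`, `s ≥ 1`
  have tangent : ∀ s : ℝ, 1 ≤ s → ∀ h : ℝ, -1 ≤ h → (1 + h) ^ s ≤ 1 + s * h * (1 + h) ^ (s - 1) := by
    intro s hs h hh
    rcases hh.eq_or_lt with rfl | hh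
    · rcases hs.eq_or_lt with rfl | hs
      · norm_num
      · norm_num
        rw [Real.zero_rpow (by linarith), Real.zero_rpow (by linarith)]; norm_num
    have h0 : 0 < 1 + h := by linarith
    have hB := one_add_mul_self_le_rpow_one_add (s := -h / (1 + h)) (by
      rw [le_div_iff₀ h0]; linarith) hs
    rw [show 1 + -h / (1 + h) = (1 + h)⁻¹ by field_simp; ring, Real.inv_rpow h0.le] at hB
    have hpos : 0 < (1 + h) ^ s := Real.rpow_pos_of_pos h0 _
    have h2 := mul_le_mul_of_nonneg_right hB hpos.le
    rw [inv_mul_cancel₀ hpos.ne'] at h2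
    have h3 : (1 + h) ^ s = (1 + h) ^ (s - 1) * (1 + h) := by
      rw [← Real.rpow_add_one h0.ne']; congr 1; ring
    have h4 : (1 + s * (-h / (1 + h))) * (1 + h) ^ s =
        (1 + h) ^ s - s * h * (1 + h) ^ (s - 1) := by
      rw [h3]; field_simp; ring
    rw [h4] at h2
    linarith
  have h1 := tangent p (by linarith) b (by linarith)
  have h2 := tangent p (by linarith) (-b) (by linarith)
  have h3 := tangent (p - 1) (by linarith) b (by linarith)
  have h4 := one_add_mul_self_le_rpow_one_add (s := -b) (by linarith) (p := p - 1) (by linarith)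
  have h5 : (1 + b) ^ (p - 1 - 1) ≤ 2 ^ p := by
    calc (1 + b) ^ (p - 1 - 1) ≤ 2 ^ (p - 1 - 1) :=
          Real.rpow_le_rpow (by linarith) (by linarith) (by linarith)
      _ ≤ 2 ^ p := Real.rpow_le_rpow_of_exponent_le (by norm_num) (by linarith)
  have h6 : (1 : ℝ) ≤ 2 ^ p := Real.one_le_rpow (by norm_num) (by linarith)
  have h7 : (1 + b) ^ (p - 1) - (1 + -b) ^ (p - 1) ≤ (p - 1) * b * (2 ^ p + 1) := by
    have : (p - 1) * b * (1 + b) ^ (p - 1 - 1) ≤ (p - 1) * b * 2 ^ p :=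
      mul_le_mul_of_nonneg_left h5 (mul_nonneg (by linarith) hb0)
    linarith
  have h8 : p * b * ((1 + b) ^ (p - 1) - (1 + -b) ^ (p - 1)) ≤
      p * b * ((p - 1) * b * (2 ^ p + 1)) :=
    mul_le_mul_of_nonneg_left h7 (mul_nonneg (by linarith) hb0)
  have h9 : p * b * ((p - 1) * b * (2 ^ p + 1)) ≤ 2 * (p ^ 2 * 2 ^ p) * b ^ 2 := by
    have : p * (p - 1) * (2 ^ p + 1) ≤ p ^ 2 * (2 * 2 ^ p) := by
      apply mul_le_mul _ (by linarith) (by linarith) (by positivity)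
      nlinarith
    nlinarith [mul_le_mul_of_nonneg_right this (sq_nonneg b)]
  rw [← sub_eq_add_neg] at h2 h8
  linarith

/-- A two point form of Rosenthal's inequality; the term `|a| ^ (p - 2) * b ^ 2` comes from the second
order behaviour of `t ↦ |t| ^ p` at `a`, which is the part left after averaging over `±b`. -/
theorem abs_add_rpow_add_abs_sub_rpow_le {p : ℝ} (hp : 2 ≤ p) (a b : ℝ) :
    |a + b| ^ p + |a - b| ^ p ≤
      2 * (|a| ^ p + p ^ 2 * 2 ^ p * (|a| ^ (p - 2) * b ^ 2 + |b| ^ p)) := by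
  have h2p : (1 : ℝ) ≤ 2 ^ p := Real.one_le_rpow (by norm_num) (by linarith)
  rcases le_total |b| |a| with h | h
  · rcases (abs_nonneg a).eq_or_lt with ha | ha
    · have hb : b = 0 := by rw [← ha] at h; exact abs_nonpos_iff.1 h
      have ha' : a = 0 := abs_eq_zero.1 ha.symm
      subst hb ha'
      simp [Real.zero_rpow (show p ≠ 0 by linarith)]
    have h1 := one_add_rpow_add_one_sub_rpow_le hp (b := |b| / |a|) (by positivity)
      ((div_le_one ha).2 h)
    have hsum : |a + b| ^ p + |a - b| ^ p = (|a| + |b|) ^ p + (|a| - |b|) ^ p := by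
      rcases abs_cases a with ⟨h1, h1'⟩ | ⟨h1, h1'⟩ <;>
        rcases abs_cases b with ⟨h2, h2'⟩ | ⟨h2, h2'⟩ <;>
          rw [h1, h2] at h <;> rw [h1, h2]
      · rw [abs_of_nonneg (by linarith : 0 ≤ a + b), abs_of_nonneg (by linarith : 0 ≤ a - b)]
      · rw [abs_of_nonneg (by linarith : 0 ≤ a + b), abs_of_nonneg (by linarith : 0 ≤ a - b),
          add_comm]
        congr 2; ring
      · rw [abs_of_nonpos (by linarith : a + b ≤ 0), abs_of_nonpos (by linarith : a - b ≤ 0),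
          add_comm]
        congr 2 <;> ring
      · rw [abs_of_nonpos (by linarith : a + b ≤ 0), abs_of_nonpos (by linarith : a - b ≤ 0)]
        congr 2 <;> ring
    have hfac : (|a| + |b|) ^ p + (|a| - |b|) ^ p =
        |a| ^ p * ((1 + |b| / |a|) ^ p + (1 - |b| / |a|) ^ p) := by
      rw [mul_add, ← Real.mul_rpow ha.le (by positivity), ← Real.mul_rpow ha.le (by
        rw [sub_nonneg]; exact (div_le_one ha).2 h)]
      congr 2 <;> field_simp
    have hpow : |a| ^ p * (|b| / |a|) ^ 2 = |a| ^ (p - 2) * b ^ 2 := by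
      rw [Real.rpow_sub ha, div_pow, sq_abs b]
      norm_num
      ring
    rw [hsum, hfac]
    calc _ ≤ |a| ^ p * (2 + 2 * (p ^ 2 * 2 ^ p) * (|b| / |a|) ^ 2) := by gcongr
      _ = 2 * (|a| ^ p + p ^ 2 * 2 ^ p * (|a| ^ p * (|b| / |a|) ^ 2)) := by ring
      _ = 2 * (|a| ^ p + p ^ 2 * 2 ^ p * (|a| ^ (p - 2) * b ^ 2)) := by rw [hpow]
      _ ≤ _ := by
        have : 0 ≤ |b| ^ p := by positivity
        gcongr
        linarith
  · have h1 : |a + b| ^ p ≤ 2 ^ p * |b| ^ p := by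
      rw [← Real.mul_rpow (by norm_num) (abs_nonneg b)]
      exact Real.rpow_le_rpow (abs_nonneg _) ((abs_add_le a b).trans (by linarith)) (by linarith)
    have h2 : |a - b| ^ p ≤ 2 ^ p * |b| ^ p := by
      rw [← Real.mul_rpow (by norm_num) (abs_nonneg b)]
      exact Real.rpow_le_rpow (abs_nonneg _) ((abs_sub a b).trans (by linarith)) (by linarith)
    have h3 : 2 ^ p * |b| ^ p ≤ p ^ 2 * 2 ^ p * |b| ^ p := by
      rw [mul_assoc]
      exact le_mul_of_one_le_left (by positivity) (by nlinarith)
    have h4 : 0 ≤ |a| ^ p := by positivity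
    have h5 : 0 ≤ p ^ 2 * 2 ^ p * (|a| ^ (p - 2) * b ^ 2) := by positivity
    linarith

end TwoPoint

section Sums

variable {Ω : Type*} [MeasurableSpace Ω] {P : Measure Ω} [IsProbabilityMeasure P]
variable {𝕜 : Type*} [RCLike 𝕜]

/-- A symmetric summand independent of the rest may be replaced by its negative. -/
theorem integral_comp_add_eq_integral_comp_sub {S X : Ω → 𝕜} (hS : Measurable S)
    (hX : Measurable X) (hSX : IndepFun S X P) (hsymm : P.map X = P.map (fun ω => -X ω))
    {g : 𝕜 → ℝ} (hg : Measurable g) :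
    ∫ ω, g (S ω + X ω) ∂P = ∫ ω, g (S ω - X ω) ∂P := by
  have h1 := (indepFun_iff_map_prod_eq_prod_map_map hS.aemeasurable hX.aemeasurable).1 hSX
  have h2 := (indepFun_iff_map_prod_eq_prod_map_map hS.aemeasurable hX.neg.aemeasurable).1
    (hSX.comp measurable_id measurable_neg)
  have h3 : P.map (fun ω => (S ω, X ω)) = P.map (fun ω => (S ω, -X ω)) := by
    rw [h1, hsymm]; exact h2.symm
  have hm : Measurable fun y : 𝕜 × 𝕜 => g (y.1 + y.2) := by fun_prop
  have e1 := integral_map (hS.prodMk hX).aemeasurable (hm.aestronglyMeasurable (μ := P.map _))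
  have e2 := integral_map (hS.prodMk hX.neg).aemeasurable
    (hm.aestronglyMeasurable (μ := P.map _))
  rw [← e1, h3]
  refine e2.trans ?_
  simp only [Pi.neg_apply, sub_eq_add_neg]

variable {ι : Type*} {X : ι → Ω → 𝕜}

theorem integrable_norm_rpow_of_memLp_top {f : Ω → 𝕜} (hf : MemLp f ∞ P) {t : ℝ} (ht : 0 < t) :
    Integrable (fun ω => ‖f ω‖ ^ t) P := by
  have := (hf.mono_exponent (p := ENNReal.ofReal t) le_top).integrable_norm_rpow
    (by simpa using ht) ENNReal.ofReal_ne_top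
  rwa [ENNReal.toReal_ofReal ht.le] at this

/-- For symmetric independent summands, `L_q` has type `q` with constant `1`. -/
theorem integral_norm_sum_rpow_le {q : ℝ} (hq0 : 0 < q) (hq : q ≤ 2) (hind : iIndepFun X P)
    (hmeas : ∀ j, Measurable (X j)) (hbdd : ∀ j, MemLp (X j) ∞ P)
    (hsymm : ∀ j, P.map (X j) = P.map (fun ω => -X j ω)) (s : Finset ι) :
    ∫ ω, ‖∑ j ∈ s, X j ω‖ ^ q ∂P ≤ ∑ j ∈ s, ∫ ω, ‖X j ω‖ ^ q ∂P := by
  classical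
  induction s using Finset.induction_on with
  | empty => simp [Real.zero_rpow hq0.ne']
  | insert k s hk ih =>
    have hI := hind.indepFun_finsetSum_of_notMem hmeas hk
    have hSm : Measurable (∑ j ∈ s, X j) := by
      rw [Finset.sum_fn]; exact Finset.measurable_sum s fun j _ => hmeas j
    have hSb : MemLp (∑ j ∈ s, X j) ∞ P := memLp_finsetSum' s fun j _ => hbdd j
    have heq := integral_comp_add_eq_integral_comp_sub hSm (hmeas k) hI (hsymm k)
      (g := fun x => ‖x‖ ^ q) (by fun_prop)
    simp only [Finset.sum_apply] at heq
    have i1 := integrable_norm_rpow_of_memLp_top (hSb.add (hbdd k)) hq0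
    have i2 := integrable_norm_rpow_of_memLp_top (hSb.sub (hbdd k)) hq0
    have i3 := integrable_norm_rpow_of_memLp_top hSb hq0
    have i4 := integrable_norm_rpow_of_memLp_top (hbdd k) hq0
    simp only [Pi.add_apply, Pi.sub_apply, Finset.sum_apply] at i1 i2 i3
    have hle : ∫ ω, (‖∑ j ∈ s, X j ω + X k ω‖ ^ q + ‖∑ j ∈ s, X j ω - X k ω‖ ^ q) ∂P ≤
        ∫ ω, 2 * (‖∑ j ∈ s, X j ω‖ ^ q + ‖X k ω‖ ^ q) ∂P :=
      integral_mono (i1.add i2) ((i3.add i4).const_mul 2) fun ω =>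
        norm_add_rpow_add_norm_sub_rpow_le hq0 hq _ _
    rw [integral_add i1 i2, ← heq, integral_const_mul, integral_add i3 i4] at hle
    simp only [Finset.sum_insert hk]
    simp only [add_comm (X k _)]
    linarith

/-- The constant in Rosenthal's inequality `integral_abs_sum_rpow_le`. -/
def rosenthalConst (p : ℝ) : ℝ := max 1 ((3 * (p ^ 2 * 2 ^ p)) ^ (p / 2))

theorem one_le_rosenthalConst (p : ℝ) : 1 ≤ rosenthalConst p := le_max_left _ _

/-- Rosenthal's inequality for symmetric random variables, normalized so that both terms on the
right hand side are at most `1`. -/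
theorem integral_abs_sum_rpow_le {p : ℝ} (hp : 2 < p) {X : ι → Ω → ℝ} (hind : iIndepFun X P)
    (hmeas : ∀ j, Measurable (X j)) (hbdd : ∀ j, MemLp (X j) ∞ P)
    (hsymm : ∀ j, P.map (X j) = P.map (fun ω => -X j ω)) (s : Finset ι)
    (hB : ∑ j ∈ s, ∫ ω, |X j ω| ^ p ∂P ≤ 1) (hA : ∑ j ∈ s, ∫ ω, X j ω ^ 2 ∂P ≤ 1) :
    ∫ ω, |∑ j ∈ s, X j ω| ^ p ∂P ≤ rosenthalConst p := by
  classical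
  have hp0 : 0 < p := by linarith
  set C := p ^ 2 * 2 ^ p with hC
  have hC1 : 1 ≤ C := by
    have : (1 : ℝ) ≤ 2 ^ p := Real.one_le_rpow (by norm_num) (by linarith)
    nlinarith
  let m : Finset ι → ℝ := fun t => ∫ ω, |∑ j ∈ t, X j ω| ^ p ∂P
  obtain ⟨t₀, ht₀, hmax⟩ := Finset.exists_max_image s.powerset m ⟨∅, Finset.empty_mem_powerset s⟩
  set M := m t₀ with hM
  have hsM : m s ≤ M := hmax s (Finset.mem_powerset_self s)
  refine hsM.trans ?_
  rcases le_or_gt M 1 with h1 | h1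
  · exact h1.trans (one_le_rosenthalConst p)
  have hM0 : 0 < M := zero_lt_one.trans h1
  set D := M ^ (1 - 2 / p) with hD
  have hD1 : 1 ≤ D := Real.one_le_rpow h1.le (by
    rw [sub_nonneg, div_le_one hp0]; exact hp.le)
  have hSb : ∀ t : Finset ι, MemLp (fun ω => ∑ j ∈ t, X j ω) ∞ P := fun t =>
    memLp_finsetSum t fun j _ => hbdd j
  have iS : ∀ (t : Finset ι) {r : ℝ}, 0 < r → Integrable (fun ω => |∑ j ∈ t, X j ω| ^ r) P :=
    fun t r hr => integrable_norm_rpow_of_memLp_top (hSb t) hr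
  have iX : ∀ (j : ι) {r : ℝ}, 0 < r → Integrable (fun ω => |X j ω| ^ r) P :=
    fun j r hr => integrable_norm_rpow_of_memLp_top (hbdd j) hr
  -- moments of order `p - 2` are controlled by `M`
  have hlow : ∀ t ⊆ s, ∫ ω, |∑ j ∈ t, X j ω| ^ (p - 2) ∂P ≤ 2 * D := by
    intro t ht
    have hpt : ∀ x : ℝ, 0 ≤ x → x ^ (p - 2) ≤ D * (x ^ p / M + 1) := by
      intro x hx
      set y := x / M ^ (1 / p) with hy
      have hy0 : 0 ≤ y := by positivity
      have hxy : x = y * M ^ (1 / p) := by rw [hy]; field_simp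
      have e1 : x ^ (p - 2) = y ^ (p - 2) * D := by
        rw [hxy, Real.mul_rpow hy0 (by positivity), ← Real.rpow_mul hM0.le, hD]
        congr 2
        field_simp
      have e2 : x ^ p / M = y ^ p := by
        rw [hxy, Real.mul_rpow hy0 (by positivity), ← Real.rpow_mul hM0.le,
          one_div_mul_cancel hp0.ne', Real.rpow_one]
        field_simp
      rw [e1, e2, mul_comm]
      refine mul_le_mul_of_nonneg_left ?_ (by linarith)
      rcases le_total y 1 with h | h
      · have := Real.rpow_le_one hy0 h (show 0 ≤ p - 2 by linarith)
        have := Real.rpow_nonneg hy0 p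
        linarith
      · have := Real.rpow_le_rpow_of_exponent_le h (show p - 2 ≤ p by linarith)
        linarith
    calc ∫ ω, |∑ j ∈ t, X j ω| ^ (p - 2) ∂P
        ≤ ∫ ω, D * (|∑ j ∈ t, X j ω| ^ p / M + 1) ∂P :=
          integral_mono (iS t (by linarith))
            ((((iS t hp0).div_const M).add (integrable_const 1)).const_mul D)
            fun ω => hpt _ (abs_nonneg _)
      _ = D * (m t / M + 1) := by
          rw [integral_const_mul, integral_add ((iS t hp0).div_const M) (integrable_const 1),
            integral_div, integral_const]
          simp [m]
      _ ≤ D * (1 + 1) := by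
          have : m t / M ≤ 1 := (div_le_one hM0).2 (hmax t (Finset.mem_powerset.2 ht))
          gcongr
      _ = 2 * D := by ring
  have hind' : ∀ t ⊆ s, m t ≤
      ∑ j ∈ t, C * (2 * D * ∫ ω, X j ω ^ 2 ∂P + ∫ ω, |X j ω| ^ p ∂P) := by
    intro t
    induction t using Finset.induction_on with
    | empty => intro _; simp [m, Real.zero_rpow hp0.ne']
    | insert k t hk ih =>
      intro hts
      have hts' : t ⊆ s := (Finset.subset_insert k t).trans hts
      have hI := hind.indepFun_finsetSum_of_notMem hmeas hk
      have hSm : Measurable (∑ j ∈ t, X j) := by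
        rw [Finset.sum_fn]; exact Finset.measurable_sum t fun j _ => hmeas j
      have heq := integral_comp_add_eq_integral_comp_sub hSm (hmeas k) hI (hsymm k)
        (g := fun x => |x| ^ p) (by fun_prop)
      have hprod := (hI.comp (φ := fun x => |x| ^ (p - 2)) (ψ := fun x => x ^ 2)
        (by fun_prop) (by fun_prop)).integral_fun_mul_eq_mul_integral
        (by exact (by fun_prop : Measurable _).aestronglyMeasurable)
        (by exact (by fun_prop : Measurable _).aestronglyMeasurable)
      simp only [Function.comp_apply, Finset.sum_apply] at heq hprod
      have i1 := integrable_norm_rpow_of_memLp_top ((hSb t).add (hbdd k)) hp0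
      have i2 := integrable_norm_rpow_of_memLp_top ((hSb t).sub (hbdd k)) hp0
      simp only [Pi.add_apply, Pi.sub_apply, Real.norm_eq_abs] at i1 i2
      have i3 : Integrable (fun ω => |∑ j ∈ t, X j ω| ^ (p - 2) * X k ω ^ 2) P := by
        have hb : MemLp (fun ω => X k ω ^ 2) ∞ P := by
          have := (hbdd k).mul (r := ∞) (hbdd k)
          simpa only [pow_two] using! this
        exact (iS t (by linarith)).mul_of_top_left hb
      have i4 : Integrable (fun ω => |∑ j ∈ t, X j ω| ^ (p - 2) * X k ω ^ 2 + |X k ω| ^ p) P :=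
        i3.add (iX k hp0)
      have hle : ∫ ω, (|∑ j ∈ t, X j ω + X k ω| ^ p + |∑ j ∈ t, X j ω - X k ω| ^ p) ∂P ≤
          ∫ ω, 2 * (|∑ j ∈ t, X j ω| ^ p +
            C * (|∑ j ∈ t, X j ω| ^ (p - 2) * X k ω ^ 2 + |X k ω| ^ p)) ∂P :=
        integral_mono (i1.add i2)
          (((iS t hp0).add (i4.const_mul C)).const_mul 2) fun ω =>
          abs_add_rpow_add_abs_sub_rpow_le hp.le _ _
      rw [integral_add i1 i2, ← heq, integral_const_mul,
        integral_add (iS t hp0) (i4.const_mul C), integral_const_mul,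
        integral_add i3 (iX k hp0), hprod] at hle
      have hX2 : 0 ≤ ∫ ω, X k ω ^ 2 ∂P := integral_nonneg fun ω => sq_nonneg _
      have hmul := mul_le_mul_of_nonneg_right (hlow t hts') hX2
      have hmul' := mul_le_mul_of_nonneg_left hmul (show 0 ≤ C by linarith)
      have hih := ih hts'
      rw [Finset.sum_insert hk]
      have hmk : m (insert k t) = ∫ ω, |∑ j ∈ t, X j ω + X k ω| ^ p ∂P := by
        simp only [m, Finset.sum_insert hk]
        simp only [add_comm (X k _)]
      have hmt : m t = ∫ ω, |∑ j ∈ t, X j ω| ^ p ∂P := rfl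
      rw [hmk]
      linarith
  have hMle : M ≤ 3 * C * D := by
    have h2 := hind' t₀ (Finset.mem_powerset.1 ht₀)
    rw [← Finset.mul_sum, Finset.sum_add_distrib, ← Finset.mul_sum] at h2
    have hA' : ∑ j ∈ t₀, ∫ ω, X j ω ^ 2 ∂P ≤ 1 :=
      (Finset.sum_le_sum_of_subset_of_nonneg (Finset.mem_powerset.1 ht₀) fun j _ _ =>
        integral_nonneg fun ω => sq_nonneg _).trans hA
    have hB' : ∑ j ∈ t₀, ∫ ω, |X j ω| ^ p ∂P ≤ 1 :=
      (Finset.sum_le_sum_of_subset_of_nonneg (Finset.mem_powerset.1 ht₀) fun j _ _ =>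
        integral_nonneg fun ω => Real.rpow_nonneg (abs_nonneg _) _).trans hB
    calc M ≤ C * (2 * D * ∑ j ∈ t₀, ∫ ω, X j ω ^ 2 ∂P + ∑ j ∈ t₀, ∫ ω, |X j ω| ^ p ∂P) := h2
      _ ≤ C * (2 * D * 1 + D) := by gcongr; exact hB'.trans hD1
      _ = 3 * C * D := by ring
  have hM2 : M ^ (2 / p) ≤ 3 * C := by
    have h3 : M = M ^ (2 / p) * D := by
      rw [hD, ← Real.rpow_add hM0, add_sub_cancel, Real.rpow_one]
    have hDpos : 0 < D := by linarith
    rw [h3] at hMle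
    exact le_of_mul_le_mul_right hMle hDpos
  refine le_trans ?_ (le_max_right _ _)
  calc M = (M ^ (2 / p)) ^ (p / 2) := by
        rw [← Real.rpow_mul hM0.le, div_mul_div_cancel₀ (by linarith : p ≠ 0), div_self two_ne_zero,
          Real.rpow_one]
    _ ≤ _ := Real.rpow_le_rpow (by positivity) hM2 (by positivity)

end Sums

/-! ### Three valued systems in `L_q` and the spaces `𝔛_{q,v}` -/

section ThreeValued

variable {Ω : Type*} [MeasurableSpace Ω] {P : Measure Ω}

/-- `Y` is a sequence of bounded independent symmetric random variables whose absolute moments are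
those of variables `Y j` with values `± c j` and `0`, normalized in `L_q`; moreover
`v j = 1 / ‖Y j‖₂`. -/
structure HasLevels (P : Measure Ω) (q : ℝ) (Y : ℕ → Ω → ℝ) (c v : ℕ → ℝ) : Prop where
  measurable : ∀ j, Measurable (Y j)
  indep : iIndepFun Y P
  symm : ∀ j, P.map (Y j) = P.map (fun ω => -Y j ω)
  memLp_top : ∀ j, MemLp (Y j) ∞ P
  c_pos : ∀ j, 0 < c j
  moment : ∀ j {t : ℝ}, 0 < t → ∫ ω, |Y j ω| ^ t ∂P = c j ^ (t - q)
  v_pos : ∀ j, 0 < v j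
  v_sq : ∀ j, v j ^ 2 = c j ^ (q - 2)

theorem map_eq_map_neg_of_three_valued {Y : Ω → ℝ} (hY : Measurable Y) {c : ℝ} (hc : 0 < c)
    (h3 : ∀ᵐ ω ∂P, Y ω = c ∨ Y ω = 0 ∨ Y ω = -c)
    (hsymm : P {ω | Y ω = c} = P {ω | Y ω = -c}) :
    P.map Y = P.map (fun ω => -Y ω) := by
  -- the law of `Z ∈ {Y, -Y}` is a combination of three point masses
  have key : ∀ Z : Ω → ℝ, Measurable Z → (∀ᵐ ω ∂P, Z ω = c ∨ Z ω = 0 ∨ Z ω = -c) →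
      ∀ A : Set ℝ, MeasurableSet A → P (Z ⁻¹' A) = A.indicator (fun _ => P {ω | Z ω = c}) c +
        (A.indicator (fun _ => P {ω | Z ω = -c}) (-c) +
          A.indicator (fun _ => P {ω | Z ω = 0}) 0) := by
    intro Z hZ hZ3 A hA
    have hm : ∀ x : ℝ, MeasurableSet {ω | Z ω = x} := fun x => hZ (measurableSet_singleton x)
    have hpiece : ∀ x : ℝ, P (Z ⁻¹' A ∩ {ω | Z ω = x}) =
        A.indicator (fun _ => P {ω | Z ω = x}) x := by
      intro x
      by_cases hx : x ∈ A
      · rw [Set.indicator_of_mem hx]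
        congr 1
        ext ω
        simp only [Set.mem_inter_iff, Set.mem_preimage, Set.mem_ofPred_eq, and_iff_right_iff_imp]
        rintro rfl
        exact hx
      · rw [Set.indicator_of_notMem hx]
        convert measure_empty (μ := P)
        ext ω
        simp only [Set.mem_inter_iff, Set.mem_preimage, Set.mem_ofPred_eq, Set.mem_empty_iff_false,
          iff_false, not_and]
        rintro h rfl
        exact hx h
    rw [← measure_inter_add_sdiff (Z ⁻¹' A) (hm c), hpiece,
      ← measure_inter_add_sdiff (Z ⁻¹' A \ {ω | Z ω = c}) (hm (-c))]
    congr 2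
    · rw [← hpiece]
      congr 1
      ext ω
      simp only [Set.mem_inter_iff, Set.mem_sdiff, Set.mem_preimage, Set.mem_ofPred_eq]
      constructor
      · tauto
      · rintro ⟨h, h'⟩
        exact ⟨⟨h, by rw [h']; linarith⟩, h'⟩
    · rw [← hpiece]
      refine measure_congr ?_
      filter_upwards [hZ3] with ω hω
      refine propext ⟨fun h => ⟨h.1.1, ?_⟩, fun h => ⟨⟨h.1, ?_⟩, ?_⟩⟩
      · rcases hω with h' | h' | h'
        exacts [absurd h' h.1.2, h', absurd h' h.2]
      · change ¬ (Z ω = c)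
        have : Z ω = 0 := h.2
        rw [this]; exact hc.ne
      · change ¬ (Z ω = -c)
        have : Z ω = 0 := h.2
        rw [this]; linarith
  refine Measure.ext fun A hA => ?_
  rw [Measure.map_apply hY hA, Measure.map_apply (f := fun ω => -Y ω) hY.neg hA, key Y hY h3 A hA]
  rw [key (fun ω => -Y ω) hY.neg (by filter_upwards [h3] with ω hω; grind) A hA]
  simp only [neg_eq_iff_eq_neg, neg_neg, neg_zero, hsymm]

theorem IsThreeValuedSystem.exists_hasLevels [IsProbabilityMeasure P] {q : ℝ} (hq1 : 1 < q)
    {Y : ℕ → Ω → ℝ} (h : IsThreeValuedSystem P q Y) {v : ℕ → ℝ} (hv : ∀ j, v j = (eLpNorm (Y j) 2 P).toReal⁻¹) :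
    ∃ c, HasLevels P q Y c v := by
  have hq0 : 0 < q := by linarith
  choose c hc h3 hs using h.symm_three_valued
  have hbdd : ∀ j, MemLp (Y j) ∞ P := fun j => by
    refine memLp_top_of_bound (h.measurable j).aestronglyMeasurable (c j) ?_
    filter_upwards [h3 j] with ω hω
    rw [Real.norm_eq_abs]
    rcases hω with h | h | h <;> rw [h] <;> simp [abs_of_pos (hc j), (hc j).le]
  -- all moments are multiples of the probability that `Y j` does not vanish
  have hmom : ∀ j {t : ℝ}, 0 < t →
      ∫ ω, |Y j ω| ^ t ∂P = c j ^ t * P.real {ω | Y j ω ≠ 0} := by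
    intro j t ht
    have hm : MeasurableSet {ω | Y j ω ≠ 0} :=
      (h.measurable j (measurableSet_singleton 0)).compl
    have : ∫ ω, |Y j ω| ^ t ∂P = ∫ ω, {ω | Y j ω ≠ 0}.indicator (fun _ => c j ^ t) ω ∂P := by
      refine integral_congr_ae ?_
      filter_upwards [h3 j] with ω hω
      rcases hω with h | h | h
      · rw [Set.indicator_of_mem (by change Y j ω ≠ 0; rw [h]; exact (hc j).ne'), h,
          abs_of_pos (hc j)]
      · rw [Set.indicator_of_notMem (by change ¬ (Y j ω ≠ 0); simp [h]), h, abs_zero,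
          Real.zero_rpow ht.ne']
      · rw [Set.indicator_of_mem (by change Y j ω ≠ 0; rw [h]; linarith [hc j]), h, abs_neg,
          abs_of_pos (hc j)]
    rw [this, integral_indicator_const _ hm, smul_eq_mul, mul_comm]
  have hnorm : ∀ j {t : ℝ}, 0 < t → (eLpNorm (Y j) (ENNReal.ofReal t) P).toReal =
      (∫ ω, |Y j ω| ^ t ∂P) ^ t⁻¹ := by
    intro j t ht
    rw [MemLp.eLpNorm_eq_integral_rpow_norm (by simpa using ht) ENNReal.ofReal_ne_top
      ((hbdd j).mono_exponent le_top), ENNReal.toReal_ofReal ht.le, ENNReal.toReal_ofReal]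
    · rfl
    · exact Real.rpow_nonneg (integral_nonneg fun ω => by positivity) _
  have hmass : ∀ j, P.real {ω | Y j ω ≠ 0} = c j ^ (-q) := by
    intro j
    have h1 := hnorm j hq0
    rw [h.normalized j, ENNReal.toReal_one] at h1
    have h0 : 0 ≤ ∫ ω, |Y j ω| ^ q ∂P := integral_nonneg fun ω => by positivity
    have h2 : ∫ ω, |Y j ω| ^ q ∂P = 1 := by
      rw [← Real.rpow_inv_rpow h0 hq0.ne', ← h1, Real.one_rpow]
    rw [hmom j hq0] at h2
    rw [Real.rpow_neg (hc j).le]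
    exact eq_inv_of_mul_eq_one_right h2
  have hmom' : ∀ j {t : ℝ}, 0 < t → ∫ ω, |Y j ω| ^ t ∂P = c j ^ (t - q) := by
    intro j t ht
    rw [hmom j ht, hmass, ← Real.rpow_add (hc j), sub_eq_add_neg]
  have hv' : ∀ j, v j = (c j ^ (2 - q)) ^ (-(1 / 2) : ℝ) := by
    intro j
    have h2 := hnorm j two_pos
    rw [ENNReal.ofReal_ofNat, hmom' j two_pos] at h2
    rw [hv, h2, Real.rpow_neg (Real.rpow_nonneg (hc j).le _), one_div]
  refine ⟨c, h.measurable, h.indep, fun j => map_eq_map_neg_of_three_valued (h.measurable j) (hc j)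
    (h3 j) (hs j), hbdd, hc, hmom', fun j => ?_, fun j => ?_⟩
  · rw [hv']
    exact Real.rpow_pos_of_pos (Real.rpow_pos_of_pos (hc j) _) _
  · rw [hv', ← Real.rpow_natCast, ← Real.rpow_mul (Real.rpow_nonneg (hc j).le _),
      ← Real.rpow_mul (hc j).le]
    congr 1
    push_cast
    ring

namespace HasLevels

variable {q : ℝ} {Y : ℕ → Ω → ℝ} {c v : ℕ → ℝ} {𝕜 : Type*} [RCLike 𝕜]

theorem c_rpow (L : HasLevels P q Y c v) (j : ℕ) : c j ^ (2 - q) = (v j ^ 2)⁻¹ := by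
  rw [L.v_sq, ← Real.rpow_neg (L.c_pos j).le, neg_sub]

section Scaled

variable (L : HasLevels P q Y c v) (a : ℕ → 𝕜)
include L

theorem measurable_smul (j : ℕ) : Measurable fun ω => a j * ((Y j ω : ℝ) : 𝕜) :=
  (RCLike.measurable_ofReal.comp (L.measurable j)).const_mul _

theorem indep_smul : iIndepFun (fun j ω => a j * ((Y j ω : ℝ) : 𝕜)) P :=
  L.indep.comp (fun j y => a j * ((y : ℝ) : 𝕜))
    fun _ => RCLike.measurable_ofReal.const_mul _

theorem memLp_top_smul (j : ℕ) : MemLp (fun ω => a j * ((Y j ω : ℝ) : 𝕜)) ∞ P :=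
  (L.memLp_top j).ofReal.const_mul _

theorem symm_smul (j : ℕ) : P.map (fun ω => a j * ((Y j ω : ℝ) : 𝕜)) =
    P.map (fun ω => -(a j * ((Y j ω : ℝ) : 𝕜))) := by
  have hm : Measurable fun y : ℝ => a j * (y : 𝕜) := RCLike.measurable_ofReal.const_mul _
  have h1 := Measure.map_map (μ := P) hm (L.measurable j)
  have h2 := Measure.map_map (μ := P) hm (L.measurable j).neg
  rw [L.symm j] at h1
  refine h1.symm.trans (h2.trans ?_)
  congr 1
  ext ω
  simp

theorem integral_norm_smul_rpow {t : ℝ} (ht : 0 < t) (j : ℕ) :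
    ∫ ω, ‖a j * ((Y j ω : ℝ) : 𝕜)‖ ^ t ∂P = ‖a j‖ ^ t * c j ^ (t - q) := by
  rw [← L.moment j ht, ← integral_const_mul]
  refine integral_congr_ae (Eventually.of_forall fun ω => ?_)
  simp only [norm_mul, RCLike.norm_ofReal]
  rw [Real.mul_rpow (norm_nonneg _) (abs_nonneg _)]

theorem memLp_sum_top (s : Finset ℕ) :
    MemLp (fun ω => ∑ j ∈ s, a j * ((Y j ω : ℝ) : 𝕜)) ∞ P :=
  memLp_finsetSum s fun j _ => L.memLp_top_smul a j

variable [IsProbabilityMeasure P]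

theorem memLp_sum (s : Finset ℕ) (r : ℝ≥0∞) :
    MemLp (fun ω => ∑ j ∈ s, a j * ((Y j ω : ℝ) : 𝕜)) r P :=
  (L.memLp_sum_top a s).mono_exponent le_top

theorem toReal_eLpNorm_sum (s : Finset ℕ) {t : ℝ} (ht : 0 < t) :
    (eLpNorm (fun ω => ∑ j ∈ s, a j * ((Y j ω : ℝ) : 𝕜)) (ENNReal.ofReal t) P).toReal =
      (∫ ω, ‖∑ j ∈ s, a j * ((Y j ω : ℝ) : 𝕜)‖ ^ t ∂P) ^ t⁻¹ := by
  rw [MemLp.eLpNorm_eq_integral_rpow_norm (by simpa using ht) ENNReal.ofReal_ne_top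
    (L.memLp_sum a s _), ENNReal.toReal_ofReal ht.le, ENNReal.toReal_ofReal]
  exact Real.rpow_nonneg (integral_nonneg fun ω => by positivity) _

theorem toReal_eLpNorm_sum_le (s : Finset ℕ) {t : ℝ} (ht : 0 < t) (ht2 : t ≤ 2) :
    (eLpNorm (fun ω => ∑ j ∈ s, a j * ((Y j ω : ℝ) : 𝕜)) (ENNReal.ofReal t) P).toReal ≤
      (∑ j ∈ s, ‖a j‖ ^ t * c j ^ (t - q)) ^ t⁻¹ := by
  rw [L.toReal_eLpNorm_sum a s ht]
  refine Real.rpow_le_rpow (integral_nonneg fun ω => by positivity) ?_ (by positivity)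
  refine (integral_norm_sum_rpow_le ht ht2 (L.indep_smul a) (L.measurable_smul a)
    (L.memLp_top_smul a) (L.symm_smul a) s).trans_eq ?_
  exact Finset.sum_congr rfl fun j _ => L.integral_norm_smul_rpow a ht j

theorem toReal_eLpNorm_sum_le_lq (hq1 : 1 < q) (hq2 : q < 2) (s : Finset ℕ) :
    (eLpNorm (fun ω => ∑ j ∈ s, a j * ((Y j ω : ℝ) : 𝕜)) (ENNReal.ofReal q) P).toReal ≤
      (∑ j ∈ s, ‖a j‖ ^ q) ^ q⁻¹ := by
  simpa using L.toReal_eLpNorm_sum_le a s (show 0 < q by linarith) hq2.le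

theorem toReal_eLpNorm_sum_le_l2 (hq2 : q < 2) (s : Finset ℕ) :
    (eLpNorm (fun ω => ∑ j ∈ s, a j * ((Y j ω : ℝ) : 𝕜)) (ENNReal.ofReal q) P).toReal ≤
      (∑ j ∈ s, ‖a j‖ ^ 2 * c j ^ (2 - q)) ^ (2⁻¹ : ℝ) := by
  refine le_trans ?_ ((L.toReal_eLpNorm_sum_le a s two_pos le_rfl).trans_eq (by
    simp only [Real.rpow_two]))
  exact ENNReal.toReal_mono (L.memLp_sum a s _).eLpNorm_ne_top
    (eLpNorm_le_eLpNorm_of_exponent_le (ENNReal.ofReal_le_ofReal hq2.le)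
      (L.memLp_sum a s 0).aestronglyMeasurable)

end Scaled

theorem integral_mul_eq (L : HasLevels P q Y c v) (i j : ℕ) :
    ∫ ω, Y i ω * Y j ω ∂P = if i = j then (v j ^ 2)⁻¹ else 0 := by
  split_ifs with h
  · subst h
    rw [← L.c_rpow, ← L.moment i two_pos]
    refine integral_congr_ae (Eventually.of_forall fun ω => ?_)
    simp only [Real.rpow_two]
    rw [sq_abs, pow_two]
  · rw [(L.indep.indepFun h).integral_fun_mul_eq_mul_integral
      (L.measurable i).aestronglyMeasurable (L.measurable j).aestronglyMeasurable]
    have h0 : ∫ ω, Y i ω ∂P = 0 := by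
      have e1 := integral_map (L.measurable i).aemeasurable
        (measurable_id.aestronglyMeasurable (μ := P.map (Y i)))
      have e2 := integral_map (L.measurable i).neg.aemeasurable
        (measurable_id.aestronglyMeasurable (μ := P.map (-Y i)))
      have e3 : P.map (Y i) = P.map (-Y i) := L.symm i
      rw [← e3, e1] at e2
      simp only [id, Pi.neg_apply] at e2
      rw [integral_neg] at e2
      linarith
    rw [h0, zero_mul]

/-- The constant in the duality estimate `norm_sum_mul_le`. -/
def dualityConst (p : ℝ) : ℝ := (2 ^ p * (2 * rosenthalConst p)) ^ p⁻¹

theorem dualityConst_pos (p : ℝ) : 0 < dualityConst p := by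
  have := one_le_rosenthalConst p
  unfold dualityConst
  positivity

variable [IsProbabilityMeasure P] {p : ℝ}

/-- Rosenthal's inequality for the system `v_j² Y_j`, which is biorthogonal to `Y`. -/
theorem integral_norm_biorthogonal_rpow_le (hpq : p.HolderConjugate q) (hp : 2 < p)
    (L : HasLevels P q Y c v) (a : ℕ → 𝕜) (s : Finset ℕ) (ha : ∑ j ∈ s, ‖a j‖ ^ p ≤ 1)
    (hav : ∑ j ∈ s, ‖a j‖ ^ 2 * v j ^ 2 ≤ 1) :
    ∫ ω, ‖∑ j ∈ s, (a j * ((v j ^ 2 : ℝ) : 𝕜)) * ((Y j ω : ℝ) : 𝕜)‖ ^ p ∂P ≤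
      2 ^ p * (2 * rosenthalConst p) := by
  have hp0 : 0 < p := by linarith
  -- the real case
  have hreal : ∀ b : ℕ → ℝ, (∀ j, |b j| ≤ ‖a j‖) →
      ∫ ω, |∑ j ∈ s, (b j * v j ^ 2) * Y j ω| ^ p ∂P ≤ rosenthalConst p := by
    intro b hb
    have hm : ∀ j {t : ℝ}, 0 < t → ∫ ω, |(b j * v j ^ 2) * Y j ω| ^ t ∂P =
        |b j * v j ^ 2| ^ t * c j ^ (t - q) := fun j t ht =>
      L.integral_norm_smul_rpow (𝕜 := ℝ) (fun j => b j * v j ^ 2) ht j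
    refine integral_abs_sum_rpow_le hp (L.indep_smul (𝕜 := ℝ) (fun j => b j * v j ^ 2))
      (L.measurable_smul (𝕜 := ℝ) _) (L.memLp_top_smul (𝕜 := ℝ) _) (L.symm_smul (𝕜 := ℝ) _)
      s ?_ ?_
    · refine le_trans (Finset.sum_le_sum fun j _ => ?_) ha
      refine (hm j hp0).trans_le ?_
      rw [abs_mul, abs_of_nonneg (sq_nonneg (v j)), L.v_sq,
        Real.mul_rpow (abs_nonneg _) (Real.rpow_nonneg (L.c_pos j).le _),
        ← Real.rpow_mul (L.c_pos j).le, mul_assoc, ← Real.rpow_add (L.c_pos j)]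
      have : (q - 2) * p + (p - q) = 0 := by
        have := hpq.symm.sub_one_mul_conj
        linarith
      rw [this, Real.rpow_zero, mul_one]
      exact Real.rpow_le_rpow (abs_nonneg _) (hb j) hp0.le
    · refine le_trans (Finset.sum_le_sum fun j _ => ?_) hav
      have h2 := hm j two_pos
      simp only [Real.rpow_two, sq_abs] at h2
      refine h2.trans_le ?_
      rw [L.c_rpow]
      have hv := (pow_pos (L.v_pos j) 2).ne'
      have : (b j * v j ^ 2) ^ 2 * (v j ^ 2)⁻¹ = b j ^ 2 * v j ^ 2 := by field_simp
      rw [this, ← sq_abs (b j)]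
      gcongr
      exact hb j
  have hre := hreal (fun j => RCLike.re (a j)) fun j => RCLike.abs_re_le_norm _
  have him := hreal (fun j => RCLike.im (a j)) fun j => RCLike.abs_im_le_norm _
  have hint : ∀ b : ℕ → ℝ,
      Integrable (fun ω => |∑ j ∈ s, (b j * v j ^ 2) * Y j ω| ^ p) P := fun b =>
    integrable_norm_rpow_of_memLp_top (L.memLp_sum_top (𝕜 := ℝ) (fun j => b j * v j ^ 2) s) hp0
  calc ∫ ω, ‖∑ j ∈ s, (a j * ((v j ^ 2 : ℝ) : 𝕜)) * ((Y j ω : ℝ) : 𝕜)‖ ^ p ∂P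
      ≤ ∫ ω, 2 ^ p * (|∑ j ∈ s, (RCLike.re (a j) * v j ^ 2) * Y j ω| ^ p +
          |∑ j ∈ s, (RCLike.im (a j) * v j ^ 2) * Y j ω| ^ p) ∂P := by
        refine integral_mono (integrable_norm_rpow_of_memLp_top (L.memLp_sum_top _ s) hp0)
          (((hint _).add (hint _)).const_mul _) fun ω => ?_
        set z := ∑ j ∈ s, (a j * ((v j ^ 2 : ℝ) : 𝕜)) * ((Y j ω : ℝ) : 𝕜) with hz
        have h1 : RCLike.re z = ∑ j ∈ s, (RCLike.re (a j) * v j ^ 2) * Y j ω := by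
          rw [hz, map_sum]
          refine Finset.sum_congr rfl fun j _ => ?_
          rw [RCLike.re_mul_ofReal, RCLike.re_mul_ofReal]
        have h2 : RCLike.im z = ∑ j ∈ s, (RCLike.im (a j) * v j ^ 2) * Y j ω := by
          rw [hz, map_sum]
          refine Finset.sum_congr rfl fun j _ => ?_
          rw [RCLike.im_mul_ofReal, RCLike.im_mul_ofReal]
        simp only
        rw [← h1, ← h2]
        have h3 : ‖z‖ ≤ |RCLike.re z| + |RCLike.im z| := by
          conv_lhs => rw [← RCLike.re_add_im z]
          refine (norm_add_le _ _).trans ?_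
          rw [norm_mul, RCLike.norm_ofReal, RCLike.norm_ofReal]
          have hI : ‖(RCLike.I : 𝕜)‖ ≤ 1 := by
            rw [RCLike.norm_I]; split_ifs <;> simp
          have := mul_le_mul_of_nonneg_left hI (abs_nonneg (RCLike.im z))
          linarith
        rcases le_total |RCLike.re z| |RCLike.im z| with h | h
        · calc ‖z‖ ^ p ≤ (2 * |RCLike.im z|) ^ p :=
                Real.rpow_le_rpow (norm_nonneg _) (by linarith) hp0.le
            _ = 2 ^ p * |RCLike.im z| ^ p := Real.mul_rpow (by norm_num) (abs_nonneg _)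
            _ ≤ _ := by
              have : 0 ≤ |RCLike.re z| ^ p := by positivity
              gcongr; linarith
        · calc ‖z‖ ^ p ≤ (2 * |RCLike.re z|) ^ p :=
                Real.rpow_le_rpow (norm_nonneg _) (by linarith) hp0.le
            _ = 2 ^ p * |RCLike.re z| ^ p := Real.mul_rpow (by norm_num) (abs_nonneg _)
            _ ≤ _ := by
              have : 0 ≤ |RCLike.im z| ^ p := by positivity
              gcongr; linarith
    _ = 2 ^ p * (∫ ω, |∑ j ∈ s, (RCLike.re (a j) * v j ^ 2) * Y j ω| ^ p ∂P +
          ∫ ω, |∑ j ∈ s, (RCLike.im (a j) * v j ^ 2) * Y j ω| ^ p ∂P) := by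
        rw [integral_const_mul, integral_add (hint _) (hint _)]
    _ ≤ _ := by gcongr; linarith

/-- The norm of `∑ x_j Y_j` in `L_q` dominates, up to a constant, the pairings of `x` with the unit
ball of `𝔛_{p,v}`. -/
theorem norm_sum_mul_le (hpq : p.HolderConjugate q) (hp : 2 < p) (L : HasLevels P q Y c v)
    (x a : ℕ → 𝕜) (s : Finset ℕ) (ha : ∑ j ∈ s, ‖a j‖ ^ p ≤ 1)
    (hav : ∑ j ∈ s, ‖a j‖ ^ 2 * v j ^ 2 ≤ 1) :
    ‖∑ j ∈ s, x j * a j‖ ≤ dualityConst p *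
      (eLpNorm (fun ω => ∑ j ∈ s, x j * ((Y j ω : ℝ) : 𝕜)) (ENNReal.ofReal q) P).toReal := by
  set S : Ω → 𝕜 := fun ω => ∑ j ∈ s, x j * ((Y j ω : ℝ) : 𝕜) with hS
  set Z : Ω → 𝕜 := fun ω => ∑ j ∈ s, (a j * ((v j ^ 2 : ℝ) : 𝕜)) * ((Y j ω : ℝ) : 𝕜) with hZ
  have hint : ∫ ω, S ω * Z ω ∂P = ∑ j ∈ s, x j * a j := by
    have hterm : ∀ i j, Integrable (fun ω => (x i * ((Y i ω : ℝ) : 𝕜)) *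
        ((a j * ((v j ^ 2 : ℝ) : 𝕜)) * ((Y j ω : ℝ) : 𝕜))) P := fun i j =>
      MemLp.integrable_mul (p := 2) (q := 2) ((L.memLp_top_smul x i).mono_exponent le_top)
        ((L.memLp_top_smul (fun j => a j * ((v j ^ 2 : ℝ) : 𝕜)) j).mono_exponent le_top)
    simp only [hS, hZ, Finset.sum_mul_sum]
    rw [integral_finsetSum s fun i _ => integrable_finsetSum s fun j _ => hterm i j]
    refine Finset.sum_congr rfl fun i hi => ?_
    rw [integral_finsetSum s fun j _ => hterm i j, Finset.sum_eq_single i]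
    · have hvi : ((v i ^ 2 : ℝ) : 𝕜) ≠ 0 := by exact_mod_cast (pow_pos (L.v_pos i) 2).ne'
      have : ∀ ω, (x i * ((Y i ω : ℝ) : 𝕜)) * ((a i * ((v i ^ 2 : ℝ) : 𝕜)) * ((Y i ω : ℝ) : 𝕜)) =
          (x i * a i * ((v i ^ 2 : ℝ) : 𝕜)) * ((Y i ω * Y i ω : ℝ) : 𝕜) := fun ω => by
        push_cast; ring
      simp only [this]
      rw [integral_const_mul, integral_ofReal, L.integral_mul_eq, if_pos rfl, RCLike.ofReal_inv,
        mul_assoc, mul_inv_cancel₀ hvi, mul_one]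
    · intro j _ hj
      have : ∀ ω, (x i * ((Y i ω : ℝ) : 𝕜)) * ((a j * ((v j ^ 2 : ℝ) : 𝕜)) * ((Y j ω : ℝ) : 𝕜)) =
          (x i * a j * ((v j ^ 2 : ℝ) : 𝕜)) * ((Y i ω * Y j ω : ℝ) : 𝕜) := fun ω => by
        push_cast; ring
      simp only [this]
      rw [integral_const_mul, integral_ofReal, L.integral_mul_eq, if_neg hj.symm,
        RCLike.ofReal_zero, mul_zero]
    · exact fun h => absurd hi h
  have hp0 : 0 < p := by linarith
  rw [← hint, L.toReal_eLpNorm_sum x s hpq.symm.pos]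
  have hZp := L.integral_norm_biorthogonal_rpow_le hpq hp a s ha hav
  have hH := integral_mul_norm_le_Lp_mul_Lq hpq.symm (L.memLp_sum x s (ENNReal.ofReal q))
    (L.memLp_sum (fun j => a j * ((v j ^ 2 : ℝ) : 𝕜)) s (ENNReal.ofReal p))
  calc ‖∫ ω, S ω * Z ω ∂P‖ ≤ ∫ ω, ‖S ω‖ * ‖Z ω‖ ∂P := by
        refine (norm_integral_le_integral_norm _).trans_eq ?_
        simp only [norm_mul]
    _ ≤ (∫ ω, ‖S ω‖ ^ q ∂P) ^ (1 / q) * (∫ ω, ‖Z ω‖ ^ p ∂P) ^ (1 / p) := hH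
    _ ≤ (∫ ω, ‖S ω‖ ^ q ∂P) ^ (1 / q) * dualityConst p := by
        refine mul_le_mul_of_nonneg_left ?_
          (Real.rpow_nonneg (integral_nonneg fun ω => by positivity) _)
        rw [one_div]
        exact Real.rpow_le_rpow (integral_nonneg fun ω => by positivity) hZp (by positivity)
    _ = _ := by rw [one_div, mul_comm]

variable [Fact (1 ≤ ENNReal.ofReal p)]

/-- The map `h_j ↦ Y_j` from `𝔛_{q,v}` to `L_q` is bounded below. -/
theorem norm_sum_smul_dualUnitVector_le (hpq : p.HolderConjugate q) (hp : 2 < p)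
    (L : HasLevels P q Y c v) (x : ℕ → 𝕜) (s : Finset ℕ) :
    ‖∑ j ∈ s, x j • dualUnitVector 𝕜 (ENNReal.ofReal p) v j‖ ≤ dualityConst p *
      (eLpNorm (fun ω => ∑ j ∈ s, x j * ((Y j ω : ℝ) : 𝕜)) (ENNReal.ofReal q) P).toReal := by
  have hp0 : 0 < p := by linarith
  have hpt : (ENNReal.ofReal p).toReal = p := ENNReal.toReal_ofReal hp0.le
  refine ContinuousLinearMap.opNorm_le_of_unit_norm
    (mul_nonneg (dualityConst_pos p).le ENNReal.toReal_nonneg) fun a ha => ?_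
  simp only [sum_apply, smul_apply, smul_eq_mul, dualUnitVector_apply]
  refine L.norm_sum_mul_le hpq hp x (fun j => RosenthalX.fstL 𝕜 _ v a j) s ?_ ?_
  · have h1 := lp.sum_rpow_le_norm_rpow (by rwa [hpt]) (RosenthalX.fstL 𝕜 (ENNReal.ofReal p) v a) s
    rw [hpt] at h1
    exact h1.trans (Real.rpow_le_one (norm_nonneg _) (ha ▸ a.norm_fstL_apply_le) hp0.le)
  · have h1 := lp.sum_rpow_le_norm_rpow (by norm_num)
      (RosenthalX.sndL 𝕜 (ENNReal.ofReal p) v a) s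
    simp only [ENNReal.toReal_ofNat, Real.rpow_two] at h1
    have h2 := a.norm_sndL_apply_le
    rw [ha] at h2
    refine le_trans (le_of_eq ?_) (h1.trans (pow_le_one₀ (norm_nonneg _) h2))
    refine Finset.sum_congr rfl fun j _ => ?_
    rw [RosenthalX.sndL_apply, norm_mul, RCLike.norm_ofReal, abs_of_pos (L.v_pos j)]
    ring

/-- The map `h_j ↦ Y_j` from `𝔛_{q,v}` to `L_q` is bounded: a functional splits into a part in `ℓ_q`
and a part in a weighted `ℓ_2`, and on each of these parts the sum of the `x_j Y_j` is controlled by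
the type inequality with exponent `q`, respectively `2`. -/
theorem toReal_eLpNorm_sum_le_norm (hpq : p.HolderConjugate q) (hq1 : 1 < q) (hq2 : q < 2)
    (L : HasLevels P q Y c v) (x : ℕ → 𝕜) (s : Finset ℕ) :
    (eLpNorm (fun ω => ∑ j ∈ s, x j * ((Y j ω : ℝ) : 𝕜)) (ENNReal.ofReal q) P).toReal ≤
      2 * ‖∑ j ∈ s, x j • dualUnitVector 𝕜 (ENNReal.ofReal p) v j‖ := by
  set f := ∑ j ∈ s, x j • dualUnitVector 𝕜 (ENNReal.ofReal p) v j with hf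
  obtain ⟨F, hF1, hF2, hF⟩ := RosenthalX.exists_dualSum_eq f
  have hpt : (ENNReal.ofReal p).toReal = p := ENNReal.toReal_ofReal hpq.nonneg
  have hqt : (ENNReal.ofReal q).toReal = q := ENNReal.toReal_ofReal (by linarith)
  set y : ℕ → 𝕜 := fun j => F.1 (lp.single _ j 1) with hy
  set z : ℕ → 𝕜 := fun j => (v j : 𝕜) * F.2 (lp.single _ j 1) with hz
  have hx : ∀ j ∈ s, x j = y j + z j := by
    intro j hj
    have h1 : f (RosenthalX.unitVector 𝕜 (ENNReal.ofReal p) v j) = x j := by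
      simp only [hf, sum_apply, smul_apply, smul_eq_mul, dualUnitVector_unitVector]
      rw [Finset.sum_eq_single j]
      · rw [Pi.single_eq_same, mul_one]
      · intro i _ hi
        rw [Pi.single_eq_of_ne hi, mul_zero]
      · exact fun h => absurd hj h
    rw [← h1, ← hF, RosenthalX.dualSum_apply, RosenthalX.fstL_unitVector,
      RosenthalX.sndL_unitVector, map_smul, smul_eq_mul]
  have hsum : (fun ω => ∑ j ∈ s, x j * ((Y j ω : ℝ) : 𝕜)) =
      (fun ω => ∑ j ∈ s, y j * ((Y j ω : ℝ) : 𝕜)) + fun ω => ∑ j ∈ s, z j * ((Y j ω : ℝ) : 𝕜) := by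
    ext ω
    rw [Pi.add_apply, ← Finset.sum_add_distrib]
    exact Finset.sum_congr rfl fun j hj => by rw [hx j hj, add_mul]
  have hq1' : 1 ≤ ENNReal.ofReal q := by
    rw [← ENNReal.ofReal_one]; exact ENNReal.ofReal_le_ofReal hq1.le
  have hle := eLpNorm_add_le (L.memLp_sum y s 0).aestronglyMeasurable
    (L.memLp_sum z s 0).aestronglyMeasurable hq1'
  rw [← hsum] at hle
  have hle' := ENNReal.toReal_mono (ENNReal.add_ne_top.2
    ⟨(L.memLp_sum y s _).eLpNorm_ne_top, (L.memLp_sum z s _).eLpNorm_ne_top⟩) hle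
  rw [ENNReal.toReal_add (L.memLp_sum y s _).eLpNorm_ne_top
    (L.memLp_sum z s _).eLpNorm_ne_top] at hle'
  refine hle'.trans ?_
  rw [two_mul]
  refine add_le_add (le_trans ?_ hF1) (le_trans ?_ hF2)
  · refine (L.toReal_eLpNorm_sum_le_lq y hq1 hq2 s).trans ?_
    have h1 := sum_norm_rpow_coeff_le (p := ENNReal.ofReal p) (q := ENNReal.ofReal q)
      (by rwa [hpt, hqt]) F.1 s
    rw [hqt] at h1
    calc _ ≤ (‖F.1‖ ^ q) ^ q⁻¹ := Real.rpow_le_rpow (by positivity) h1 (by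
          rw [inv_nonneg]; linarith)
      _ = ‖F.1‖ := Real.rpow_rpow_inv (norm_nonneg _) (by linarith)
  · refine (L.toReal_eLpNorm_sum_le_l2 z hq2 s).trans ?_
    have h1 := sum_norm_rpow_coeff_le (p := 2) (q := 2)
      (by simpa using Real.HolderConjugate.two_two) F.2 s
    simp only [ENNReal.toReal_ofNat, Real.rpow_two] at h1
    have h2 : ∑ j ∈ s, ‖z j‖ ^ 2 * c j ^ (2 - q) = ∑ j ∈ s, ‖F.2 (lp.single 2 j 1)‖ ^ 2 := by
      refine Finset.sum_congr rfl fun j _ => ?_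
      have := (L.v_pos j).ne'
      rw [hz]
      simp only [norm_mul, RCLike.norm_ofReal]
      rw [abs_of_pos (L.v_pos j), L.c_rpow]
      field_simp
    rw [h2]
    calc _ ≤ (‖F.2‖ ^ 2) ^ (2⁻¹ : ℝ) := Real.rpow_le_rpow (by positivity) h1 (by norm_num)
      _ = ‖F.2‖ := by
        rw [← Real.rpow_two, Real.rpow_rpow_inv (norm_nonneg _) two_ne_zero]

end HasLevels

end ThreeValued

/-! ### Subspaces far from Euclidean spaces -/

section Far

variable {𝕜 : Type*} [RCLike 𝕜]

/-- In a Hilbert space some choice of signs makes the square of the norm of a sum at most the sum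
of the squares of the norms. -/
theorem exists_signs_norm_sum_sq_le {H : Type*} [NormedAddCommGroup H] [InnerProductSpace 𝕜 H]
    {ι : Type*} (y : ι → H) (s : Finset ι) :
    ∃ ε : ι → 𝕜, (∀ i, ε i = 1 ∨ ε i = -1) ∧ ‖∑ i ∈ s, ε i • y i‖ ^ 2 ≤ ∑ i ∈ s, ‖y i‖ ^ 2 := by
  classical
  induction s using Finset.induction_on with
  | empty => exact ⟨fun _ => 1, fun _ => Or.inl rfl, by simp⟩
  | insert k s hk ih =>
    obtain ⟨ε, hε, hle⟩ := ih
    set z := ∑ i ∈ s, ε i • y i with hz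
    have hpar := parallelogram_law_with_norm 𝕜 z (y k)
    have hupd : ∀ t : 𝕜, ∑ i ∈ insert k s, Function.update ε k t i • y i = z + t • y k := by
      intro t
      rw [Finset.sum_insert hk, Function.update_self, add_comm, hz]
      congr 1
      refine Finset.sum_congr rfl fun i hi => ?_
      rw [Function.update_of_ne (by rintro rfl; exact hk hi)]
    have hsgn : ∀ t : 𝕜, (t = 1 ∨ t = -1) →
        ∀ i, Function.update ε k t i = 1 ∨ Function.update ε k t i = -1 := by
      intro t ht i
      rcases eq_or_ne i k with rfl | hi
      · rwa [Function.update_self]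
      · rw [Function.update_of_ne hi]; exact hε i
    rw [Finset.sum_insert hk]
    rcases le_total (‖z + y k‖ ^ 2) (‖z - y k‖ ^ 2) with h | h
    · refine ⟨Function.update ε k 1, hsgn 1 (Or.inl rfl), ?_⟩
      rw [hupd, one_smul]
      linarith
    · refine ⟨Function.update ε k (-1), hsgn (-1) (Or.inr rfl), ?_⟩
      rw [hupd, neg_smul, one_smul, ← sub_eq_add_neg]
      linarith

/-- A space containing vectors `e l` whose signed sums are all large is far from Euclidean. -/
theorem le_euclideanDist_of_signs {E : Type*} [NormedAddCommGroup E] [NormedSpace 𝕜 E] {N : ℕ}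
    (hN : 0 < N) (e : Fin N → E) {A β : ℝ} (hβ0 : 0 < β) (hβ : ∀ l, ‖e l‖ ≤ β)
    (hA : ∀ ε : Fin N → 𝕜, (∀ l, ε l = 1 ∨ ε l = -1) → A ≤ ‖∑ l, ε l • e l‖) :
    ENNReal.ofReal (A / (β * (N : ℝ) ^ (1 / 2 : ℝ))) ≤ euclideanDist 𝕜 E := by
  unfold euclideanDist
  refine le_sInf ?_
  rintro _ ⟨φ, rfl⟩
  have hN' : (0 : ℝ) < N := by exact_mod_cast hN
  rw [← ofReal_norm, ← ofReal_norm, ← ENNReal.ofReal_mul (norm_nonneg _)]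
  refine ENNReal.ofReal_le_ofReal ?_
  let F : E →L[𝕜] EuclideanSpace 𝕜 (Fin (Module.finrank 𝕜 E)) := ↑φ
  change A / _ ≤ ‖F‖ * ‖(φ.symm : EuclideanSpace 𝕜 (Fin (Module.finrank 𝕜 E)) →L[𝕜] E)‖
  set G : EuclideanSpace 𝕜 (Fin (Module.finrank 𝕜 E)) →L[𝕜] E :=
    (φ.symm : EuclideanSpace 𝕜 (Fin (Module.finrank 𝕜 E)) →L[𝕜] E)
  obtain ⟨ε, hε, hle⟩ := exists_signs_norm_sum_sq_le (𝕜 := 𝕜) (fun l => F (e l)) Finset.univ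
  have h1 : ∑ l, ‖F (e l)‖ ^ 2 ≤ N * (‖F‖ * β) ^ 2 := by
    calc ∑ l, ‖F (e l)‖ ^ 2 ≤ ∑ _l : Fin N, (‖F‖ * β) ^ 2 := by
          refine Finset.sum_le_sum fun l _ => ?_
          gcongr
          exact (F.le_opNorm _).trans (mul_le_mul_of_nonneg_left (hβ l) (norm_nonneg _))
      _ = _ := by rw [Finset.sum_const, Finset.card_univ, Fintype.card_fin, nsmul_eq_mul]
  have hsq : ((N : ℝ) ^ (1 / 2 : ℝ)) ^ 2 = N := by
    rw [← Real.rpow_natCast, ← Real.rpow_mul hN'.le]; norm_num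
  have h2 : ‖F (∑ l, ε l • e l)‖ ≤ ‖F‖ * β * (N : ℝ) ^ (1 / 2 : ℝ) := by
    refine le_of_sq_le_sq ?_ (by positivity)
    rw [map_sum]
    simp only [map_smul]
    refine (hle.trans h1).trans_eq ?_
    rw [mul_pow (‖F‖ * β), hsq]
    ring
  have h3 : ‖∑ l, ε l • e l‖ ≤ ‖G‖ * ‖F (∑ l, ε l • e l)‖ := by
    have : G (F (∑ l, ε l • e l)) = ∑ l, ε l • e l := φ.symm_apply_apply _
    conv_lhs => rw [← this]
    exact G.le_opNorm _
  rw [div_le_iff₀ (by positivity)]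
  calc A ≤ ‖∑ l, ε l • e l‖ := hA ε hε
    _ ≤ ‖G‖ * (‖F‖ * β * (N : ℝ) ^ (1 / 2 : ℝ)) :=
      h3.trans (mul_le_mul_of_nonneg_left h2 (norm_nonneg _))
    _ = _ := by ring

/-- A combination of block sums as a single sum; the blocks need not be disjoint. -/
theorem sum_blockCoeff_smul {M : Type*} [AddCommGroup M] [Module 𝕜 M] {N : ℕ}
    (σ : Fin N → Finset ℕ) (a : ℕ → 𝕜) (c : Fin N → 𝕜) (g : ℕ → M) :
    ∑ j ∈ Finset.univ.biUnion σ, (∑ l, if j ∈ σ l then c l * a j else 0) • g j =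
      ∑ l, c l • ∑ j ∈ σ l, a j • g j := by
  simp only [Finset.sum_smul, ite_smul, zero_smul, mul_smul]
  rw [Finset.sum_comm]
  refine Finset.sum_congr rfl fun l _ => ?_
  rw [← Finset.sum_filter, Finset.smul_sum]
  refine Finset.sum_congr ?_ fun _ _ => rfl
  ext j
  simp only [Finset.mem_filter, Finset.mem_biUnion, Finset.mem_univ, true_and]
  exact ⟨fun h => h.2, fun h => ⟨⟨l, h⟩, h⟩⟩

theorem two_lt_of_holderConjugate {p q : ℝ} (hpq : p.HolderConjugate q) (hq2 : q < 2) : 2 < p := by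
  have h1 := hpq.symm.sub_one_mul_conj
  by_contra! h
  nlinarith [hpq.pos, hpq.symm.pos, hpq.symm.lt]

/-- The spans of the block vectors are uniformly preserved by `Δ^*` and far from Euclidean. -/
theorem preservesFarFromEuclidean_comp_DeltaAdj {p q : ℝ} (hpq : p.HolderConjugate q)
    (hq1 : 1 < q) (hq2 : q < 2) [Fact (1 ≤ ENNReal.ofReal p)] {δ r : ℕ → ℝ} {n : ℕ → ℕ}
    (hr_gt : ∀ i, q < r i)
    (hn : Tendsto (fun i => (n i : ℝ) ^ (1 / r i - 1 / 2)) atTop atTop)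
    {W : WeightPair} (hW : IsBlockWeightChoice 𝕜 q δ r n W)
    {X : Type*} [NormedAddCommGroup X] [NormedSpace 𝕜 X]
    (S : RosenthalXDual 𝕜 (ENNReal.ofReal p) W.w ≃L[𝕜] X) :
    PreservesFarFromEuclidean ((S : RosenthalXDual 𝕜 (ENNReal.ofReal p) W.w →L[𝕜] X).comp
      (W.DeltaAdj 𝕜 (ENNReal.ofReal p))) := by
  obtain ⟨Ω, _, P, _, Y, Z, σ, a, C, hY, hZ, hv, hw, -, hσ, hC, hequiv⟩ := hW
  obtain ⟨cY, LY⟩ := hY.exists_hasLevels hq1 hv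
  obtain ⟨cZ, LZ⟩ := hZ.exists_hasLevels hq1 hw
  have hp : 2 < p := two_lt_of_holderConjugate hpq hq2
  set K := HasLevels.dualityConst p with hK
  have hK0 : 0 < K := HasLevels.dualityConst_pos p
  set hh := dualUnitVector 𝕜 (ENNReal.ofReal p) W.v
  set hw' := dualUnitVector 𝕜 (ENNReal.ofReal p) W.w
  let e : ∀ i, Fin (n i) → RosenthalXDual 𝕜 (ENNReal.ofReal p) W.v := fun i l =>
    ∑ j ∈ σ ⟨i, l⟩, a j • hh j
  let nr : ∀ i, (Fin (n i) → 𝕜) → ℝ := fun i c => (∑ l, ‖c l‖ ^ r i) ^ (1 / r i)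
  -- the block vectors are equivalent to the basis of `ℓ_r`, and so are their images
  have hfun : ∀ (y : ℕ → Ω → ℝ) (b : ℕ → 𝕜) (i : ℕ) (c : Fin (n i) → 𝕜),
      (fun ω => ∑ l, c l * ∑ j ∈ σ ⟨i, l⟩, b j * ((y j ω : ℝ) : 𝕜)) =
      fun ω => ∑ j ∈ Finset.univ.biUnion fun l => σ ⟨i, l⟩,
        (∑ l, if j ∈ σ ⟨i, l⟩ then c l * b j else 0) * ((y j ω : ℝ) : 𝕜) := fun y b i c => by
    ext ω
    exact (sum_blockCoeff_smul (fun l => σ ⟨i, l⟩) b c fun j => ((y j ω : ℝ) : 𝕜)).symm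
  have hup : ∀ i (c : Fin (n i) → 𝕜), ‖∑ l, c l • e i l‖ ≤ K * C * nr i c := by
    intro i c
    have h1 := LY.norm_sum_smul_dualUnitVector_le hpq hp
      (fun j => ∑ l, if j ∈ σ ⟨i, l⟩ then c l * a j else 0)
      (Finset.univ.biUnion fun l => σ ⟨i, l⟩)
    rw [sum_blockCoeff_smul (fun l => σ ⟨i, l⟩) a c (dualUnitVector 𝕜 (ENNReal.ofReal p) W.v),
      ← hfun Y a i c] at h1
    refine h1.trans ?_
    rw [mul_assoc]
    exact mul_le_mul_of_nonneg_left ((hequiv i).1 c).2 hK0.le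
  have hlow : ∀ i (c : Fin (n i) → 𝕜), C⁻¹ * nr i c ≤ 2 * ‖∑ l, c l • e i l‖ := by
    intro i c
    have h1 := LY.toReal_eLpNorm_sum_le_norm hpq hq1 hq2
      (fun j => ∑ l, if j ∈ σ ⟨i, l⟩ then c l * a j else 0)
      (Finset.univ.biUnion fun l => σ ⟨i, l⟩)
    rw [sum_blockCoeff_smul (fun l => σ ⟨i, l⟩) a c (dualUnitVector 𝕜 (ENNReal.ofReal p) W.v),
      ← hfun Y a i c] at h1
    exact ((hequiv i).1 c).1.trans h1
  have hΔ : ∀ i (c : Fin (n i) → 𝕜),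
      C⁻¹ * nr i c ≤ 2 * ‖W.DeltaAdj 𝕜 _ (∑ l, c l • e i l)‖ := by
    intro i c
    have h1 := LZ.toReal_eLpNorm_sum_le_norm hpq hq1 hq2
      (fun j => ∑ l, if j ∈ σ ⟨i, l⟩ then c l * ((δ i : 𝕜) * a j) else 0)
      (Finset.univ.biUnion fun l => σ ⟨i, l⟩)
    rw [sum_blockCoeff_smul (fun l => σ ⟨i, l⟩) (fun j => (δ i : 𝕜) * a j) c
      (dualUnitVector 𝕜 (ENNReal.ofReal p) W.w),
      ← hfun Z (fun j => (δ i : 𝕜) * a j) i c] at h1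
    refine (((hequiv i).2 c).1.trans h1).trans_eq ?_
    congr 2
    rw [map_sum]
    refine Finset.sum_congr rfl fun l _ => ?_
    rw [map_smul, map_sum]
    congr 1
    refine Finset.sum_congr rfl fun j hj => ?_
    rw [map_smul, W.DeltaAdj_dualUnitVector, smul_smul, hσ ⟨i, l⟩ j hj,
      mul_div_cancel_right₀ _ (W.v_pos j).ne', mul_comm (a j)]
  set s : ℝ := ‖(S.symm : X →L[𝕜] RosenthalXDual 𝕜 (ENNReal.ofReal p) W.w)‖ + 1
  have hs : 0 < s := by positivity
  have hS : ∀ f, ‖f‖ ≤ s * ‖S f‖ := fun f => by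
    have h1 := (S.symm : X →L[𝕜] RosenthalXDual 𝕜 (ENNReal.ofReal p) W.w).le_opNorm (S f)
    have h2 : (S.symm : X →L[𝕜] RosenthalXDual 𝕜 (ENNReal.ofReal p) W.w) (S f) = f :=
      S.symm_apply_apply f
    rw [h2] at h1
    refine h1.trans (mul_le_mul_of_nonneg_right ?_ (norm_nonneg _))
    simp [s]
  refine ⟨(4 * s * K * C * C)⁻¹, by positivity, fun M => ?_⟩
  obtain ⟨i, hi, hni⟩ := ((hn.eventually_gt_atTop (2 * C * K * C * M + 1)).and
    (hn.eventually_gt_atTop 1)).exists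
  have hr0 : 0 < r i := by linarith [hr_gt i]
  have hN : 0 < n i := by
    rcases Nat.eq_zero_or_pos (n i) with h | h
    · rw [h] at hni
      rcases eq_or_ne (1 / r i - 1 / 2) 0 with h0 | h0
      · rw [h0, Real.rpow_zero] at hni; exact absurd hni (lt_irrefl _)
      · rw [Nat.cast_zero, Real.zero_rpow h0] at hni; linarith
    · exact h
  have hN' : (0 : ℝ) < n i := by exact_mod_cast hN
  let E : Submodule 𝕜 (RosenthalXDual 𝕜 (ENNReal.ofReal p) W.v) :=
    Submodule.span 𝕜 (Set.range (e i))
  refine ⟨E, FiniteDimensional.span_of_finite 𝕜 (Set.finite_range _), ?_, fun x hx hx0 => ?_⟩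
  · let e' : Fin (n i) → E := fun l => ⟨e i l, Submodule.subset_span ⟨l, rfl⟩⟩
    have hsum : ∀ c : Fin (n i) → 𝕜, ‖∑ l, c l • e' l‖ = ‖∑ l, c l • e i l‖ := fun c => by
      change ‖((∑ l, c l • e' l : E) : RosenthalXDual 𝕜 (ENNReal.ofReal p) W.v)‖ = _
      congr 1
      simp only [Submodule.coe_sum, Submodule.coe_smul, e']
    have hβ : ∀ l, ‖e' l‖ ≤ K * C := fun l => by
      have h1 := hup i (Pi.single l 1)
      have h2 : ∑ k, (Pi.single l (1 : 𝕜) : Fin (n i) → 𝕜) k • e i k = e i l := by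
        rw [Finset.sum_eq_single l]
        · simp
        · intro k _ hk; rw [Pi.single_eq_of_ne hk]; exact zero_smul 𝕜 (e i k)
        · simp
      have h3 : nr i (Pi.single l 1) = 1 := by
        simp only [nr]
        rw [Finset.sum_eq_single l]
        · simp
        · intro k _ hk; simp [Pi.single_eq_of_ne hk, Real.zero_rpow hr0.ne']
        · simp
      rw [h2, h3, mul_one] at h1
      exact h1
    have hA : ∀ ε : Fin (n i) → 𝕜, (∀ l, ε l = 1 ∨ ε l = -1) →
        C⁻¹ * (n i : ℝ) ^ (1 / r i) / 2 ≤ ‖∑ l, ε l • e' l‖ := by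
      intro ε hε
      rw [hsum]
      have h1 := hlow i ε
      have h2 : nr i ε = (n i : ℝ) ^ (1 / r i) := by
        simp only [nr]
        congr 1
        have : ∀ l, ‖ε l‖ ^ r i = 1 := fun l => by
          rcases hε l with h | h <;> simp [h]
        simp [this]
      rw [h2] at h1
      linarith
    refine lt_of_lt_of_le ?_ (le_euclideanDist_of_signs hN e' (by positivity) hβ hA)
    rw [← ENNReal.ofReal_coe_nnreal, ENNReal.ofReal_lt_ofReal_iff']
    have h4 : C⁻¹ * (n i : ℝ) ^ (1 / r i) / 2 / (K * C * (n i : ℝ) ^ (1 / 2 : ℝ)) =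
        (n i : ℝ) ^ (1 / r i - 1 / 2) / (2 * C * K * C) := by
      rw [Real.rpow_sub hN']
      field_simp
    rw [h4]
    refine ⟨?_, by positivity⟩
    rw [lt_div_iff₀ (by positivity)]
    linarith
  · obtain ⟨c, rfl⟩ := (Submodule.mem_span_range_iff_exists_fun 𝕜).1 hx
    set x := ∑ l, c l • e i l with hxdef
    have hxpos : 0 < ‖x‖ := norm_pos_iff.2 hx0
    have h1 := hup i c
    have h2 := hΔ i c
    have h3 := hS (W.DeltaAdj 𝕜 _ x)
    rw [← hxdef] at h1 h2
    have h5 : ((S : RosenthalXDual 𝕜 (ENNReal.ofReal p) W.w →L[𝕜] X).comp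
      (W.DeltaAdj 𝕜 (ENNReal.ofReal p))) x = S (W.DeltaAdj 𝕜 _ x) := rfl
    rw [h5, inv_mul_lt_iff₀ (by positivity)]
    set t := ‖S (W.DeltaAdj 𝕜 _ x)‖
    have h6 : nr i c ≤ C * (2 * (s * t)) := by
      rw [inv_mul_le_iff₀ hC] at h2
      exact h2.trans (by gcongr)
    have h7 : ‖x‖ ≤ K * C * (C * (2 * (s * t))) := h1.trans (by gcongr)
    nlinarith

end Far

/-! ### Block operators on `ℓ_t` -/

section BlockOperators

variable {𝕜 : Type*} [RCLike 𝕜]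

theorem sum_spread_le {t : ℝ≥0∞} (ht : 0 < t.toReal) (β : ℕ → ℕ) (b : ℕ → ℝ)
    (hb : ∀ i (s : Finset ℕ), (∀ j ∈ s, β j = i) → ∑ j ∈ s, |b j| ^ t.toReal ≤ 1)
    (x : SeqLp 𝕜 t) (s : Finset ℕ) :
    ∑ j ∈ s, ‖(b j : 𝕜) * x (β j)‖ ^ t.toReal ≤ ‖x‖ ^ t.toReal := by
  rw [← Finset.sum_fiberwise_of_maps_to (g := β) (t := s.image β)
    (fun j hj => Finset.mem_image_of_mem β hj)]
  refine (Finset.sum_le_sum fun i _ => ?_).trans (lp.sum_rpow_le_norm_rpow ht x (s.image β))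
  calc ∑ j ∈ s with β j = i, ‖(b j : 𝕜) * x (β j)‖ ^ t.toReal
      = ∑ j ∈ s with β j = i, |b j| ^ t.toReal * ‖x i‖ ^ t.toReal := by
        refine Finset.sum_congr rfl fun j hj => ?_
        rw [(Finset.mem_filter.1 hj).2, norm_mul, RCLike.norm_ofReal,
          Real.mul_rpow (abs_nonneg _) (norm_nonneg _)]
    _ ≤ 1 * ‖x i‖ ^ t.toReal := by
        rw [← Finset.sum_mul]
        exact mul_le_mul_of_nonneg_right (hb i _ fun j hj => (Finset.mem_filter.1 hj).2)
          (by positivity)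
    _ = ‖x i‖ ^ t.toReal := one_mul _

/-- The contraction `x ↦ (b j * x (β j))` of `ℓ_t`, where the restriction of `b` to each fibre of
`β` lies in the unit ball of `ℓ_t`. -/
def lpSpread (t : ℝ≥0∞) [Fact (1 ≤ t)] (ht : 0 < t.toReal) (β : ℕ → ℕ) (b : ℕ → ℝ)
    (hb : ∀ i (s : Finset ℕ), (∀ j ∈ s, β j = i) → ∑ j ∈ s, |b j| ^ t.toReal ≤ 1) :
    SeqLp 𝕜 t →L[𝕜] SeqLp 𝕜 t :=
  LinearMap.mkContinuous
    { toFun := fun x => ⟨fun j => (b j : 𝕜) * x (β j), memℓp_gen' (sum_spread_le ht β b hb x)⟩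
      map_add' := fun x y => by
        ext j
        exact mul_add _ _ _
      map_smul' := fun c x => by
        ext j
        exact mul_left_comm _ _ _ }
    1 (fun x => by
      rw [one_mul]
      exact lp.norm_le_of_forall_sum_le ht (norm_nonneg _) (sum_spread_le ht β b hb x))

theorem sum_average_le {t : ℝ≥0∞} {t' : ℝ} (ht : t.toReal.HolderConjugate t') {β : ℕ → ℕ}
    {A : ℕ → Finset ℕ} (hA : ∀ i, ∀ j ∈ A i, β j = i) (b : ℕ → ℝ)
    (hb : ∀ i, ∑ j ∈ A i, |b j| ^ t' ≤ 1) (x : SeqLp 𝕜 t) (s : Finset ℕ) :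
    ∑ i ∈ s, ‖∑ j ∈ A i, (b j : 𝕜) * x j‖ ^ t.toReal ≤ ‖x‖ ^ t.toReal := by
  have ht0 := ht.pos
  have key : ∀ i, ‖∑ j ∈ A i, (b j : 𝕜) * x j‖ ^ t.toReal ≤ ∑ j ∈ A i, ‖x j‖ ^ t.toReal := by
    intro i
    have h1 : ‖∑ j ∈ A i, (b j : 𝕜) * x j‖ ≤ (∑ j ∈ A i, ‖x j‖ ^ t.toReal) ^ (1 / t.toReal) := by
      calc ‖∑ j ∈ A i, (b j : 𝕜) * x j‖ ≤ ∑ j ∈ A i, |b j| * ‖x j‖ := by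
            refine (norm_sum_le _ _).trans (Finset.sum_le_sum fun j _ => ?_)
            rw [norm_mul, RCLike.norm_ofReal]
        _ ≤ (∑ j ∈ A i, |b j| ^ t') ^ (1 / t') * (∑ j ∈ A i, ‖x j‖ ^ t.toReal) ^ (1 / t.toReal) :=
            Real.inner_le_Lp_mul_Lq_of_nonneg _ ht.symm (fun _ _ => abs_nonneg _)
              (fun _ _ => norm_nonneg _)
        _ ≤ 1 * (∑ j ∈ A i, ‖x j‖ ^ t.toReal) ^ (1 / t.toReal) := by
            refine mul_le_mul_of_nonneg_right (Real.rpow_le_one ?_ (hb i) ?_) (by positivity)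
            · positivity
            · exact (one_div_pos.2 ht.symm.pos).le
        _ = _ := one_mul _
    refine (Real.rpow_le_rpow (norm_nonneg _) h1 ht0.le).trans_eq ?_
    rw [← Real.rpow_mul (by positivity), one_div_mul_cancel ht0.ne', Real.rpow_one]
  refine (Finset.sum_le_sum fun i _ => key i).trans ?_
  rw [← Finset.sum_biUnion]
  · exact lp.sum_rpow_le_norm_rpow ht0 x _
  · intro i _ k _ hik
    exact Finset.disjoint_left.2 fun j hi hk => hik ((hA i j hi).symm.trans (hA k j hk))

/-- The contraction `x ↦ (∑_{j ∈ A i} b j * x j)` of `ℓ_t`, where the `A i` are disjoint and the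
restriction of `b` to each `A i` lies in the unit ball of the dual space. -/
def lpAverage (t : ℝ≥0∞) [Fact (1 ≤ t)] {t' : ℝ} (ht : t.toReal.HolderConjugate t') {β : ℕ → ℕ}
    {A : ℕ → Finset ℕ} (hA : ∀ i, ∀ j ∈ A i, β j = i) (b : ℕ → ℝ)
    (hb : ∀ i, ∑ j ∈ A i, |b j| ^ t' ≤ 1) : SeqLp 𝕜 t →L[𝕜] SeqLp 𝕜 t :=
  LinearMap.mkContinuous
    { toFun := fun x =>
        ⟨fun i => ∑ j ∈ A i, (b j : 𝕜) * x j, memℓp_gen' (sum_average_le ht hA b hb x)⟩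
      map_add' := fun x y => by
        ext i
        change ∑ j ∈ A i, (b j : 𝕜) * (x j + y j) =
          ∑ j ∈ A i, (b j : 𝕜) * x j + ∑ j ∈ A i, (b j : 𝕜) * y j
        simp only [mul_add, Finset.sum_add_distrib]
      map_smul' := fun c x => by
        ext i
        change ∑ j ∈ A i, (b j : 𝕜) * (c * x j) = c * ∑ j ∈ A i, (b j : 𝕜) * x j
        rw [Finset.mul_sum]
        exact Finset.sum_congr rfl fun j _ => mul_left_comm _ _ _ }
    1 (fun x => by
      rw [one_mul]
      exact lp.norm_le_of_forall_sum_le ht.pos (norm_nonneg _) (sum_average_le ht hA b hb x))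

end BlockOperators

/-! ### Rosenthal's isomorphism theorem -/

section Rosenthal

variable (𝕜 : Type*) [RCLike 𝕜] {p : ℝ} [Fact (1 ≤ ENNReal.ofReal p)]

/-- If blocks of coordinates carry numbers `b`, `b'` which define contractions on `ℓ_p` and, after
the change of weights, on `ℓ_2`, and which are biorthogonal up to a factor `κ`, then `𝔛_{p,v}` is
complemented in `𝔛_{p,u}`. -/
theorem exists_rightInverse_of_blocks {q : ℝ} (hpq : p.HolderConjugate q) {u v : ℕ → ℝ}
    (hu : ∀ j, 0 < u j) (hv : ∀ i, 0 < v i) {β : ℕ → ℕ} {A : ℕ → Finset ℕ}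
    (hA : ∀ i, ∀ j ∈ A i, β j = i) {b b' : ℕ → ℝ} {κ : ℝ} (hκ : κ ≠ 0)
    (hb0 : ∀ j, j ∉ A (β j) → b j = 0)
    (hbp : ∀ i, ∑ j ∈ A i, |b j| ^ p ≤ 1)
    (hb2 : ∀ i, ∑ j ∈ A i, |u j * b j / v i| ^ (2 : ℝ) ≤ 1)
    (hbq : ∀ i, ∑ j ∈ A i, |b' j| ^ q ≤ 1)
    (hb2' : ∀ i, ∑ j ∈ A i, |v i * b' j / u j| ^ (2 : ℝ) ≤ 1)
    (hbb : ∀ i, ∑ j ∈ A i, b' j * b j = κ) :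
    ∃ (ι : RosenthalX 𝕜 (ENNReal.ofReal p) v →L[𝕜] RosenthalX 𝕜 (ENNReal.ofReal p) u)
      (R : RosenthalX 𝕜 (ENNReal.ofReal p) u →L[𝕜] RosenthalX 𝕜 (ENNReal.ofReal p) v),
      Function.RightInverse ι R ∧
      (∀ x j, RosenthalX.fstL 𝕜 _ u (ι x) j = (b j : 𝕜) * RosenthalX.fstL 𝕜 _ v x (β j)) ∧
      (∀ x i, RosenthalX.fstL 𝕜 _ v (R x) i =
        (κ⁻¹ : 𝕜) * ∑ j ∈ A i, (b' j : 𝕜) * RosenthalX.fstL 𝕜 _ u x j) := by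
  have htp : (ENNReal.ofReal p).toReal = p := ENNReal.toReal_ofReal hpq.nonneg
  have h2 : (2 : ℝ≥0∞).toReal = 2 := by simp
  have hp0 : 0 < (ENNReal.ofReal p).toReal := by rw [htp]; exact hpq.pos
  have hpq' : (ENNReal.ofReal p).toReal.HolderConjugate q := by rw [htp]; exact hpq
  have h22 : (2 : ℝ≥0∞).toReal.HolderConjugate 2 := by
    rw [h2]; exact Real.HolderConjugate.two_two
  have hfib : ∀ (c : ℕ → ℝ) (t : ℝ), 0 < t → (∀ j, j ∉ A (β j) → c j = 0) →
      (∀ i, ∑ j ∈ A i, |c j| ^ t ≤ 1) →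
      ∀ i (s : Finset ℕ), (∀ j ∈ s, β j = i) → ∑ j ∈ s, |c j| ^ t ≤ 1 := by
    intro c t ht hc0 hc i s hs
    refine le_trans ?_ (hc i)
    rw [← Finset.sum_filter_add_sum_filter_not s (· ∈ A i)]
    have : ∑ j ∈ s with j ∉ A i, |c j| ^ t = 0 := by
      refine Finset.sum_eq_zero fun j hj => ?_
      obtain ⟨h1, h2⟩ := Finset.mem_filter.1 hj
      rw [hc0 j (by rwa [hs j h1]), abs_zero, Real.zero_rpow ht.ne']
    rw [this, add_zero]
    refine Finset.sum_le_sum_of_subset_of_nonneg (fun j hj => (Finset.mem_filter.1 hj).2) ?_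
    intros; positivity
  let E1 : SeqLp 𝕜 (ENNReal.ofReal p) →L[𝕜] SeqLp 𝕜 (ENNReal.ofReal p) :=
    lpSpread _ hp0 β b (by
      rw [htp]; exact hfib b p hpq.pos hb0 hbp)
  let E2 : SeqLp 𝕜 2 →L[𝕜] SeqLp 𝕜 2 :=
    lpSpread 2 (by simp) β (fun j => u j * b j / v (β j)) (by
      rw [h2]
      refine hfib _ 2 two_pos (fun j hj => by simp [hb0 j hj]) fun i => ?_
      refine (Finset.sum_congr rfl fun j hj => ?_).trans_le (hb2 i)
      rw [hA i j hj])
  let R1 : SeqLp 𝕜 (ENNReal.ofReal p) →L[𝕜] SeqLp 𝕜 (ENNReal.ofReal p) :=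
    lpAverage _ hpq' hA b' hbq
  let R2 : SeqLp 𝕜 2 →L[𝕜] SeqLp 𝕜 2 :=
    lpAverage 2 h22 hA (fun j => v (β j) * b' j / u j) (fun i => by
      refine (Finset.sum_congr rfl fun j hj => ?_).trans_le (hb2' i)
      rw [hA i j hj])
  have hu' : ∀ j, (u j : 𝕜) ≠ 0 := fun j => by exact_mod_cast (hu j).ne'
  have hv' : ∀ j, (v j : 𝕜) ≠ 0 := fun j => by exact_mod_cast (hv j).ne'
  let ι : RosenthalX 𝕜 (ENNReal.ofReal p) v →L[𝕜] RosenthalX 𝕜 (ENNReal.ofReal p) u :=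
    RosenthalX.lift (E1.comp (RosenthalX.fstL 𝕜 _ v)) (E2.comp (RosenthalX.sndL 𝕜 _ v))
      (fun x j => by
        change ((u j * b j / v (β j) : ℝ) : 𝕜) * RosenthalX.sndL 𝕜 _ v x (β j) =
          (u j : 𝕜) * ((b j : 𝕜) * RosenthalX.fstL 𝕜 _ v x (β j))
        rw [RosenthalX.sndL_apply]
        push_cast
        have := hv' (β j)
        field_simp)
  let R : RosenthalX 𝕜 (ENNReal.ofReal p) u →L[𝕜] RosenthalX 𝕜 (ENNReal.ofReal p) v :=
    RosenthalX.lift (R1.comp (RosenthalX.fstL 𝕜 _ u)) (R2.comp (RosenthalX.sndL 𝕜 _ u))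
      (fun x i => by
        change ∑ j ∈ A i, ((v (β j) * b' j / u j : ℝ) : 𝕜) * RosenthalX.sndL 𝕜 _ u x j =
          (v i : 𝕜) * ∑ j ∈ A i, (b' j : 𝕜) * RosenthalX.fstL 𝕜 _ u x j
        rw [Finset.mul_sum]
        refine Finset.sum_congr rfl fun j hj => ?_
        rw [RosenthalX.sndL_apply, hA i j hj]
        push_cast
        have := hu' j
        field_simp)
  have hκ' : (κ : 𝕜) ≠ 0 := by exact_mod_cast hκ
  refine ⟨ι, (κ⁻¹ : 𝕜) • R, fun x => ?_, fun x j => rfl, fun x i => rfl⟩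
  refine RosenthalX.ext_fstL fun i => ?_
  change (κ⁻¹ : 𝕜) * ∑ j ∈ A i, (b' j : 𝕜) * ((b j : 𝕜) * RosenthalX.fstL 𝕜 _ v x (β j)) = _
  have : ∑ j ∈ A i, (b' j : 𝕜) * ((b j : 𝕜) * RosenthalX.fstL 𝕜 _ v x (β j)) =
      (κ : 𝕜) * RosenthalX.fstL 𝕜 _ v x i := by
    rw [← hbb i]
    push_cast
    rw [Finset.sum_mul]
    refine Finset.sum_congr rfl fun j hj => ?_
    rw [hA i j hj]
    ring
  rw [this, inv_mul_cancel_left₀ hκ']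

/-- Splitting the index set splits the space. -/
theorem exists_equiv_prod_of_splitting {q : ℝ} (hpq : p.HolderConjugate q) {u : ℕ → ℝ}
    (hu : ∀ j, 0 < u j) {f g : ℕ → ℕ} (hf : Function.Injective f) (hg : Function.Injective g)
    (hfg : ∀ i k, f i ≠ g k) (hcov : ∀ j, j ∈ Set.range f ∨ j ∈ Set.range g) :
    Nonempty (RosenthalX 𝕜 (ENNReal.ofReal p) u ≃L[𝕜]
      RosenthalX 𝕜 (ENNReal.ofReal p) (u ∘ f) × RosenthalX 𝕜 (ENNReal.ofReal p) (u ∘ g)) := by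
  classical
  have key : ∀ h : ℕ → ℕ, Function.Injective h →
      ∃ (ι : RosenthalX 𝕜 (ENNReal.ofReal p) (u ∘ h) →L[𝕜] RosenthalX 𝕜 (ENNReal.ofReal p) u)
        (R : RosenthalX 𝕜 (ENNReal.ofReal p) u →L[𝕜] RosenthalX 𝕜 (ENNReal.ofReal p) (u ∘ h)),
        (∀ x i, RosenthalX.fstL 𝕜 _ _ (ι x) (h i) = RosenthalX.fstL 𝕜 _ _ x i) ∧
        (∀ x j, j ∉ Set.range h → RosenthalX.fstL 𝕜 _ _ (ι x) j = 0) ∧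
        (∀ x i, RosenthalX.fstL 𝕜 _ _ (R x) i = RosenthalX.fstL 𝕜 _ _ x (h i)) := by
    intro h hh
    have hinv : ∀ i, Function.invFun h (h i) = i := Function.leftInverse_invFun hh
    obtain ⟨ι, R, -, h1, h2⟩ := exists_rightInverse_of_blocks 𝕜 hpq hu (fun i => hu (h i))
      (β := Function.invFun h) (A := fun i => {h i}) (b := fun j => if j ∈ Set.range h then 1 else 0)
      (b' := fun _ => 1) (v := u ∘ h) (κ := 1) (fun i j hj => by
        rw [Finset.mem_singleton.1 hj, hinv]) one_ne_zero
      (fun j hj => by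
        refine if_neg ?_
        rintro ⟨i, rfl⟩
        exact hj (by simp [hinv]))
      (fun i => by simp) (fun i => by simp [(hu (h i)).ne']) (fun i => by simp)
      (fun i => by simp [(hu (h i)).ne'])
      (fun i => by rw [Finset.sum_singleton]; simp)
    refine ⟨ι, R, fun x i => ?_, fun x j hj => ?_, fun x i => ?_⟩
    · rw [h1, hinv]; simp
    · rw [h1, if_neg hj]; simp
    · rw [h2]; simp
  obtain ⟨ιf, Rf, hf1, hf2, hf3⟩ := key f hf
  obtain ⟨ιg, Rg, hg1, hg2, hg3⟩ := key g hg
  have hfg' : ∀ i, f i ∉ Set.range g := fun i ⟨k, hk⟩ => hfg i k hk.symm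
  have hgf' : ∀ i, g i ∉ Set.range f := fun i ⟨k, hk⟩ => hfg k i hk
  refine ⟨ContinuousLinearEquiv.equivOfInverse (Rf.prod Rg) (ιf.coprod ιg) (fun x => ?_)
    fun y => ?_⟩
  · refine RosenthalX.ext_fstL fun j => ?_
    change RosenthalX.fstL 𝕜 _ _ (ιf (Rf x) + ιg (Rg x)) j = _
    rw [map_add, lp.coeFn_add, Pi.add_apply]
    rcases hcov j with ⟨i, rfl⟩ | ⟨i, rfl⟩
    · rw [hf1, hf3, hg2 _ _ (hfg' i), add_zero]
    · rw [hg1, hg3, hf2 _ _ (hgf' i), zero_add]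
  · obtain ⟨y, z⟩ := y
    refine Prod.ext (RosenthalX.ext_fstL fun i => ?_) (RosenthalX.ext_fstL fun i => ?_)
    · change RosenthalX.fstL 𝕜 _ _ (Rf (ιf y + ιg z)) i = _
      rw [hf3, map_add, lp.coeFn_add, Pi.add_apply, hf1, hg2 _ _ (hfg' i), add_zero]
    · change RosenthalX.fstL 𝕜 _ _ (Rg (ιf y + ιg z)) i = _
      rw [hg3, map_add, lp.coeFn_add, Pi.add_apply, hg1, hf2 _ _ (hgf' i), zero_add]

/-- Each term of a sequence of positive targets is matched, up to a factor `2`, by a block of a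
divergent series whose terms tend to `0`, and the blocks can be taken disjoint. -/
theorem exists_disjoint_blocks {g : ℕ → ℝ} (hg : ∀ j, 0 < g j) (hg0 : Tendsto g atTop (𝓝 0))
    (hgs : ¬ Summable g) {t : ℕ → ℝ} (ht : ∀ i, 0 < t i) :
    ∃ A : ℕ → Finset ℕ, (Pairwise fun i k => Disjoint (A i) (A k)) ∧
      ∀ i, t i / 2 ≤ ∑ j ∈ A i, g j ∧ ∑ j ∈ A i, g j ≤ t i := by
  have hdiv := (not_summable_iff_tendsto_nat_atTop_of_nonneg fun j => (hg j).le).1 hgs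
  have step : ∀ (N : ℕ) (τ : ℝ), 0 < τ → ∃ a b : ℕ, N ≤ a ∧ a ≤ b ∧
      τ / 2 ≤ ∑ j ∈ Finset.Ico a b, g j ∧ ∑ j ∈ Finset.Ico a b, g j ≤ τ := by
    intro N τ hτ
    obtain ⟨a, ha⟩ := eventually_atTop.1
      ((hg0.eventually_lt_const (half_pos hτ)).and (eventually_ge_atTop N))
    have hex : ∃ b, a ≤ b ∧ τ / 2 ≤ ∑ j ∈ Finset.Ico a b, g j := by
      obtain ⟨b, hb, hab⟩ := ((hdiv.eventually_ge_atTop (τ / 2 + ∑ j ∈ Finset.range a, g j)).and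
        (eventually_ge_atTop a)).exists
      refine ⟨b, hab, ?_⟩
      rw [Finset.sum_Ico_eq_sub _ hab]
      linarith
    classical
    refine ⟨a, Nat.find hex, (ha a le_rfl).2, (Nat.find_spec hex).1, (Nat.find_spec hex).2, ?_⟩
    obtain ⟨hab, hb⟩ := Nat.find_spec hex
    rcases hab.eq_or_lt with h | h
    · rw [← h, Finset.Ico_self, Finset.sum_empty] at hb
      linarith
    · obtain ⟨k, hk⟩ : ∃ k, Nat.find hex = k + 1 := Nat.exists_eq_succ_of_ne_zero (by omega)
      have hak : a ≤ k := by omega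
      have hmin := Nat.find_min hex (m := k) (by omega)
      rw [hk, Finset.sum_Ico_succ_top hak]
      have h1 := (ha k hak).1
      have h2 : ∑ j ∈ Finset.Ico a k, g j < τ / 2 := by
        by_contra! h3
        exact hmin ⟨hak, h3⟩
      linarith
  choose! a b hNa hab hlow hup using step
  let N : ℕ → ℕ := fun i => Nat.rec 0 (fun i N => b N (t i)) i
  have hN : ∀ i, N (i + 1) = b (N i) (t i) := fun i => rfl
  have hmono : Monotone N := monotone_nat_of_le_succ fun i => by
    rw [hN]; exact (hNa _ _ (ht i)).trans (hab _ _ (ht i))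
  refine ⟨fun i => Finset.Ico (a (N i) (t i)) (b (N i) (t i)), ?_,
    fun i => ⟨hlow _ _ (ht i), hup _ _ (ht i)⟩⟩
  have hlt : ∀ i k, i < k → Disjoint (Finset.Ico (a (N i) (t i)) (b (N i) (t i)))
      (Finset.Ico (a (N k) (t k)) (b (N k) (t k))) := by
    intro i k hik
    refine Finset.disjoint_left.2 fun j hi hk => ?_
    have h1 := (Finset.mem_Ico.1 hi).2
    have h2 := (Finset.mem_Ico.1 hk).1
    have h3 := hNa (N k) (t k) (ht k)
    have h4 := hmono (Nat.succ_le_of_lt hik)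
    rw [Nat.succ_eq_add_one, hN] at h4
    omega
  intro i k hik
  rcases lt_or_gt_of_ne hik with h | h
  · exact hlt i k h
  · exact (hlt k i h).symm

/-- Rosenthal's condition on a weight: along some infinite set of indices it tends to `0` while the
series of its powers of exponent `s` diverges. -/
def IsRosenthalWeight (s : ℝ) (u : ℕ → ℝ) : Prop :=
  ∃ f : ℕ → ℕ, Function.Injective f ∧ Tendsto (fun k => u (f k)) atTop (𝓝 0) ∧
    ¬ Summable fun k => u (f k) ^ s

/-- If `u` satisfies Rosenthal's condition, then every `𝔛_{p,v}` is complemented in `𝔛_{p,u}`. -/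
theorem IsRosenthalWeight.exists_complemented {q s : ℝ} (hpq : p.HolderConjugate q) (hs : 0 < s)
    (hsp : 1 / s = 1 / 2 - 1 / p) {u v : ℕ → ℝ} (hu : ∀ j, 0 < u j) (hv : ∀ i, 0 < v i)
    (hus : IsRosenthalWeight s u) :
    ∃ (ι : RosenthalX 𝕜 (ENNReal.ofReal p) v →L[𝕜] RosenthalX 𝕜 (ENNReal.ofReal p) u)
      (R : RosenthalX 𝕜 (ENNReal.ofReal p) u →L[𝕜] RosenthalX 𝕜 (ENNReal.ofReal p) v),
      Function.RightInverse ι R := by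
  classical
  obtain ⟨f, hf, hf0, hfs⟩ := hus
  obtain ⟨A', hA', hsum⟩ := exists_disjoint_blocks (fun k => Real.rpow_pos_of_pos (hu (f k)) s)
    (by simpa [Real.zero_rpow hs.ne'] using hf0.rpow_const (Or.inr hs.le)) hfs
    (fun i => Real.rpow_pos_of_pos (hv i) s)
  set A : ℕ → Finset ℕ := fun i => (A' i).map ⟨f, hf⟩ with hAdef
  have hVA : ∀ i, ∑ j ∈ A i, u j ^ s = ∑ k ∈ A' i, u (f k) ^ s := fun i => by
    simp [hAdef]
  set V : ℕ → ℝ := fun i => ∑ j ∈ A i, u j ^ s with hV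
  have hV1 : ∀ i, v i ^ s / 2 ≤ V i := fun i => (hsum i).1.trans_eq (hVA i).symm
  have hV2 : ∀ i, V i ≤ v i ^ s := fun i => (hVA i).trans_le (hsum i).2
  have hVpos : ∀ i, 0 < V i := fun i =>
    (half_pos (Real.rpow_pos_of_pos (hv i) s)).trans_le (hV1 i)
  have hdisj : ∀ i k j, j ∈ A i → j ∈ A k → i = k := by
    intro i k j hi hk
    by_contra hik
    simp only [hAdef, Finset.mem_map, Function.Embedding.coeFn_mk] at hi hk
    obtain ⟨a, ha, rfl⟩ := hi
    obtain ⟨b, hb, hab⟩ := hk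
    rw [hf hab] at hb
    exact Finset.disjoint_left.1 (hA' hik) ha hb
  let β : ℕ → ℕ := fun j => if h : ∃ i, j ∈ A i then h.choose else 0
  have hβ : ∀ i, ∀ j ∈ A i, β j = i := by
    intro i j hj
    have h : ∃ i, j ∈ A i := ⟨i, hj⟩
    simp only [β, dif_pos h]
    exact hdisj _ _ j h.choose_spec hj
  let ρ : ℕ → ℝ := fun j => u j ^ s / V (β j)
  have hρ : ∀ j, 0 < ρ j := fun j => div_pos (Real.rpow_pos_of_pos (hu j) s) (hVpos _)
  have hρsum : ∀ i, ∑ j ∈ A i, ρ j = 1 := fun i => by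
    have : ∀ j ∈ A i, ρ j = u j ^ s / V i := fun j hj => by simp only [ρ, hβ i j hj]
    rw [Finset.sum_congr rfl this, ← Finset.sum_div, div_self (hVpos i).ne']
  have hρs : ∀ j, ρ j ^ (1 / s) = u j / V (β j) ^ (1 / s) := fun j => by
    simp only [ρ]
    rw [Real.div_rpow (Real.rpow_nonneg (hu j).le _) (hVpos _).le, ← Real.rpow_mul (hu j).le,
      mul_one_div_cancel hs.ne', Real.rpow_one]
  have hρp : ∀ j, ρ j ^ (1 / p) * ρ j ^ (1 / s) = ρ j ^ (1 / 2 : ℝ) := fun j => by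
    rw [← Real.rpow_add (hρ j), hsp]; congr 1; ring
  have hρq : ∀ j, ρ j ^ (1 / q) = ρ j ^ (1 / 2 : ℝ) * ρ j ^ (1 / s) := fun j => by
    rw [← Real.rpow_add (hρ j), hsp]; congr 1
    have := hpq.inv_add_inv_eq_one
    linarith [one_div p, one_div q]
  have hρ2 : ∀ j, (ρ j ^ (1 / 2 : ℝ)) ^ (2 : ℝ) = ρ j := fun j => by
    rw [← Real.rpow_mul (hρ j).le]; norm_num
  set κ : ℝ := (1 / 2) ^ (1 / s) with hκ
  have hκ0 : 0 < κ := by positivity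
  have hκ1 : κ ≤ 1 := Real.rpow_le_one (by norm_num) (by norm_num) (by positivity)
  have hVs : ∀ i, V i ^ (1 / s) ≤ v i := fun i => by
    refine (Real.rpow_le_rpow (hVpos i).le (hV2 i) (by positivity)).trans_eq ?_
    rw [← Real.rpow_mul (hv i).le, mul_one_div_cancel hs.ne', Real.rpow_one]
  have hVs' : ∀ i, κ * v i ≤ V i ^ (1 / s) := fun i => by
    refine le_trans (le_of_eq ?_) (Real.rpow_le_rpow ?_ (hV1 i) (by positivity))
    · rw [div_eq_inv_mul, Real.mul_rpow (by norm_num) (Real.rpow_nonneg (hv i).le _),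
        ← Real.rpow_mul (hv i).le, mul_one_div_cancel hs.ne', Real.rpow_one, hκ, one_div 2]
    · exact (half_pos (Real.rpow_pos_of_pos (hv i) s)).le
  have hVs0 : ∀ i, 0 < V i ^ (1 / s) := fun i => Real.rpow_pos_of_pos (hVpos i) _
  refine (exists_rightInverse_of_blocks 𝕜 hpq hu hv hβ hκ0.ne'
    (b := fun j => if j ∈ A (β j) then ρ j ^ (1 / p) else 0)
    (b' := fun j => κ * ρ j ^ (1 / q)) (fun j hj => if_neg hj)
    (fun i => ?_) (fun i => ?_) (fun i => ?_) (fun i => ?_) (fun i => ?_)).imp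
    fun ι => Exists.imp fun R h => h.1
  · refine le_of_eq ((Finset.sum_congr rfl fun j hj => ?_).trans (hρsum i))
    rw [if_pos (by rwa [hβ i j hj]), abs_of_pos (Real.rpow_pos_of_pos (hρ j) _),
      ← Real.rpow_mul (hρ j).le, one_div_mul_cancel hpq.ne_zero, Real.rpow_one]
  · refine (Finset.sum_le_sum fun j hj => ?_).trans_eq (hρsum i)
    rw [if_pos (by rwa [hβ i j hj])]
    have h1 := Real.rpow_pos_of_pos (hρ j) (1 / p)
    have hnn : 0 < u j * ρ j ^ (1 / p) / v i := div_pos (mul_pos (hu j) h1) (hv i)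
    refine (Real.rpow_le_rpow (abs_nonneg _) ?_ two_pos.le).trans_eq (hρ2 j)
    rw [abs_of_pos hnn, ← hρp j, hρs, hβ i j hj, div_le_iff₀ (hv i)]
    have h2 : 1 ≤ v i / V i ^ (1 / s) := (one_le_div (hVs0 i)).2 (hVs i)
    calc u j * ρ j ^ (1 / p) ≤ u j * ρ j ^ (1 / p) * (v i / V i ^ (1 / s)) :=
          le_mul_of_one_le_right (mul_pos (hu j) h1).le h2
      _ = _ := by ring
  · refine (Finset.sum_le_sum fun j hj => ?_).trans_eq (hρsum i)
    have h1 := Real.rpow_pos_of_pos (hρ j) (1 / q)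
    rw [abs_of_pos (mul_pos hκ0 h1), Real.mul_rpow hκ0.le h1.le, ← Real.rpow_mul (hρ j).le,
      one_div_mul_cancel hpq.symm.ne_zero, Real.rpow_one]
    exact mul_le_of_le_one_left (hρ j).le (Real.rpow_le_one hκ0.le hκ1 hpq.symm.nonneg)
  · refine (Finset.sum_le_sum fun j hj => ?_).trans_eq (hρsum i)
    have h1 := Real.rpow_pos_of_pos (hρ j) (1 / 2)
    have h3 := Real.rpow_pos_of_pos (hρ j) (1 / q)
    have hnn : 0 < v i * (κ * ρ j ^ (1 / q)) / u j :=
      div_pos (mul_pos (hv i) (mul_pos hκ0 h3)) (hu j)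
    refine (Real.rpow_le_rpow (abs_nonneg _) ?_ two_pos.le).trans_eq (hρ2 j)
    rw [abs_of_pos hnn, hρq, hρs, hβ i j hj, div_le_iff₀ (hu j)]
    have h2 : κ * v i / V i ^ (1 / s) ≤ 1 := (div_le_one (hVs0 i)).2 (hVs' i)
    calc v i * (κ * (ρ j ^ (1 / 2 : ℝ) * (u j / V i ^ (1 / s))))
        = ρ j ^ (1 / 2 : ℝ) * u j * (κ * v i / V i ^ (1 / s)) := by ring
      _ ≤ ρ j ^ (1 / 2 : ℝ) * u j := mul_le_of_le_one_right (mul_pos h1 (hu j)).le h2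
  · refine Eq.trans (Finset.sum_congr rfl fun j hj => ?_)
      ((Finset.mul_sum _ _ κ).symm.trans (by rw [hρsum i, mul_one]))
    rw [if_pos (by rwa [hβ i j hj]), mul_assoc, ← Real.rpow_add (hρ j)]
    have : 1 / q + 1 / p = 1 := by
      rw [one_div, one_div, add_comm]; exact hpq.inv_add_inv_eq_one
    rw [this, Real.rpow_one]

/-- If `u` satisfies Rosenthal's condition, then `𝔛_{p,u}` absorbs every `𝔛_{p,v}`. This is
Pełczyński's decomposition method, applied to the sum of infinitely many copies of `𝔛_{p,v}` that
is again a space of the same kind. -/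
theorem IsRosenthalWeight.exists_equiv_prod {q s : ℝ} (hpq : p.HolderConjugate q) (hs : 0 < s)
    (hsp : 1 / s = 1 / 2 - 1 / p) {u v : ℕ → ℝ} (hu : ∀ j, 0 < u j) (hv : ∀ i, 0 < v i)
    (hus : IsRosenthalWeight s u) :
    Nonempty (RosenthalX 𝕜 (ENNReal.ofReal p) u ≃L[𝕜]
      RosenthalX 𝕜 (ENNReal.ofReal p) v × RosenthalX 𝕜 (ENNReal.ofReal p) u) := by
  let w : ℕ → ℝ := fun m => v (Nat.unpair m).1
  have hw : ∀ m, 0 < w m := fun m => hv _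
  let f : ℕ → ℕ := fun i => Nat.pair i 0
  let g : ℕ → ℕ := fun m => Nat.pair (Nat.unpair m).1 ((Nat.unpair m).2 + 1)
  have hf : Function.Injective f := fun i k h => (Nat.pair_eq_pair.1 h).1
  have hg : Function.Injective g := fun i k h => by
    obtain ⟨h1, h2⟩ := Nat.pair_eq_pair.1 h
    rw [← Nat.pair_unpair i, ← Nat.pair_unpair k, h1, Nat.succ_injective h2]
  obtain ⟨e⟩ := exists_equiv_prod_of_splitting 𝕜 hpq hw hf hg
    (fun i k h => by have := (Nat.pair_eq_pair.1 h).2; omega)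
    (fun j => by
      rcases h : (Nat.unpair j).2 with _ | k
      · exact Or.inl ⟨(Nat.unpair j).1, by simp only [f]; rw [← h, Nat.pair_unpair]⟩
      · refine Or.inr ⟨Nat.pair (Nat.unpair j).1 k, ?_⟩
        simp only [g, Nat.unpair_pair]
        rw [← h, Nat.pair_unpair])
  have hwf : w ∘ f = v := by ext i; simp [w, f]
  have hwg : w ∘ g = w := by ext i; simp [w, g]
  rw [hwf, hwg] at e
  obtain ⟨ι, R, hR⟩ := hus.exists_complemented 𝕜 hpq hs hsp hu hw
  let d := ContinuousLinearEquiv.equivOfRightInverse R ι hR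
  exact ⟨d.trans ((e.prodCongr (.refl 𝕜 _)).trans
    ((ContinuousLinearEquiv.prodAssoc 𝕜 _ _ _).trans
      ((ContinuousLinearEquiv.refl 𝕜 _).prodCongr d.symm)))⟩

/-- Rosenthal's theorem: up to isomorphism `𝔛_{p,u}` does not depend on `u`, as long as `u`
satisfies Rosenthal's condition. -/
theorem IsRosenthalWeight.nonempty_equiv {q s : ℝ} (hpq : p.HolderConjugate q) (hs : 0 < s)
    (hsp : 1 / s = 1 / 2 - 1 / p) {u v : ℕ → ℝ} (hu : ∀ j, 0 < u j) (hv : ∀ i, 0 < v i)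
    (hus : IsRosenthalWeight s u) (hvs : IsRosenthalWeight s v) :
    Nonempty (RosenthalX 𝕜 (ENNReal.ofReal p) u ≃L[𝕜] RosenthalX 𝕜 (ENNReal.ofReal p) v) := by
  obtain ⟨e⟩ := hus.exists_equiv_prod 𝕜 hpq hs hsp hu hv
  obtain ⟨e'⟩ := hvs.exists_equiv_prod 𝕜 hpq hs hsp hv hu
  exact ⟨e.trans ((ContinuousLinearEquiv.prodComm 𝕜 _ _).trans e'.symm)⟩

variable {𝕜} in
theorem exists_equiv_norm_eq_one {E F : Type*} [NormedAddCommGroup E] [NormedSpace 𝕜 E]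
    [NormedAddCommGroup F] [NormedSpace 𝕜 F] (e : E ≃L[𝕜] F) {x : E} (hx : x ≠ 0) :
    ∃ S : E ≃L[𝕜] F, ‖(S : E →L[𝕜] F)‖ = 1 := by
  have hc0 : 0 < ‖(e : E →L[𝕜] F)‖ := by
    refine norm_pos_iff.2 fun h => hx (e.injective ?_)
    rw [map_zero]
    exact DFunLike.congr_fun h x
  have hc' : ((‖(e : E →L[𝕜] F)‖ : 𝕜))⁻¹ ≠ 0 := inv_ne_zero (by exact_mod_cast hc0.ne')
  refine ⟨e.trans (ContinuousLinearEquiv.smulLeft (Units.mk0 _ hc')), ?_⟩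
  change ‖((‖(e : E →L[𝕜] F)‖ : 𝕜))⁻¹ • (e : E →L[𝕜] F)‖ = 1
  rw [norm_smul, norm_inv, RCLike.norm_ofReal, abs_of_pos hc0, inv_mul_cancel₀ hc0.ne']

/-- The dual form of Rosenthal's theorem, with the isomorphism normalized. -/
theorem IsRosenthalWeight.exists_dual_equiv_norm_eq_one {q s : ℝ} (hpq : p.HolderConjugate q)
    (hs : 0 < s) (hsp : 1 / s = 1 / 2 - 1 / p) {u v : ℕ → ℝ} (hu : ∀ j, 0 < u j)
    (hv : ∀ i, 0 < v i) (hus : IsRosenthalWeight s u) (hvs : IsRosenthalWeight s v) :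
    ∃ S : RosenthalXDual 𝕜 (ENNReal.ofReal p) u ≃L[𝕜] RosenthalXDual 𝕜 (ENNReal.ofReal p) v,
      ‖(S : RosenthalXDual 𝕜 (ENNReal.ofReal p) u →L[𝕜]
        RosenthalXDual 𝕜 (ENNReal.ofReal p) v)‖ = 1 := by
  obtain ⟨e⟩ := hus.nonempty_equiv 𝕜 hpq hs hsp hu hv hvs
  have hh : dualUnitVector 𝕜 (ENNReal.ofReal p) u 0 ≠ 0 := fun h => by
    have h1 := dualUnitVector_unitVector (𝕜 := 𝕜) (p := ENNReal.ofReal p) (u := u) 0 0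
    rw [h] at h1
    simp at h1
  exact exists_equiv_norm_eq_one (e.arrowCongr (.refl 𝕜 𝕜)) hh

end Rosenthal

/-! ### Three valued systems with prescribed weights -/

section Laws

/-- The symmetric law with atoms at `c`, `-c` of mass `τ / 2` and an atom at `0`. -/
def threeValuedLaw (c τ : ℝ) : Measure ℝ :=
  ENNReal.ofReal (τ / 2) • Measure.dirac c + ENNReal.ofReal (τ / 2) • Measure.dirac (-c) +
    ENNReal.ofReal (1 - τ) • Measure.dirac 0

theorem isProbabilityMeasure_threeValuedLaw {c τ : ℝ} (h0 : 0 ≤ τ) (h1 : τ ≤ 1) :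
    IsProbabilityMeasure (threeValuedLaw c τ) := by
  constructor
  simp only [threeValuedLaw, Measure.add_apply, Measure.smul_apply, smul_eq_mul, measure_univ,
    mul_one]
  rw [← ENNReal.ofReal_add (by linarith) (by linarith), ← ENNReal.ofReal_add (by linarith)
    (by linarith)]
  simp

theorem lintegral_enorm_rpow_threeValuedLaw {c τ t : ℝ} (hc : 0 < c) (h0 : 0 ≤ τ) (ht : 0 < t) :
    ∫⁻ x, ‖x‖ₑ ^ t ∂(threeValuedLaw c τ) = ENNReal.ofReal (τ * c ^ t) := by
  simp only [threeValuedLaw, lintegral_add_measure, lintegral_smul_measure, lintegral_dirac,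
    enorm_neg, enorm_zero, ENNReal.zero_rpow_of_pos ht, smul_eq_mul, mul_zero, add_zero]
  rw [← add_mul, ← ENNReal.ofReal_add (by linarith) (by linarith), Real.enorm_of_nonneg hc.le,
    ENNReal.ofReal_rpow_of_pos hc, ← ENNReal.ofReal_mul (by linarith)]
  ring_nf

theorem ae_threeValuedLaw (c τ : ℝ) :
    ∀ᵐ x ∂(threeValuedLaw c τ), x = c ∨ x = 0 ∨ x = -c := by
  have hm : MeasurableSet {x : ℝ | x = c ∨ x = 0 ∨ x = -c}ᶜ := by
    refine (Set.Finite.measurableSet (Set.Finite.subset (Set.toFinite {c, 0, -c}) ?_)).compl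
    intro x hx
    simpa using hx
  rw [ae_iff]
  change threeValuedLaw c τ {x : ℝ | x = c ∨ x = 0 ∨ x = -c}ᶜ = 0
  simp only [threeValuedLaw, Measure.add_apply, Measure.smul_apply, smul_eq_mul,
    Measure.dirac_apply' _ hm]
  simp

theorem threeValuedLaw_singleton {c : ℝ} (hc : 0 < c) (τ : ℝ) :
    threeValuedLaw c τ {c} = threeValuedLaw c τ {-c} := by
  have h1 : ¬ (-c = c) := by intro h; linarith
  have h2 : ¬ (c = -c) := by intro h; linarith
  have h3 : ¬ ((0 : ℝ) = -c) := by intro h; linarith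
  simp only [threeValuedLaw, Measure.add_apply, Measure.smul_apply, smul_eq_mul,
    Measure.dirac_apply' _ (measurableSet_singleton _), Set.indicator_apply,
    Set.mem_singleton_iff, h1, h2, h3, hc.ne, if_false, if_true, mul_zero, add_zero, zero_add, Pi.one_apply]

/-- Every sequence of weights in `(0, 1]` comes from a three valued system, and two such systems
can be realized on one probability space. -/
theorem exists_isThreeValuedSystem {q : ℝ} (hq1 : 1 < q) (hq2 : q < 2) {v w : ℕ → ℝ}
    (hv : ∀ j, 0 < v j) (hv1 : ∀ j, v j ≤ 1) (hw : ∀ j, 0 < w j) (hw1 : ∀ j, w j ≤ 1) :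
    ∃ (Ω : Type) (_ : MeasurableSpace Ω) (P : Measure Ω) (_ : IsProbabilityMeasure P)
      (Y Z : ℕ → Ω → ℝ), IsThreeValuedSystem P q Y ∧ IsThreeValuedSystem P q Z ∧
      (∀ j, v j = (eLpNorm (Y j) 2 P).toReal⁻¹) ∧ (∀ j, w j = (eLpNorm (Z j) 2 P).toReal⁻¹) := by
  have hq0 : 0 < q := by linarith
  have h2q : 0 < 2 - q := by linarith
  -- `c = x ^ (-2 / (2 - q))` is the level, and `c ^ (-q)` the probability of being nonzero
  let c : ℝ → ℝ := fun x => x ^ (-(2 / (2 - q)))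
  let u : ℕ ⊕ ℕ → ℝ := Sum.elim v w
  have hu : ∀ k, 0 < u k := by rintro (j | j); exacts [hv j, hw j]
  have hu1 : ∀ k, u k ≤ 1 := by rintro (j | j); exacts [hv1 j, hw1 j]
  have hc : ∀ k, 0 < c (u k) := fun k => Real.rpow_pos_of_pos (hu k) _
  have hτ1 : ∀ k, c (u k) ^ (-q) ≤ 1 := fun k => by
    rw [← Real.rpow_mul (hu k).le]
    refine Real.rpow_le_one (hu k).le (hu1 k) ?_
    rw [neg_mul_neg]; positivity
  have hprob : ∀ k, IsProbabilityMeasure (threeValuedLaw (c (u k)) (c (u k) ^ (-q))) := fun k =>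
    isProbabilityMeasure_threeValuedLaw (Real.rpow_nonneg (hc k).le _) (hτ1 k)
  obtain ⟨Ω, mΩ, P, X, hX, hlaw, hind, hP⟩ := exists_hasLaw_indepFun (fun _ : ℕ ⊕ ℕ => ℝ)
    (fun k => threeValuedLaw (c (u k)) (c (u k) ^ (-q)))
  have hnorm : ∀ k {t : ℝ}, 0 < t → eLpNorm (X k) (ENNReal.ofReal t) P =
      ENNReal.ofReal (c (u k) ^ (t - q)) ^ (1 / t) := fun k t ht => by
    rw [eLpNorm_eq_lintegral_rpow_enorm_toReal (by simpa using ht) ENNReal.ofReal_ne_top,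
      ENNReal.toReal_ofReal ht.le]
    congr 1
    have hm : Measurable fun x : ℝ => ‖x‖ₑ ^ t := by fun_prop
    rw [← lintegral_map hm (hX k), (hlaw k).map_eq,
      lintegral_enorm_rpow_threeValuedLaw (hc k) (Real.rpow_nonneg (hc k).le _) ht,
      ← Real.rpow_add (hc k)]
    congr 2; ring
  have hsys : ∀ e : ℕ → ℕ ⊕ ℕ, Function.Injective e →
      IsThreeValuedSystem P q (fun j => X (e j)) := fun e he =>
    { measurable := fun j => hX _
      indep := hind.precomp he
      symm_three_valued := fun j => by
        refine ⟨c (u (e j)), hc _, ?_, ?_⟩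
        · have h := ae_threeValuedLaw (c (u (e j))) (c (u (e j)) ^ (-q))
          rw [← (hlaw (e j)).map_eq] at h
          exact ae_of_ae_map (hX _).aemeasurable h
        · have h := threeValuedLaw_singleton (hc (e j)) (c (u (e j)) ^ (-q))
          rw [← (hlaw (e j)).map_eq, Measure.map_apply (hX _) (measurableSet_singleton _),
            Measure.map_apply (hX _) (measurableSet_singleton _)] at h
          exact h
      normalized := fun j => by rw [hnorm _ hq0]; simp }
  have hweight : ∀ k, u k = (eLpNorm (X k) 2 P).toReal⁻¹ := fun k => by
    have h := hnorm k two_pos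
    rw [ENNReal.ofReal_ofNat] at h
    rw [h, ← ENNReal.toReal_rpow, ENNReal.toReal_ofReal (Real.rpow_nonneg (hc k).le _),
      ← Real.rpow_mul (hu k).le, ← Real.rpow_mul (hu k).le, ← Real.rpow_neg (hu k).le]
    conv_lhs => rw [← Real.rpow_one (u k)]
    congr 1
    field_simp
  exact ⟨Ω, mΩ, P, hP, fun j => X (Sum.inl j), fun j => X (Sum.inr j),
    hsys _ Sum.inl_injective, hsys _ Sum.inr_injective, fun j => hweight (Sum.inl j),
    fun j => hweight (Sum.inr j)⟩

end Laws

/-! ### The modular of a three valued system -/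

section Modular

/-- The Orlicz function `min (t ^ q) (t ^ 2)`. -/
def orlicz (q t : ℝ) : ℝ := min (t ^ q) (t ^ (2 : ℝ))

theorem orlicz_nonneg (q : ℝ) {t : ℝ} (ht : 0 ≤ t) : 0 ≤ orlicz q t :=
  le_min (Real.rpow_nonneg ht _) (Real.rpow_nonneg ht _)

theorem orlicz_mono {q : ℝ} (hq : 0 ≤ q) {t t' : ℝ} (ht : 0 ≤ t) (h : t ≤ t') :
    orlicz q t ≤ orlicz q t' :=
  min_le_min (Real.rpow_le_rpow ht h hq) (Real.rpow_le_rpow ht h two_pos.le)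

theorem orlicz_of_one_le {q : ℝ} (hq2 : q < 2) {t : ℝ} (ht : 1 ≤ t) : orlicz q t = t ^ q :=
  min_eq_left (Real.rpow_le_rpow_of_exponent_le ht hq2.le)

theorem orlicz_of_le_one {q : ℝ} (hq2 : q < 2) {t : ℝ} (ht0 : 0 < t) (ht : t ≤ 1) :
    orlicz q t = t ^ (2 : ℝ) :=
  min_eq_right (Real.rpow_le_rpow_of_exponent_ge ht0 ht hq2.le)

theorem orlicz_zero {q : ℝ} (hq : 0 < q) : orlicz q 0 = 0 := by
  simp [orlicz, Real.zero_rpow hq.ne']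

variable {𝕜 : Type*} [RCLike 𝕜] {Ω : Type*} [MeasurableSpace Ω] {P : Measure Ω}
  {p q : ℝ} {Y : ℕ → Ω → ℝ} {c v : ℕ → ℝ}

namespace HasLevels

theorem rpow_neg_mul_orlicz_of_one_le (L : HasLevels P q Y c v) (hq2 : q < 2) {j : ℕ} {t : ℝ}
    (ht0 : 0 ≤ t) (ht : 1 ≤ t * c j) : c j ^ (-q) * orlicz q (t * c j) = t ^ q := by
  have hc := L.c_pos j
  rw [orlicz_of_one_le hq2 ht, Real.mul_rpow ht0 hc.le, mul_left_comm, ← Real.rpow_add hc]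
  simp

theorem rpow_neg_mul_orlicz_of_lt_one (L : HasLevels P q Y c v) (hq1 : 1 < q) (hq2 : q < 2)
    {j : ℕ} {t : ℝ} (ht0 : 0 ≤ t) (ht : t * c j < 1) :
    c j ^ (-q) * orlicz q (t * c j) = t ^ 2 * c j ^ (2 - q) := by
  have hc := L.c_pos j
  rcases ht0.eq_or_lt with rfl | ht0
  · simp [orlicz_zero (show 0 < q by linarith)]
  · rw [orlicz_of_le_one hq2 (mul_pos ht0 hc) ht.le, Real.mul_rpow ht0.le hc.le, mul_left_comm,
      ← Real.rpow_add hc, Real.rpow_two]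
    ring_nf

variable [IsProbabilityMeasure P]

/-- The norm in `L_q` of a combination of the `Y j` in terms of its modular, from above. -/
theorem toReal_eLpNorm_sum_le_modular (L : HasLevels P q Y c v) (hq1 : 1 < q) (hq2 : q < 2)
    (x : ℕ → 𝕜) (s : Finset ℕ) {M : ℝ}
    (hM : ∑ j ∈ s, c j ^ (-q) * orlicz q (‖x j‖ * c j) ≤ M) :
    (eLpNorm (fun ω => ∑ j ∈ s, x j * ((Y j ω : ℝ) : 𝕜)) (ENNReal.ofReal q) P).toReal ≤
      M ^ q⁻¹ + M ^ (2⁻¹ : ℝ) := by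
  have hq0 : 0 < q := by linarith
  have hnn : ∀ j, 0 ≤ c j ^ (-q) * orlicz q (‖x j‖ * c j) := fun j =>
    mul_nonneg (Real.rpow_nonneg (L.c_pos j).le _)
      (orlicz_nonneg q (mul_nonneg (norm_nonneg _) (L.c_pos j).le))
  have hsub : ∀ s' ⊆ s, ∑ j ∈ s', c j ^ (-q) * orlicz q (‖x j‖ * c j) ≤ M := fun s' h =>
    (Finset.sum_le_sum_of_subset_of_nonneg h fun j _ _ => hnn j).trans hM
  set s₁ := s.filter (fun j => 1 ≤ ‖x j‖ * c j) with hs₁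
  set s₂ := s.filter (fun j => ¬ 1 ≤ ‖x j‖ * c j) with hs₂
  have h1 := L.toReal_eLpNorm_sum_le_lq x hq1 hq2 s₁
  have h2 := L.toReal_eLpNorm_sum_le_l2 x hq2 s₂
  have e1 : ∑ j ∈ s₁, ‖x j‖ ^ q ≤ M := by
    refine (Finset.sum_congr rfl fun j hj => ?_).trans_le (hsub s₁ (Finset.filter_subset _ _))
    exact (L.rpow_neg_mul_orlicz_of_one_le hq2 (norm_nonneg _) (Finset.mem_filter.1 hj).2).symm
  have e2 : ∑ j ∈ s₂, ‖x j‖ ^ 2 * c j ^ (2 - q) ≤ M := by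
    refine (Finset.sum_congr rfl fun j hj => ?_).trans_le (hsub s₂ (Finset.filter_subset _ _))
    exact (L.rpow_neg_mul_orlicz_of_lt_one hq1 hq2 (norm_nonneg _)
      (not_le.1 (Finset.mem_filter.1 hj).2)).symm
  have hsum : (fun ω => ∑ j ∈ s, x j * ((Y j ω : ℝ) : 𝕜)) =
      (fun ω => ∑ j ∈ s₁, x j * ((Y j ω : ℝ) : 𝕜)) +
        fun ω => ∑ j ∈ s₂, x j * ((Y j ω : ℝ) : 𝕜) := by
    ext ω
    exact (Finset.sum_filter_add_sum_filter_not s _ _).symm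
  have htri : eLpNorm (fun ω => ∑ j ∈ s, x j * ((Y j ω : ℝ) : 𝕜)) (ENNReal.ofReal q) P ≤
      eLpNorm (fun ω => ∑ j ∈ s₁, x j * ((Y j ω : ℝ) : 𝕜)) (ENNReal.ofReal q) P +
      eLpNorm (fun ω => ∑ j ∈ s₂, x j * ((Y j ω : ℝ) : 𝕜)) (ENNReal.ofReal q) P := by
    rw [hsum]
    exact eLpNorm_add_le (L.memLp_sum x s₁ 0).aestronglyMeasurable
      (L.memLp_sum x s₂ 0).aestronglyMeasurable (by simpa using hq1.le)
  have hfin₁ := (L.memLp_sum x s₁ (ENNReal.ofReal q)).eLpNorm_ne_top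
  have hfin₂ := (L.memLp_sum x s₂ (ENNReal.ofReal q)).eLpNorm_ne_top
  have htri' := ENNReal.toReal_mono (ENNReal.add_ne_top.2 ⟨hfin₁, hfin₂⟩) htri
  rw [ENNReal.toReal_add hfin₁ hfin₂] at htri'
  refine htri'.trans (add_le_add (h1.trans ?_) (h2.trans ?_))
  · exact Real.rpow_le_rpow (Finset.sum_nonneg fun j _ => by positivity) e1 (by positivity)
  · refine Real.rpow_le_rpow (Finset.sum_nonneg fun j _ => ?_) e2 (by positivity)
    exact mul_nonneg (by positivity) (Real.rpow_nonneg (L.c_pos j).le _)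

/-- The norm in `L_q` of a combination of the `Y j` in terms of its modular, from below. -/
theorem min_modular_le_toReal_eLpNorm_sum (hpq : p.HolderConjugate q) (L : HasLevels P q Y c v)
    (hq1 : 1 < q) (hq2 : q < 2) (hp : 2 < p) (x : ℕ → 𝕜) (s : Finset ℕ) {M : ℝ} (hM0 : 0 < M)
    (hM : ∑ j ∈ s, c j ^ (-q) * orlicz q (‖x j‖ * c j) = M) :
    min (M ^ q⁻¹) (M ^ (2⁻¹ : ℝ)) ≤ dualityConst p *
      (eLpNorm (fun ω => ∑ j ∈ s, x j * ((Y j ω : ℝ) : 𝕜)) (ENNReal.ofReal q) P).toReal := by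
  have hq0 : 0 < q := by linarith
  have hp0 : 0 < p := by linarith
  have hqp : q * p = q + p := by have := hpq.symm.mul_eq_add; linarith
  choose θ hθ hθx using fun j => exists_norm_one_mul_eq_norm (x j)
  -- the functional which norms the modular
  let b : ℕ → ℝ := fun j => if 1 ≤ ‖x j‖ * c j then ‖x j‖ ^ (q - 1) else ‖x j‖ * c j ^ (2 - q)
  have hc : ∀ j, 0 < c j := L.c_pos
  have hb0 : ∀ j, 0 ≤ b j := fun j => by
    simp only [b]
    split_ifs
    · positivity
    · exact mul_nonneg (norm_nonneg _) (Real.rpow_nonneg (hc j).le _)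
  have hxpos : ∀ j, 1 ≤ ‖x j‖ * c j → 0 < ‖x j‖ := fun j h => by
    by_contra! h'
    have : ‖x j‖ = 0 := le_antisymm h' (norm_nonneg _)
    rw [this, zero_mul] at h
    linarith
  have hxb : ∀ j, ‖x j‖ * b j = c j ^ (-q) * orlicz q (‖x j‖ * c j) := fun j => by
    simp only [b]
    split_ifs with h
    · rw [L.rpow_neg_mul_orlicz_of_one_le hq2 (norm_nonneg _) h]
      nth_rewrite 1 [← Real.rpow_one ‖x j‖]
      rw [← Real.rpow_add (hxpos j h)]
      ring_nf
    · rw [L.rpow_neg_mul_orlicz_of_lt_one hq1 hq2 (norm_nonneg _) (not_le.1 h)]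
      ring
  have hbp : ∀ j, b j ^ p ≤ c j ^ (-q) * orlicz q (‖x j‖ * c j) := fun j => by
    simp only [b]
    split_ifs with h
    · rw [L.rpow_neg_mul_orlicz_of_one_le hq2 (norm_nonneg _) h, ← Real.rpow_mul (norm_nonneg _)]
      refine le_of_eq ?_
      congr 1; linarith
    · rw [L.rpow_neg_mul_orlicz_of_lt_one hq1 hq2 (norm_nonneg _) (not_le.1 h)]
      rcases (norm_nonneg (x j)).eq_or_lt with h0 | h0
      · rw [← h0, zero_mul, Real.zero_rpow hp0.ne']; simp
      · have e : (‖x j‖ * c j ^ (2 - q)) ^ p =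
            ‖x j‖ ^ 2 * c j ^ (2 - q) * (‖x j‖ * c j) ^ (p - 2) := by
          rw [Real.mul_rpow h0.le (Real.rpow_nonneg (hc j).le _), Real.mul_rpow h0.le (hc j).le,
            ← Real.rpow_mul (hc j).le, ← Real.rpow_two]
          have e1 : ‖x j‖ ^ p = ‖x j‖ ^ (2 : ℝ) * ‖x j‖ ^ (p - 2) := by
            rw [← Real.rpow_add h0]; ring_nf
          have e2 : c j ^ ((2 - q) * p) = c j ^ (2 - q) * c j ^ (p - 2) := by
            rw [← Real.rpow_add (hc j)]; congr 1; linarith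
          rw [e1, e2]; ring
        rw [e]
        refine mul_le_of_le_one_right ?_
          (Real.rpow_le_one (mul_pos h0 (hc j)).le (not_le.1 h).le (by linarith))
        exact mul_nonneg (by positivity) (Real.rpow_nonneg (hc j).le _)
  have hbv : ∀ j, b j ^ 2 * v j ^ 2 ≤ c j ^ (-q) * orlicz q (‖x j‖ * c j) := fun j => by
    rw [L.v_sq]
    simp only [b]
    split_ifs with h
    · have h0 := hxpos j h
      rw [L.rpow_neg_mul_orlicz_of_one_le hq2 (norm_nonneg _) h]
      have e : (‖x j‖ ^ (q - 1)) ^ 2 * c j ^ (q - 2) = ‖x j‖ ^ q * (‖x j‖ * c j) ^ (q - 2) := by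
        rw [Real.mul_rpow h0.le (hc j).le, ← Real.rpow_two, ← Real.rpow_mul h0.le, ← mul_assoc,
          ← Real.rpow_add h0]
        ring_nf
      rw [e]
      exact mul_le_of_le_one_right (by positivity)
        (Real.rpow_le_one_of_one_le_of_nonpos h (by linarith))
    · rw [L.rpow_neg_mul_orlicz_of_lt_one hq1 hq2 (norm_nonneg _) (not_le.1 h), mul_pow,
        ← Real.rpow_two (c j ^ _), ← Real.rpow_mul (hc j).le, mul_assoc, ← Real.rpow_add (hc j)]
      ring_nf
      exact le_rfl
  set T := max (M ^ p⁻¹) (M ^ (2⁻¹ : ℝ)) with hT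
  have hT0 : 0 < T := lt_max_of_lt_left (Real.rpow_pos_of_pos hM0 _)
  have hTp : M ≤ T ^ p := by
    calc M = (M ^ p⁻¹) ^ p := by rw [← Real.rpow_mul hM0.le, inv_mul_cancel₀ hp0.ne', Real.rpow_one]
      _ ≤ T ^ p := Real.rpow_le_rpow (Real.rpow_nonneg hM0.le _) (le_max_left _ _) hp0.le
  have hT2 : M ≤ T ^ 2 := by
    calc M = (M ^ (2⁻¹ : ℝ)) ^ 2 := by
          rw [← Real.rpow_two, ← Real.rpow_mul hM0.le, inv_mul_cancel₀ two_ne_zero, Real.rpow_one]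
      _ ≤ T ^ 2 := pow_le_pow_left₀ (Real.rpow_nonneg hM0.le _) (le_max_right _ _) 2
  have hna : ∀ j, ‖θ j * ((b j / T : ℝ) : 𝕜)‖ = b j / T := fun j => by
    rw [norm_mul, hθ, one_mul, RCLike.norm_ofReal, abs_of_nonneg (div_nonneg (hb0 j) hT0.le)]
  have key := L.norm_sum_mul_le hpq hp x (fun j => θ j * ((b j / T : ℝ) : 𝕜)) s
    (by
      simp only [hna]
      have : ∀ j ∈ s, (b j / T) ^ p = b j ^ p / T ^ p := fun j _ => Real.div_rpow (hb0 j) hT0.le _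
      rw [Finset.sum_congr rfl this, ← Finset.sum_div, div_le_one (Real.rpow_pos_of_pos hT0 _)]
      exact ((Finset.sum_le_sum fun j _ => hbp j).trans_eq hM).trans hTp)
    (by
      simp only [hna]
      have : ∀ j ∈ s, (b j / T) ^ 2 * v j ^ 2 = b j ^ 2 * v j ^ 2 / T ^ 2 := fun j _ => by ring
      rw [Finset.sum_congr rfl this, ← Finset.sum_div, div_le_one (by positivity)]
      exact ((Finset.sum_le_sum fun j _ => hbv j).trans_eq hM).trans hT2)
  have hval : ∑ j ∈ s, x j * (θ j * ((b j / T : ℝ) : 𝕜)) = ((M / T : ℝ) : 𝕜) := by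
    have : ∀ j ∈ s, x j * (θ j * ((b j / T : ℝ) : 𝕜)) =
        (((c j ^ (-q) * orlicz q (‖x j‖ * c j)) / T : ℝ) : 𝕜) := fun j _ => by
      rw [← mul_assoc, mul_comm (x j), hθx, ← hxb]
      push_cast
      ring
    rw [Finset.sum_congr rfl this, ← hM, Finset.sum_div]
    push_cast
    rfl
  rw [hval, RCLike.norm_ofReal, abs_of_pos (div_pos hM0 hT0)] at key
  refine le_trans ?_ key
  rw [le_div_iff₀ hT0, hT]
  have hpq1 : q⁻¹ + p⁻¹ = 1 := by rw [add_comm]; exact hpq.inv_add_inv_eq_one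
  rcases le_total (M ^ p⁻¹) (M ^ (2⁻¹ : ℝ)) with h | h
  · rw [max_eq_right h]
    calc min (M ^ q⁻¹) (M ^ (2⁻¹ : ℝ)) * M ^ (2⁻¹ : ℝ) ≤ M ^ (2⁻¹ : ℝ) * M ^ (2⁻¹ : ℝ) :=
          mul_le_mul_of_nonneg_right (min_le_right _ _) (Real.rpow_nonneg hM0.le _)
      _ = M := by rw [← Real.rpow_add hM0]; norm_num
  · rw [max_eq_left h]
    calc min (M ^ q⁻¹) (M ^ (2⁻¹ : ℝ)) * M ^ p⁻¹ ≤ M ^ q⁻¹ * M ^ p⁻¹ :=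
          mul_le_mul_of_nonneg_right (min_le_left _ _) (Real.rpow_nonneg hM0.le _)
      _ = M := by rw [← Real.rpow_add hM0, hpq1, Real.rpow_one]

/-- Block sums whose modulars behave like `t ^ r` on the relevant range of `t` are equivalent to the
unit vector basis of `ℓ_r`. -/
theorem isEquivToEllR_of_modular (hpq : p.HolderConjugate q) (L : HasLevels P q Y c v)
    (hq1 : 1 < q) (hq2 : q < 2) (hp : 2 < p) {r : ℝ} (hr : 0 < r) {N : ℕ}
    {σ : Fin N → Finset ℕ} (hσ : Pairwise fun l k => Disjoint (σ l) (σ k)) (a : ℕ → 𝕜)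
    (hup : ∀ l t, 0 ≤ t →
      ∑ j ∈ σ l, c j ^ (-q) * orlicz q (‖a j‖ * t * c j) ≤ 4 * t ^ r)
    (hlow : ∀ l t, 0 ≤ t → t ≤ 1 → (2 * N : ℝ)⁻¹ ≤ t ^ r →
      t ^ r / 16 ≤ ∑ j ∈ σ l, c j ^ (-q) * orlicz q (‖a j‖ * t * c j)) :
    IsEquivToEllR P q r (6 + 32 * dualityConst p)
      (fun l ω => ∑ j ∈ σ l, a j * ((Y j ω : ℝ) : 𝕜)) := by
  intro d
  have hq0 : 0 < q := by linarith
  have hK := dualityConst_pos p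
  set K := dualityConst p
  set ρ := (∑ l, ‖d l‖ ^ r) ^ (1 / r) with hρ
  have hsum0 : 0 ≤ ∑ l, ‖d l‖ ^ r := Finset.sum_nonneg fun l _ => by positivity
  rcases hsum0.eq_or_lt with h0 | hpos
  · have hd : ∀ l, d l = 0 := fun l => by
      have h1 := (Finset.sum_eq_zero_iff_of_nonneg fun l _ => by positivity).1 h0.symm l
        (Finset.mem_univ l)
      exact norm_eq_zero.1 ((Real.rpow_eq_zero (norm_nonneg _) hr.ne').1 h1)
    have hρ0 : ρ = 0 := by rw [hρ, ← h0, Real.zero_rpow (one_div_pos.2 hr).ne']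
    rw [hρ0]
    simp [hd]
  have hρpos : 0 < ρ := Real.rpow_pos_of_pos hpos _
  have hρr : ρ ^ r = ∑ l, ‖d l‖ ^ r := by
    rw [hρ, ← Real.rpow_mul hpos.le, one_div_mul_cancel hr.ne', Real.rpow_one]
  -- the normalized combination
  let e : Fin N → 𝕜 := fun l => (ρ⁻¹ : 𝕜) * d l
  have hne : ∀ l, ‖e l‖ = ‖d l‖ / ρ := fun l => by
    simp only [e]
    rw [norm_mul, norm_inv, RCLike.norm_ofReal, abs_of_pos hρpos, div_eq_inv_mul]
  have hesum : ∑ l, ‖e l‖ ^ r = 1 := by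
    have : ∀ l ∈ Finset.univ, ‖e l‖ ^ r = ‖d l‖ ^ r / ρ ^ r := fun l _ => by
      rw [hne, Real.div_rpow (norm_nonneg _) hρpos.le]
    rw [Finset.sum_congr rfl this, ← Finset.sum_div, hρr, div_self hpos.ne']
  set x : ℕ → 𝕜 := fun j => ∑ l, if j ∈ σ l then e l * a j else 0 with hx
  set s := Finset.univ.biUnion σ with hs
  have hxval : ∀ l, ∀ j ∈ σ l, x j = e l * a j := fun l j hj => by
    rw [hx]
    dsimp only
    rw [Finset.sum_eq_single l, if_pos hj]
    · intro k _ hk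
      exact if_neg fun hj' => Finset.disjoint_left.1 (hσ hk) hj' hj
    · simp
  have hfun : (fun ω => ∑ l, d l * ∑ j ∈ σ l, a j * ((Y j ω : ℝ) : 𝕜)) =
      (ρ : 𝕜) • fun ω => ∑ j ∈ s, x j * ((Y j ω : ℝ) : 𝕜) := by
    ext ω
    have h1 := sum_blockCoeff_smul σ a e fun j => ((Y j ω : ℝ) : 𝕜)
    simp only [smul_eq_mul] at h1
    rw [Pi.smul_apply, smul_eq_mul, h1, Finset.mul_sum]
    refine Finset.sum_congr rfl fun l _ => ?_
    have : (ρ : 𝕜) ≠ 0 := by exact_mod_cast hρpos.ne'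
    simp only [e]
    rw [← mul_assoc, mul_inv_cancel_left₀ this]
  have hN : (eLpNorm (fun ω => ∑ l, d l * ∑ j ∈ σ l, a j * ((Y j ω : ℝ) : 𝕜))
      (ENNReal.ofReal q) P).toReal = ρ * (eLpNorm (fun ω => ∑ j ∈ s, x j * ((Y j ω : ℝ) : 𝕜))
      (ENNReal.ofReal q) P).toReal := by
    rw [hfun, eLpNorm_const_smul, ENNReal.toReal_mul, toReal_enorm, RCLike.norm_ofReal,
      abs_of_pos hρpos]
  rw [hN]
  set M := ∑ j ∈ s, c j ^ (-q) * orlicz q (‖x j‖ * c j) with hM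
  have hMl : M = ∑ l, ∑ j ∈ σ l, c j ^ (-q) * orlicz q (‖a j‖ * ‖e l‖ * c j) := by
    rw [hM, hs, Finset.sum_biUnion fun l _ k _ h => hσ h]
    refine Finset.sum_congr rfl fun l _ => Finset.sum_congr rfl fun j hj => ?_
    rw [hxval l j hj, norm_mul, mul_comm ‖e l‖]
  have hM4 : M ≤ 4 := by
    rw [hMl]
    refine (Finset.sum_le_sum fun l _ => hup l _ (norm_nonneg (e l))).trans_eq ?_
    rw [← Finset.mul_sum, hesum, mul_one]
  have hNpos : 0 < N := by
    rcases Nat.eq_zero_or_pos N with h | h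
    · subst h; simp at hpos
    · exact h
  have hM32 : 1 / 32 ≤ M := by
    have hterm : ∀ l ∈ Finset.univ, ‖e l‖ ^ r / 16 - (2 * N : ℝ)⁻¹ / 16 ≤
        ∑ j ∈ σ l, c j ^ (-q) * orlicz q (‖a j‖ * ‖e l‖ * c j) := fun l _ => by
      rcases le_or_gt ((2 * N : ℝ)⁻¹) (‖e l‖ ^ r) with h | h
      · have h1 : ‖e l‖ ≤ 1 := by
          have h2 : ‖e l‖ ^ r ≤ 1 := by
            rw [← hesum]
            exact Finset.single_le_sum (f := fun l => ‖e l‖ ^ r) (fun k _ => by positivity)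
              (Finset.mem_univ l)
          by_contra! h4
          exact absurd h2 (not_le.2 (Real.one_lt_rpow h4 hr))
        have h3 : (0 : ℝ) ≤ (2 * N : ℝ)⁻¹ := by positivity
        exact le_trans (by linarith) (hlow l _ (norm_nonneg _) h1 h)
      · refine le_trans (by linarith) (Finset.sum_nonneg fun j _ => ?_)
        exact mul_nonneg (Real.rpow_nonneg (L.c_pos j).le _)
          (orlicz_nonneg q (mul_nonneg (by positivity) (L.c_pos j).le))
    have h1 := Finset.sum_le_sum hterm
    rw [← hMl, Finset.sum_sub_distrib, ← Finset.sum_div, hesum, Finset.sum_const,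
      Finset.card_univ, Fintype.card_fin, nsmul_eq_mul] at h1
    have hN' : (N : ℝ) ≠ 0 := by exact_mod_cast hNpos.ne'
    have h2 : (N : ℝ) * ((2 * N : ℝ)⁻¹ / 16) = 1 / 32 := by field_simp; norm_num
    linarith
  have hM0 : 0 < M := by linarith
  have hupper := L.toReal_eLpNorm_sum_le_modular hq1 hq2 x s hM4
  have hlower := L.min_modular_le_toReal_eLpNorm_sum hpq hq1 hq2 hp x s hM0 rfl
  set n := (eLpNorm (fun ω => ∑ j ∈ s, x j * ((Y j ω : ℝ) : 𝕜)) (ENNReal.ofReal q) P).toReal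
  have hqi : q⁻¹ ≤ 1 := inv_le_one_of_one_le₀ hq1.le
  have hn6 : n ≤ 6 := by
    have h1 : (4 : ℝ) ^ q⁻¹ ≤ 4 := by
      simpa using Real.rpow_le_rpow_of_exponent_le (show (1 : ℝ) ≤ 4 by norm_num) hqi
    have h2 : (4 : ℝ) ^ (2⁻¹ : ℝ) = 2 := by
      rw [show (4 : ℝ) = 2 ^ (2 : ℝ) by norm_num, ← Real.rpow_mul two_pos.le]; norm_num
    linarith
  have hn32 : 1 ≤ 32 * K * n := by
    have h0 : (1 / 32 : ℝ) ≤ min (M ^ q⁻¹) (M ^ (2⁻¹ : ℝ)) := by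
      have : ∀ t : ℝ, 0 ≤ t → t ≤ 1 → (1 / 32 : ℝ) ≤ M ^ t := fun t ht0 ht1 => by
        calc (1 / 32 : ℝ) = (1 / 32) ^ (1 : ℝ) := (Real.rpow_one _).symm
          _ ≤ (1 / 32) ^ t :=
            Real.rpow_le_rpow_of_exponent_ge (by norm_num) (by norm_num) ht1
          _ ≤ M ^ t := Real.rpow_le_rpow (by norm_num) hM32 ht0
      exact le_min (this _ (by positivity) hqi) (this _ (by norm_num) (by norm_num))
    linarith [h0.trans hlower]
  have hn0 : 0 ≤ n := ENNReal.toReal_nonneg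
  constructor
  · rw [inv_mul_le_iff₀ (by positivity)]
    calc ρ = ρ * 1 := (mul_one _).symm
      _ ≤ ρ * ((6 + 32 * K) * n) := by
        refine mul_le_mul_of_nonneg_left ?_ hρpos.le
        nlinarith
      _ = _ := by ring
  · rw [mul_comm]
    refine mul_le_mul_of_nonneg_right ?_ hρpos.le
    nlinarith

end HasLevels

end Modular

/-! ### Power functions as sums of dilates of the Orlicz function -/

section PowerFamily

theorem summable_dyadic_orlicz {q r : ℝ} (hr1 : q < r) (hr2 : r < 2) :
    Summable fun k : ℤ => (2 : ℝ) ^ (-(k * r)) * orlicz q ((2 : ℝ) ^ (k : ℝ)) := by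
  have hgeo : ∀ a : ℝ, 0 < a → Summable fun n : ℕ => ((2 : ℝ) ^ (-a)) ^ n := fun a ha =>
    summable_geometric_of_lt_one (by positivity)
      (Real.rpow_lt_one_of_one_lt_of_neg one_lt_two (by linarith))
  have hnn : ∀ k : ℤ, 0 ≤ (2 : ℝ) ^ (-(k * r)) * orlicz q ((2 : ℝ) ^ (k : ℝ)) := fun k =>
    mul_nonneg (by positivity) (orlicz_nonneg q (by positivity))
  have h2 : (0 : ℝ) < 2 := two_pos
  refine Summable.of_nat_of_neg ?_ ?_
  · refine (hgeo (r - q) (by linarith)).of_nonneg_of_le (fun n => hnn n) fun n => ?_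
    refine (mul_le_mul_of_nonneg_left (min_le_left _ _) (by positivity)).trans_eq ?_
    rw [← Real.rpow_mul h2.le, ← Real.rpow_add h2, ← Real.rpow_natCast, ← Real.rpow_mul h2.le]
    push_cast
    ring_nf
  · refine (hgeo (2 - r) (by linarith)).of_nonneg_of_le (fun n => hnn _) fun n => ?_
    refine (mul_le_mul_of_nonneg_left (min_le_right _ _) (by positivity)).trans_eq ?_
    rw [← Real.rpow_mul h2.le, ← Real.rpow_add h2, ← Real.rpow_natCast, ← Real.rpow_mul h2.le]
    push_cast
    ring_nf

theorem exists_zpow_two_le {t : ℝ} (ht : 0 < t) :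
    ∃ m : ℤ, (2 : ℝ) ^ (m : ℝ) ≤ t ∧ t < 2 * (2 : ℝ) ^ (m : ℝ) := by
  obtain ⟨m, h1, h2⟩ := exists_mem_Ico_zpow (y := (2 : ℝ)) ht one_lt_two
  refine ⟨m, by rwa [Real.rpow_intCast], ?_⟩
  rw [Real.rpow_intCast]
  rw [zpow_add_one₀ two_ne_zero] at h2
  linarith

/-- On a compact interval of `(0, ∞)`, the function `t ^ r` with `q < r < 2` is equivalent to a
finite positive combination of dilates of the Orlicz function, with constants that do not depend
on `r` or on the interval; the upper estimate holds on all of `[0, ∞)`. -/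
theorem exists_orlicz_family {q r t₀ D : ℝ} (hq : 0 < q) (hr1 : q < r) (hr2 : r < 2)
    (ht₀ : 0 < t₀) :
    ∃ (K : ℕ) (f μ : Fin K → ℝ), (∀ k, 0 < f k) ∧ (∀ k, 0 < μ k) ∧ (∀ k, μ k ≤ 1) ∧
      (∀ t, 0 ≤ t → ∑ k, μ k * orlicz q (f k * t) ≤ 4 * t ^ r) ∧
      (∀ t, t₀ ≤ t → t ≤ D → t ^ r / 8 ≤ ∑ k, μ k * orlicz q (f k * t)) := by
  have hr0 : 0 < r := hq.trans hr1
  have h2 : (0 : ℝ) < 2 := two_pos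
  have hrpow2 : (2 : ℝ) ^ r ≤ 4 := by
    calc (2 : ℝ) ^ r ≤ 2 ^ (2 : ℝ) := Real.rpow_le_rpow_of_exponent_le one_le_two hr2.le
      _ = 4 := by norm_num
  set g : ℤ → ℝ := fun k => (2 : ℝ) ^ (-(k * r)) * orlicz q ((2 : ℝ) ^ (k : ℝ)) with hg
  have hgnn : ∀ k, 0 ≤ g k := fun k =>
    mul_nonneg (by positivity) (orlicz_nonneg q (by positivity))
  have hsum : Summable g := summable_dyadic_orlicz hr1 hr2
  set S := ∑' k, g k with hS
  have hS0 : 0 < S := by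
    refine hsum.tsum_pos hgnn 0 ?_
    simp [hg, orlicz]
  obtain ⟨F₀, hF₀⟩ : ∃ F₀ : Finset ℤ, S / 2 ≤ ∑ k ∈ F₀, g k :=
    ((hsum.hasSum.eventually_const_le (half_lt_self hS0))).exists
  -- a finite window containing all translates that matter
  obtain ⟨W, hW⟩ : ∃ W : Finset ℤ, ∀ m : ℤ, ∀ t, t₀ ≤ t → t ≤ D → (2 : ℝ) ^ (m : ℝ) ≤ t →
      t < 2 * (2 : ℝ) ^ (m : ℝ) → m ∈ W := by
    rcases le_or_gt D 0 with hD | hD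
    · exact ⟨∅, fun m t h1 h3 _ _ => absurd (ht₀.trans_le (h1.trans h3)) (not_lt.2 hD)⟩
    obtain ⟨m₀, h0, -⟩ := exists_zpow_two_le ht₀
    obtain ⟨m₁, -, h1⟩ := exists_zpow_two_le hD
    have hlt : ∀ a b : ℤ, (2 : ℝ) ^ (a : ℝ) < 2 * 2 ^ (b : ℝ) → a ≤ b := fun a b h => by
      nth_rewrite 2 [← Real.rpow_one 2] at h
      rw [← Real.rpow_add h2, Real.rpow_lt_rpow_left_iff one_lt_two] at h
      have : a < 1 + b := by exact_mod_cast h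
      omega
    refine ⟨Finset.Icc m₀ m₁, fun m t h3 h4 h5 h6 => Finset.mem_Icc.2 ⟨?_, ?_⟩⟩
    · exact hlt _ _ (h0.trans_lt (h3.trans_lt h6))
    · exact hlt _ _ ((h5.trans h4).trans_lt h1)
  set F : Finset ℤ := W.biUnion fun m => F₀.image fun k => k - m with hF
  let G : ℝ → ℝ := fun t => ∑ k ∈ F, S⁻¹ * (2 : ℝ) ^ (-(k * r)) * orlicz q ((2 : ℝ) ^ (k : ℝ) * t)
  have hGmono : ∀ t t', 0 ≤ t → t ≤ t' → G t ≤ G t' := fun t t' h0 h =>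
    Finset.sum_le_sum fun k _ => mul_le_mul_of_nonneg_left
      (orlicz_mono hq.le (by positivity) (by gcongr)) (by positivity)
  have hGval : ∀ m : ℤ, G ((2 : ℝ) ^ (m : ℝ)) =
      S⁻¹ * ((2 : ℝ) ^ (m : ℝ)) ^ r * ∑ k ∈ F, g (k + m) := fun m => by
    simp only [G, hg]
    rw [Finset.mul_sum]
    refine Finset.sum_congr rfl fun k _ => ?_
    push_cast
    rw [← Real.rpow_add h2, ← mul_assoc, mul_assoc S⁻¹ (((2 : ℝ) ^ (m : ℝ)) ^ r),
      ← Real.rpow_mul h2.le, ← Real.rpow_add h2]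
    ring_nf
  have hup : ∀ t, 0 ≤ t → G t ≤ 4 * t ^ r := fun t ht => by
    rcases ht.eq_or_lt with rfl | ht
    · simp [G, orlicz_zero hq, Real.zero_rpow hr0.ne']
    obtain ⟨m, h1, h3⟩ := exists_zpow_two_le ht
    have h4 : (2 : ℝ) ^ ((m + 1 : ℤ) : ℝ) = 2 * 2 ^ (m : ℝ) := by
      push_cast; rw [Real.rpow_add h2, Real.rpow_one, mul_comm]
    refine (hGmono _ _ ht.le (h3.le.trans_eq h4.symm)).trans ?_
    rw [hGval, h4, Real.mul_rpow h2.le (by positivity)]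
    have h5 : ∑ k ∈ F, g (k + (m + 1)) ≤ S := by
      have : ∑ k ∈ F, g (k + (m + 1)) = ∑ k ∈ F.map (addRightEmbedding (m + 1)), g k := by simp
      rw [this]
      exact hsum.sum_le_tsum _ fun k _ => hgnn k
    calc S⁻¹ * (2 ^ r * ((2 : ℝ) ^ (m : ℝ)) ^ r) * ∑ k ∈ F, g (k + (m + 1))
        ≤ S⁻¹ * (4 * t ^ r) * S := by
          gcongr
          exact Finset.sum_nonneg fun k _ => hgnn _
      _ = 4 * t ^ r := by field_simp
  have hlow : ∀ t, t₀ ≤ t → t ≤ D → t ^ r / 8 ≤ G t := fun t h0 hD => by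
    have ht := ht₀.trans_le h0
    obtain ⟨m, h1, h3⟩ := exists_zpow_two_le ht
    refine le_trans ?_ (hGmono _ _ (by positivity) h1)
    rw [hGval]
    have h5 : S / 2 ≤ ∑ k ∈ F, g (k + m) := by
      have : ∑ k ∈ F, g (k + m) = ∑ k ∈ F.map (addRightEmbedding m), g k := by simp
      rw [this]
      refine hF₀.trans (Finset.sum_le_sum_of_subset_of_nonneg (fun k hk => ?_)
        fun k _ _ => hgnn k)
      refine Finset.mem_map.2 ⟨k - m, ?_, by simp⟩
      exact Finset.mem_biUnion.2 ⟨m, hW m t h0 hD h1 h3, Finset.mem_image.2 ⟨k, hk, rfl⟩⟩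
    have h6 : t ^ r ≤ 4 * ((2 : ℝ) ^ (m : ℝ)) ^ r := by
      calc t ^ r ≤ (2 * (2 : ℝ) ^ (m : ℝ)) ^ r := Real.rpow_le_rpow ht.le h3.le hr0.le
        _ = 2 ^ r * ((2 : ℝ) ^ (m : ℝ)) ^ r := Real.mul_rpow h2.le (by positivity)
        _ ≤ _ := by gcongr
    calc t ^ r / 8 ≤ S⁻¹ * ((2 : ℝ) ^ (m : ℝ)) ^ r * (S / 2) := by
          field_simp; linarith
      _ ≤ _ := by gcongr
  -- split the masses into pieces of size at most `1`
  obtain ⟨N, hN⟩ := exists_nat_gt (∑ k ∈ F, S⁻¹ * (2 : ℝ) ^ (-(k * r)))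
  have hN0 : (0 : ℝ) < N := lt_of_le_of_lt (Finset.sum_nonneg fun k _ => by positivity) hN
  let e := Fintype.equivFin (F × Fin N)
  refine ⟨_, fun i => (2 : ℝ) ^ (((e.symm i).1 : ℤ) : ℝ),
    fun i => S⁻¹ * (2 : ℝ) ^ (-((((e.symm i).1 : ℤ) : ℝ) * r)) / N, fun i => by positivity,
    fun i => by positivity, fun i => ?_, ?_⟩
  · rw [div_le_one hN0]
    refine le_trans ?_ hN.le
    exact Finset.single_le_sum (f := fun k : ℤ => S⁻¹ * (2 : ℝ) ^ (-(k * r)))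
      (fun k _ => by positivity) (e.symm i).1.2
  · have hsumG : ∀ t, ∑ i, S⁻¹ * (2 : ℝ) ^ (-((((e.symm i).1 : ℤ) : ℝ) * r)) / N *
        orlicz q ((2 : ℝ) ^ (((e.symm i).1 : ℤ) : ℝ) * t) = G t := fun t => by
      rw [e.symm.sum_comp fun x : F × Fin N => S⁻¹ * (2 : ℝ) ^ (-(((x.1 : ℤ) : ℝ) * r)) / N *
        orlicz q ((2 : ℝ) ^ ((x.1 : ℤ) : ℝ) * t), Fintype.sum_prod_type]
      simp only [Finset.sum_const, Finset.card_univ, Fintype.card_fin, nsmul_eq_mul]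
      rw [Finset.sum_coe_sort F fun k : ℤ => (N : ℝ) * (S⁻¹ * (2 : ℝ) ^ (-((k : ℝ) * r)) / N *
        orlicz q ((2 : ℝ) ^ (k : ℝ) * t))]
      refine Finset.sum_congr rfl fun k _ => ?_
      field_simp
    simp only [hsumG]
    exact ⟨hup, hlow⟩

end PowerFamily

/-! ### Existence of block weights satisfying Rosenthal's condition -/

section Existence

variable {𝕜 : Type*} [RCLike 𝕜]

/-- The levels are determined by the weights. -/
theorem HasLevels.level_eq {Ω : Type*} [MeasurableSpace Ω] {P : Measure Ω} {q : ℝ}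
    {Y : ℕ → Ω → ℝ} {c v : ℕ → ℝ} (L : HasLevels P q Y c v) (hq2 : q < 2) (j : ℕ) :
    c j = v j ^ (-(2 / (2 - q))) := by
  have h2q : 2 - q ≠ 0 := by linarith
  have h : (c j ^ (2 - q)) ^ (1 / (2 - q)) = ((v j ^ 2)⁻¹) ^ (1 / (2 - q)) := by rw [L.c_rpow]
  rw [← Real.rpow_mul (L.c_pos j).le, mul_one_div_cancel h2q, Real.rpow_one] at h
  rw [h, ← Real.rpow_two, ← Real.rpow_neg (L.v_pos j).le, ← Real.rpow_mul (L.v_pos j).le]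
  congr 1
  ring

theorem isRosenthalWeight_of_eq_rpow {s β : ℝ} (hs : 0 < s) (hβ0 : 0 < β) (hβ1 : β ≤ 1)
    {u : ℕ → ℝ} {f : ℕ → ℕ} (hf : Function.Injective f)
    (hu : ∀ j, u (f j) = (((j : ℝ) + 1) ^ (-β)) ^ (1 / s)) : IsRosenthalWeight s u := by
  refine ⟨f, hf, ?_, fun h => ?_⟩
  · simp only [hu]
    have h1 : Tendsto (fun j : ℕ => ((j : ℝ) + 1) ^ (-β)) atTop (𝓝 0) :=
      (tendsto_rpow_neg_atTop hβ0).comp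
        (tendsto_atTop_add_const_right _ _ tendsto_natCast_atTop_atTop)
    simpa [Real.zero_rpow (inv_pos.2 hs).ne'] using
      h1.rpow_const (p := 1 / s) (Or.inr (one_div_pos.2 hs).le)
  · refine not_lt.2 hβ1 ((Real.summable_one_div_nat_add_rpow 1 β).1 (h.congr fun j => ?_))
    have hj : (0 : ℝ) < (j : ℝ) + 1 := by positivity
    rw [hu, ← Real.rpow_mul (by positivity), one_div_mul_cancel hs.ne', Real.rpow_one,
      Real.rpow_neg hj.le, abs_of_pos hj, one_div]

/-- The index set of the construction: an atom for each block and each dilate used in it, together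
with a sequence of further indices. -/
abbrev BlockIndex (n K : ℕ → ℕ) : Type := (Σ i, Fin (n i) × Fin (K i)) ⊕ ℕ

theorem tendsto_cofinite_blockIndex {n K : ℕ → ℕ} {δ b : ℕ → ℝ} (hδ : Tendsto δ atTop (𝓝 0))
    (hb : Tendsto b atTop (𝓝 0)) :
    Tendsto (Sum.elim (fun x => δ x.1) b : BlockIndex n K → ℝ) cofinite (𝓝 0) := by
  have h1 : Tendsto (fun x : Σ i, Fin (n i) × Fin (K i) => δ x.1) cofinite (𝓝 0) := by
    rw [← Nat.cofinite_eq_atTop] at hδ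
    refine hδ.comp (Tendsto.cofinite_of_finite_preimage_singleton fun i => ?_)
    refine Set.Finite.subset (Set.finite_range fun y : Fin (n i) × Fin (K i) => ⟨i, y⟩) ?_
    rintro ⟨i', y⟩ (rfl : i' = i)
    exact ⟨y, rfl⟩
  rw [← Nat.cofinite_eq_atTop] at hb
  intro U hU
  rw [mem_map, mem_cofinite, ← Set.finite_preimage_inl_and_inr]
  exact ⟨mem_cofinite.1 (h1 hU), mem_cofinite.1 (hb hU)⟩

/-- There are weights of the required kind both of which satisfy Rosenthal's condition. -/
theorem exists_isBlockWeightChoice {p q : ℝ} (hpq : p.HolderConjugate q) (hp : 2 < p)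
    (hq1 : 1 < q) (hq2 : q < 2) {δ r : ℕ → ℝ} (n : ℕ → ℕ)
    (hδ_pos : ∀ i, 0 < δ i) (hδ_le : ∀ i, δ i ≤ 1) (hδ_lim : Tendsto δ atTop (𝓝 0))
    (hr_gt : ∀ i, q < r i) (hr_lt : ∀ i, r i < 2)
    (hδr : ∀ i, 1 / 2 < δ i ^ (q * (2 - r i) / (2 - q))) :
    ∃ W : WeightPair, IsBlockWeightChoice 𝕜 q δ r n W ∧
      IsRosenthalWeight (2 * q / (2 - q)) W.v ∧ IsRosenthalWeight (2 * q / (2 - q)) W.w := by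
  have hq0 : 0 < q := by linarith
  have h2q : 0 < 2 - q := by linarith
  set s := 2 * q / (2 - q) with hs_def
  have hs : 0 < s := by positivity
  have hr0 : ∀ i, 0 < r i := fun i => hq0.trans (hr_gt i)
  -- In a normalized combination of `n` blocks the coefficients below `t₀` carry less than half of the
  -- sum of the powers; the summand `1` keeps `t₀` positive when there are no blocks. The factor `D` is
  -- the dilation of the modular caused by passing from `v` to `δ v`.
  let t₀ : ℕ → ℝ := fun i => (2 * (n i : ℝ) + 1) ^ (-(1 / r i))
  let D : ℕ → ℝ := fun i => δ i ^ (-(q / (2 - q)))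
  have hD1 : ∀ i, 1 ≤ D i := fun i =>
    Real.one_le_rpow_of_pos_of_le_one_of_nonpos (hδ_pos i) (hδ_le i)
      (by have : 0 < q / (2 - q) := by positivity
          linarith)
  choose K f μ hf hμ hμ1 hup hlow using fun i =>
    exists_orlicz_family (t₀ := t₀ i) (D := D i) hq0 (hr_gt i) (hr_lt i)
      (show (0 : ℝ) < (2 * (n i : ℝ) + 1) ^ (-(1 / r i)) by positivity)
  obtain ⟨e⟩ : Nonempty (BlockIndex n K ≃ ℕ) := nonempty_equiv_of_countable
  -- `m` is `v ^ s` and `d` is `w / v`; on the additional coordinates `v ^ s` and `w ^ s` are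
  -- `(j + 1) ^ (-1 / 2)` and `(j + 1) ^ (-1)`, whose sums diverge
  let b : ℕ → ℝ := fun j => ((j : ℝ) + 1) ^ (-(1 / 2 : ℝ))
  have hb0 : ∀ j, 0 < b j := fun j => by positivity
  have hb1 : ∀ j, b j ≤ 1 := fun j =>
    Real.rpow_le_one_of_one_le_of_nonpos (by simp) (by norm_num)
  let m : BlockIndex n K → ℝ := Sum.elim (fun x => μ x.1 x.2.2) b
  let d : BlockIndex n K → ℝ := Sum.elim (fun x => δ x.1) fun j => b j ^ (1 / s)
  have hm0 : ∀ x, 0 < m x := by rintro (x | j); exacts [hμ _ _, hb0 j]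
  have hm1 : ∀ x, m x ≤ 1 := by rintro (x | j); exacts [hμ1 _ _, hb1 j]
  have hd0 : ∀ x, 0 < d x := by
    rintro (x | j); exacts [hδ_pos _, Real.rpow_pos_of_pos (hb0 j) _]
  have hd1 : ∀ x, d x ≤ 1 := by
    rintro (x | j)
    exacts [hδ_le _, Real.rpow_le_one (hb0 j).le (hb1 j) (one_div_pos.2 hs).le]
  have hdlim : Tendsto d cofinite (𝓝 0) := by
    refine tendsto_cofinite_blockIndex hδ_lim ?_
    have h1 : Tendsto b atTop (𝓝 0) :=
      (tendsto_rpow_neg_atTop (by norm_num)).comp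
        (tendsto_atTop_add_const_right _ _ tendsto_natCast_atTop_atTop)
    simpa [Real.zero_rpow (inv_pos.2 hs).ne'] using
      h1.rpow_const (p := 1 / s) (Or.inr (one_div_pos.2 hs).le)
  let v : ℕ → ℝ := fun j => m (e.symm j) ^ (1 / s)
  let w : ℕ → ℝ := fun j => d (e.symm j) * v j
  have hv0 : ∀ j, 0 < v j := fun j => Real.rpow_pos_of_pos (hm0 _) _
  have hv1 : ∀ j, v j ≤ 1 := fun j =>
    Real.rpow_le_one (hm0 _).le (hm1 _) (one_div_pos.2 hs).le
  have hw0 : ∀ j, 0 < w j := fun j => mul_pos (hd0 _) (hv0 j)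
  have hw1 : ∀ j, w j ≤ 1 := fun j => mul_le_one₀ (hd1 _) (hv0 j).le (hv1 j)
  have hratio : ∀ j, w j / v j = d (e.symm j) := fun j => mul_div_cancel_right₀ _ (hv0 j).ne'
  let W : WeightPair :=
    { v := v
      w := w
      v_pos := hv0
      w_pos := hw0
      ratio_le_one := fun j => by rw [hratio]; exact hd1 _
      ratio_tendsto := by
        simp only [hratio]
        rw [← Nat.cofinite_eq_atTop]
        exact hdlim.comp e.symm.injective.tendsto_cofinite }
  have hinr : Function.Injective fun j => e (Sum.inr j) := e.injective.comp Sum.inr_injective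
  refine ⟨W, ?_, ?_, ?_⟩
  · obtain ⟨Ω, mΩ, P, hP, Y, Z, hY, hZ, hvY, hwZ⟩ :=
      exists_isThreeValuedSystem hq1 hq2 hv0 hv1 hw0 hw1
    obtain ⟨cY, LY⟩ := hY.exists_hasLevels hq1 hvY
    obtain ⟨cZ, LZ⟩ := hZ.exists_hasLevels hq1 hwZ
    have hse : 1 / s * (2 / (2 - q)) = 1 / q := by rw [hs_def]; field_simp
    have hcY : ∀ j, cY j = m (e.symm j) ^ (-(1 / q)) := fun j => by
      rw [LY.level_eq hq2, ← Real.rpow_mul (hm0 _).le, mul_neg, hse]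
    have hcZ : ∀ j, cZ j = d (e.symm j) ^ (-(2 / (2 - q))) * m (e.symm j) ^ (-(1 / q)) :=
      fun j => by
        rw [LZ.level_eq hq2, Real.mul_rpow (hd0 _).le (hv0 j).le, ← Real.rpow_mul (hm0 _).le,
          mul_neg, hse]
    have hcY' : ∀ j, cY j ^ (-q) = m (e.symm j) := fun j => by
      rw [hcY, ← Real.rpow_mul (hm0 _).le, neg_mul_neg, one_div_mul_cancel hq0.ne', Real.rpow_one]
    have hcZ' : ∀ j, cZ j ^ (-q) = d (e.symm j) ^ s * m (e.symm j) := fun j => by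
      rw [hcZ, Real.mul_rpow (Real.rpow_nonneg (hd0 _).le _) (Real.rpow_nonneg (hm0 _).le _),
        ← Real.rpow_mul (hm0 _).le, ← Real.rpow_mul (hd0 _).le, neg_mul_neg, neg_mul_neg,
        one_div_mul_cancel hq0.ne', Real.rpow_one]
      congr 2
      rw [hs_def]; ring
    let α : BlockIndex n K → ℝ := Sum.elim (fun x => f x.1 x.2.2 * μ x.1 x.2.2 ^ (1 / q)) 0
    have hα : ∀ x, 0 ≤ α x := by
      rintro (x | j)
      · exact mul_nonneg (hf _ _).le (Real.rpow_nonneg (hμ _ _).le _)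
      · exact le_rfl
    let emb : ∀ y : (Σ i, Fin (n i)), Fin (K y.1) ↪ ℕ := fun y =>
      ⟨fun k => e (Sum.inl ⟨y.1, y.2, k⟩), fun k k' h => by simpa using h⟩
    let σ : (Σ i, Fin (n i)) → Finset ℕ := fun y => Finset.univ.map (emb y)
    have hσ : Pairwise fun y y' => Disjoint (σ y) (σ y') := by
      rintro ⟨i, l⟩ ⟨i', l'⟩ hne
      refine Finset.disjoint_left.2 fun j hj hj' => hne ?_
      obtain ⟨k, -, rfl⟩ := Finset.mem_map.1 hj
      obtain ⟨k', -, h⟩ := Finset.mem_map.1 hj'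
      have h1 := Sum.inl_injective (e.injective h)
      obtain ⟨rfl, h2⟩ := Sigma.mk.inj_iff.1 h1
      exact Sigma.ext rfl (heq_of_eq (Prod.mk.inj (eq_of_heq h2)).1.symm)
    have ht₀ : ∀ i (_ : Fin (n i)) t, 0 ≤ t → (2 * (n i : ℝ))⁻¹ ≤ t ^ r i → t₀ i ≤ t := by
      intro i l t ht h
      have hn : 0 < n i := l.pos
      have hn' : (0 : ℝ) < n i := by exact_mod_cast hn
      have h1 : (2 * (n i : ℝ) + 1)⁻¹ ≤ t ^ r i :=
        (inv_anti₀ (by positivity) (by linarith)).trans h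
      have h2 := Real.rpow_le_rpow (by positivity) h1 (one_div_pos.2 (hr0 i)).le
      rw [← Real.rpow_mul ht, mul_one_div_cancel (hr0 i).ne', Real.rpow_one] at h2
      refine le_trans (le_of_eq ?_) h2
      rw [Real.inv_rpow (by positivity), ← Real.rpow_neg (by positivity)]
    -- the modulars of the blocks
    have hmodY : ∀ i l t, ∑ j ∈ σ ⟨i, l⟩, cY j ^ (-q) *
        orlicz q (‖((α (e.symm j) : ℝ) : 𝕜)‖ * t * cY j) =
        ∑ k, μ i k * orlicz q (f i k * t) := by
      intro i l t
      rw [Finset.sum_map]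
      refine Finset.sum_congr rfl fun k _ => ?_
      rw [hcY', hcY, RCLike.norm_ofReal, abs_of_nonneg (hα _)]
      have hk : e.symm (emb ⟨i, l⟩ k) = Sum.inl ⟨i, l, k⟩ := e.symm_apply_apply _
      rw [hk]
      change μ i k * orlicz q (f i k * μ i k ^ (1 / q) * t * μ i k ^ (-(1 / q))) = _
      have h1 : μ i k ^ (1 / q) * μ i k ^ (-(1 / q)) = 1 := by
        rw [← Real.rpow_add (hμ i k), add_neg_cancel, Real.rpow_zero]
      congr 2
      linear_combination f i k * t * h1
    have hmodZ : ∀ i l t, ∑ j ∈ σ ⟨i, l⟩, cZ j ^ (-q) *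
        orlicz q (‖(δ i : 𝕜) * ((α (e.symm j) : ℝ) : 𝕜)‖ * t * cZ j) =
        δ i ^ s * ∑ k, μ i k * orlicz q (f i k * (D i * t)) := by
      intro i l t
      rw [Finset.sum_map, Finset.mul_sum]
      refine Finset.sum_congr rfl fun k _ => ?_
      rw [hcZ', hcZ, norm_mul, RCLike.norm_ofReal, RCLike.norm_ofReal, abs_of_nonneg (hα _),
        abs_of_pos (hδ_pos i)]
      have hk : e.symm (emb ⟨i, l⟩ k) = Sum.inl ⟨i, l, k⟩ := e.symm_apply_apply _
      rw [hk, mul_assoc]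
      change δ i ^ s * (μ i k * orlicz q (δ i * (f i k * μ i k ^ (1 / q)) * t *
        (δ i ^ (-(2 / (2 - q))) * μ i k ^ (-(1 / q))))) = _
      have h1 : μ i k ^ (1 / q) * μ i k ^ (-(1 / q)) = 1 := by
        rw [← Real.rpow_add (hμ i k), add_neg_cancel, Real.rpow_zero]
      have h2 : δ i * δ i ^ (-(2 / (2 - q))) = D i := by
        nth_rewrite 1 [← Real.rpow_one (δ i)]
        rw [← Real.rpow_add (hδ_pos i)]
        simp only [D]
        congr 1
        field_simp
        ring
      congr 3
      rw [← h2]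
      linear_combination f i k * t * δ i * δ i ^ (-(2 / (2 - q))) * h1
    have hθ : ∀ i, δ i ^ s * D i ^ r i = δ i ^ (q * (2 - r i) / (2 - q)) := fun i => by
      simp only [D]
      rw [← Real.rpow_mul (hδ_pos i).le, ← Real.rpow_add (hδ_pos i), hs_def]
      congr 1
      ring
    have hθ1 : ∀ i, δ i ^ (q * (2 - r i) / (2 - q)) ≤ 1 := fun i =>
      Real.rpow_le_one (hδ_pos i).le (hδ_le i)
        (div_nonneg (mul_nonneg hq0.le (by linarith [hr_lt i])) h2q.le)
    refine ⟨Ω, mΩ, P, hP, Y, Z, σ, fun j => ((α (e.symm j) : ℝ) : 𝕜),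
      6 + 32 * HasLevels.dualityConst p, hY, hZ, hvY, hwZ, hσ, ?_, ?_, fun i => ⟨?_, ?_⟩⟩
    · rintro ⟨i, l⟩ j hj
      obtain ⟨k, -, rfl⟩ := Finset.mem_map.1 hj
      change d (e.symm (e _)) * _ = _
      rw [e.symm_apply_apply]
      rfl
    · have := HasLevels.dualityConst_pos p
      positivity
    · refine LY.isEquivToEllR_of_modular hpq hq1 hq2 hp (hr0 i)
        (fun l k h => hσ (by simpa using h)) _ (fun l t ht => ?_) fun l t ht ht1 h => ?_
      · rw [hmodY]
        exact hup i t ht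
      · rw [hmodY]
        have h1 := hlow i t (ht₀ i l t ht h) (ht1.trans (hD1 i))
        have h2 : 0 ≤ t ^ r i := Real.rpow_nonneg ht _
        linarith
    · refine LZ.isEquivToEllR_of_modular hpq hq1 hq2 hp (hr0 i)
        (fun l k h => hσ (by simpa using h)) (fun j => (δ i : 𝕜) * ((α (e.symm j) : ℝ) : 𝕜))
        (fun l t ht => ?_) fun l t ht ht1 h => ?_
      · rw [hmodZ]
        have hD0 : 0 ≤ D i := zero_le_one.trans (hD1 i)
        calc δ i ^ s * ∑ k, μ i k * orlicz q (f i k * (D i * t))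
            ≤ δ i ^ s * (4 * (D i * t) ^ r i) :=
              mul_le_mul_of_nonneg_left (hup i _ (mul_nonneg hD0 ht))
                (Real.rpow_nonneg (hδ_pos i).le _)
          _ = (δ i ^ s * D i ^ r i) * (4 * t ^ r i) := by
              rw [Real.mul_rpow hD0 ht]; ring
          _ ≤ 1 * (4 * t ^ r i) := by
              rw [hθ]
              exact mul_le_mul_of_nonneg_right (hθ1 i) (by positivity)
          _ = _ := one_mul _
      · rw [hmodZ]
        have hD0 : 0 ≤ D i := zero_le_one.trans (hD1 i)
        have h1 := hlow i (D i * t)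
          ((ht₀ i l t ht h).trans (le_mul_of_one_le_left ht (hD1 i)))
          (mul_le_of_le_one_right hD0 ht1)
        have h2 : 0 ≤ t ^ r i := Real.rpow_nonneg ht _
        calc t ^ r i / 16 ≤ (δ i ^ s * D i ^ r i) * (t ^ r i / 8) := by
              rw [hθ]; nlinarith [hδr i]
          _ = δ i ^ s * ((D i * t) ^ r i / 8) := by
              rw [Real.mul_rpow hD0 ht]; ring
          _ ≤ _ := mul_le_mul_of_nonneg_left h1 (Real.rpow_nonneg (hδ_pos i).le _)
  · refine isRosenthalWeight_of_eq_rpow hs (β := 1 / 2) (by norm_num) (by norm_num) hinr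
      fun j => ?_
    change m (e.symm (e _)) ^ (1 / s) = _
    rw [e.symm_apply_apply]
    rfl
  · refine isRosenthalWeight_of_eq_rpow hs one_pos le_rfl hinr fun j => ?_
    change d (e.symm (e _)) * m (e.symm (e _)) ^ (1 / s) = _
    rw [e.symm_apply_apply]
    change b j ^ (1 / s) * b j ^ (1 / s) = _
    rw [← Real.mul_rpow (hb0 j).le (hb0 j).le]
    congr 1
    simp only [b]
    rw [← Real.rpow_add (by positivity)]
    norm_num

end Existence

end

theorem proposition3 (𝕜 : Type*) [RCLike 𝕜] (p q : ℝ) (hpq : p.HolderConjugate q)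
    (hq1 : 1 < q) (hq2 : q < 2) [Fact (1 ≤ ENNReal.ofReal p)]
    (δ r : ℕ → ℝ) (n : ℕ → ℕ)
    (hδ_pos : ∀ i, 0 < δ i) (hδ_le : ∀ i, δ i ≤ 1) (hδ_anti : Antitone δ)
    (hδ_lim : Tendsto δ atTop (𝓝 0))
    (hr_gt : ∀ i, q < r i) (hr_lt : ∀ i, r i < 2) (hr_mono : Monotone r)
    (hr_lim : Tendsto r atTop (𝓝 2))
    (hδr : ∀ i, 1 / 2 < δ i ^ (q * (2 - r i) / (2 - q)))
    (hn : Tendsto (fun i => (n i : ℝ) ^ (1 / r i - 1 / 2)) atTop atTop) :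
    (∃ W : WeightPair, IsBlockWeightChoice 𝕜 q δ r n W ∧
      ∃ S : RosenthalXDual 𝕜 (ENNReal.ofReal p) W.w ≃L[𝕜]
          RosenthalXDual 𝕜 (ENNReal.ofReal p) W.v,
        ‖(S : RosenthalXDual 𝕜 (ENNReal.ofReal p) W.w →L[𝕜]
          RosenthalXDual 𝕜 (ENNReal.ofReal p) W.v)‖ = 1) ∧
    ∀ W : WeightPair, IsBlockWeightChoice 𝕜 q δ r n W →
      ∀ S : RosenthalXDual 𝕜 (ENNReal.ofReal p) W.w ≃L[𝕜]
          RosenthalXDual 𝕜 (ENNReal.ofReal p) W.v,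
        ‖(S : RosenthalXDual 𝕜 (ENNReal.ofReal p) W.w →L[𝕜]
          RosenthalXDual 𝕜 (ENNReal.ofReal p) W.v)‖ = 1 →
        ∀ T : RosenthalXDual 𝕜 (ENNReal.ofReal p) W.v →L[𝕜]
          RosenthalXDual 𝕜 (ENNReal.ofReal p) W.v,
          T = (S : RosenthalXDual 𝕜 (ENNReal.ofReal p) W.w →L[𝕜]
            RosenthalXDual 𝕜 (ENNReal.ofReal p) W.v).comp (W.DeltaAdj 𝕜 (ENNReal.ofReal p)) →
          IsOneUnconditionalBasis 𝕜 (dualUnitVector 𝕜 (ENNReal.ofReal p) W.v) ∧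
          ‖T‖ ≤ 1 ∧
          PreservesFarFromEuclidean T ∧
          HilbertianOnTails (dualUnitVector 𝕜 (ENNReal.ofReal p) W.v) T := by
  have hp : 2 < p := two_lt_of_holderConjugate hpq hq2
  have hpt : (ENNReal.ofReal p).toReal = p := ENNReal.toReal_ofReal hpq.nonneg
  have hqt : (ENNReal.ofReal q).toReal = q := ENNReal.toReal_ofReal hpq.symm.nonneg
  refine ⟨?_, fun W hW S hS T hT => ⟨?_, ?_, ?_, ?_⟩⟩
  · obtain ⟨W, hW, hv, hw⟩ := exists_isBlockWeightChoice (𝕜 := 𝕜) hpq hp hq1 hq2 n hδ_pos hδ_le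
      hδ_lim hr_gt hr_lt hδr
    have h2q : 0 < 2 - q := by linarith
    have hsp : 1 / (2 * q / (2 - q)) = 1 / 2 - 1 / p := by
      have h1 := hpq.inv_add_inv_eq_one
      have hq0 : q ≠ 0 := hpq.symm.ne_zero
      have h2 : 1 / p = 1 - 1 / q := by rw [one_div, one_div]; linarith
      rw [h2]
      field_simp
      ring
    exact ⟨W, hW, hw.exists_dual_equiv_norm_eq_one 𝕜 hpq
      (div_pos (mul_pos two_pos hpq.symm.pos) h2q) hsp W.w_pos W.v_pos hv⟩
  · have _ : Fact (1 ≤ ENNReal.ofReal q) := ⟨by simpa using hq1.le⟩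
    have _ : (ENNReal.ofReal q).HolderConjugate (ENNReal.ofReal p) :=
      hpq.symm.ennrealOfReal
    exact isOneUnconditionalBasis_dualUnitVector (q := ENNReal.ofReal q)
      (by rw [hpt, hqt]; exact hpq)
  · rw [hT]
    refine ContinuousLinearMap.opNorm_le_bound _ zero_le_one fun f => ?_
    rw [one_mul]
    refine ((S : RosenthalXDual 𝕜 (ENNReal.ofReal p) W.w →L[𝕜]
      RosenthalXDual 𝕜 (ENNReal.ofReal p) W.v).le_opNorm (W.DeltaAdj 𝕜 _ f)).trans ?_
    rw [hS, one_mul]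
    exact W.norm_DeltaAdj_apply_le f
  · rw [hT]
    exact preservesFarFromEuclidean_comp_DeltaAdj hpq hq1 hq2 hr_gt hn hW S
  · rw [hT]
    exact hilbertianOnTails_comp_DeltaAdj W _ hS.le
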